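/- Let $d,n\ge 0$, $Y=\mathbb Z^d$, $\mathfrak t_{\mathbb R}=\mathbb R^d$, $\mathfrak t=\mathbb C^d$, let $\xi_1,\dots,\xi_n\in\mathbb Z^d=\mathrm{Hom}(Y,\mathbb Z)$ be weights and $b_1,\dots,b_n\in\mathbb C$ flavor parameters. Let $\mathcal A$ be the quantized abelian Coulomb branch at $\hbar=1$: the $\mathbb C$-algebra that is a free left $\mathbb C[\mathfrak t]$-module with basis $r^\lambda$ $(\lambda\in Y)$, with $r^\lambda\alpha=(\alpha+\alpha(\lambda))r^\lambda$ for $\alpha\in\mathfrak t^*$ and $r^\lambda r^\mu=\prod_{i=1}^n A_i(\lambda,\mu)\,r^{\lambda+\mu}$, where, with $p=\xi_i(\lambda)$, $q=\xi_i(\mu)$, $D=\min(|p|,|q|)$, one has $A_i(\lambda,\mu)=\prod_{j=1}^{D}(\xi_i+b_i+p-j+\tfrac12)$ if $p\ge 0\ge q$, $A_i(\lambda,\mu)=\prod_{j=1}^{D}(\xi_i+b_i+p+j-\tfrac12)$ if $p\le 0\le q$, and $A_i(\lambda,\mu)=1$ otherwise. Let $\rho$ be an antilinear ring automorphism of $\mathcal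 A$ with $\rho(\mathbb C[\mathfrak t]r^\lambda)\subseteq\mathbb C[\mathfrak t]r^{-\lambda}$ for all $\lambda\in Y$ and $\rho(\alpha)=-\alpha$ for every coordinate function $\alpha$ on $\mathfrak t$, and let $\zeta\in\mathfrak t^*$ be such that $\rho^2(r^\lambda)=e^{2\pi \mathrm i\zeta(\lambda)}r^\lambda$ for all $\lambda\in Y$. Let $T\colon\mathcal A\to\mathbb C$ be a positive trace: $T$ is linear, $T(ab)=T(b\rho^2(a))$ for all $a,b\in\mathcal A$, and $T(a\rho(a))>0$ for all nonzero $a\in\mathcal A$. Let $u_T=\sum_{k\in\mathbb Z_{\ge 0}^d}\frac{T(x^k)}{k!}y^k$ be the exponential generating function of $T|_{\mathbb C[\mathfrak t]}$, a formal power series in the coordinates $y$ of $\mathfrak t^*$; for $\mu\in\mathfrak t$ let $e^\mu$ denote the function $y\mapsto e^{\mu(y)}$ and its Taylor series at $0$. Let $I$ be the finite set of all lines in $\mathfrak t_{\mathbb R}$ that are intersections of some (possibly none) of the hyperplanes $\xi_j=0$; for each $l\in I$ choose a shortest nonzero coweight $\lambda_l\in l\cap Y$. Put $$\Delta=\prod_{l\in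 I}\bigl(e^{\frac12\lambda_l}-e^{2\pi \mathrm i\zeta(\lambda_l)}e^{-\frac12\lambda_l}\bigr),\qquad \mathcal P=\sum_{l\in I}[-\tfrac12,\tfrac12]\lambda_l\subset\mathfrak t_{\mathbb R}.$$ Then $\Delta\,u_T=\sum_\mu S_\mu e^\mu$ for some finite set of exponents $\mu\in\mathfrak t$ and nonzero polynomials $S_\mu\in\mathbb C[\mathfrak t^*]$; such a sum is called the numerator of $u_T$. For every such numerator the following holds. 1. The function $u=\Delta^{-1}\sum_\mu S_\mu e^\mu$ extends to a continuous function on all of $\mathfrak t_{\mathbb R}^*$, with $u(0)=T(1)$, and is bounded there: $|u(x)|\le u(0)$ for all $x\in\mathfrak t_{\mathbb R}^*$. 2. For every exponent $\mu$ of the numerator, $\operatorname{Re}\mu\in\mathcal P$. 3. If $\operatorname{Re}\mu$ lies in a face $F$ of $\mathcal P$ and $U\subseteq\mathfrak t_{\mathbb R}$ is the linear part (direction space) of the affine hull of $F$, then $S_\mu\in\mathbb C[U_{\mathbb C}^*]$, i.e. $S_\mu$ is a polynomial in the elements of $U$, regarded as linear functions on $\mathfrak t^*$. -/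

import Mathlib

/-!
Coordinates: the torus is `(ℂˣ)^d`, its coweight lattice `Y` is `Fin d → ℤ`, so that `𝔱 = Fin d → ℂ`
and `𝔱_ℝ = Fin d → ℝ`; weights are elements of `Fin d → ℤ`, paired with coweights by the dot
product. The ring `ℂ[𝔱]` is `MvPolynomial (Fin d) ℂ`, its variables being the coordinates of `𝔱`.
-/

noncomputable section

namespace AbelianCoulomb

open MvPolynomial

variable {d n : ℕ}

/-- The pairing `ξ(v)` of a weight with a coweight. -/
def pair (x v : Fin d → ℤ) : ℤ := ∑ k, x k * v k

/-- The linear form `∑ c_k x_k` as a polynomial. -/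
def linForm (c : Fin d → ℂ) : MvPolynomial (Fin d) ℂ := ∑ k, C (c k) * X k

/-- The shift of argument `(S_v f)(m) = f (v + m)` by a coweight `v`. -/
def shift (v : Fin d → ℤ) : MvPolynomial (Fin d) ℂ →ₐ[ℂ] MvPolynomial (Fin d) ℂ :=
  aeval fun k => X k + C (v k : ℂ)

/-- The contribution of one weight to the multiplication of two basis elements: `x` is the weight
plus its flavor, `p` and `q` are the values of the weight on the two coweights. -/
def factor (x : MvPolynomial (Fin d) ℂ) (p q : ℤ) : MvPolynomial (Fin d) ℂ :=
  if 0 ≤ p ∧ q ≤ 0 then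
    ∏ j ∈ Finset.Icc 1 (min p.natAbs q.natAbs), (x + C ((p : ℂ) - (j : ℂ) + 1 / 2))
  else if p ≤ 0 ∧ 0 ≤ q then
    ∏ j ∈ Finset.Icc 1 (min p.natAbs q.natAbs), (x + C ((p : ℂ) + (j : ℂ) - 1 / 2))
  else 1

/-- The structure constant of `r^v r^w = (∏ i, A_i(v, w)) r^(v + w)`. -/
def structConst (ξ : Fin n → Fin d → ℤ) (b : Fin n → ℂ) (v w : Fin d → ℤ) :
    MvPolynomial (Fin d) ℂ :=
  ∏ i, factor (linForm (fun k => (ξ i k : ℂ)) + C (b i)) (pair (ξ i) v) (pair (ξ i) w)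

/-- The quantized abelian Coulomb branch (at `ħ = 1`) with weights `ξ` and flavors `b`: the free left
`ℂ[𝔱]`-module on the basis `r^v`, `v ∈ Y`. The value at `v` is the left coefficient of `r^v`. -/
def CoulombBranch (_ξ : Fin n → Fin d → ℤ) (_b : Fin n → ℂ) : Type :=
  (Fin d → ℤ) →₀ MvPolynomial (Fin d) ℂ

variable {ξ : Fin n → Fin d → ℤ} {b : Fin n → ℂ}

instance : AddCommGroup (CoulombBranch ξ b) :=
  inferInstanceAs (AddCommGroup ((Fin d → ℤ) →₀ MvPolynomial (Fin d) ℂ))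

instance : Module ℂ (CoulombBranch ξ b) :=
  inferInstanceAs (Module ℂ ((Fin d → ℤ) →₀ MvPolynomial (Fin d) ℂ))

variable (ξ b) in
/-- The element `f r^v`. -/
def mono (v : Fin d → ℤ) (f : MvPolynomial (Fin d) ℂ) : CoulombBranch ξ b := Finsupp.single v f

/-- Bilinear extension of `(f r^v) (h r^w) = f S_v(h) r^v r^w`, which encodes the relation
`r^v α = (α + α(v)) r^v` for `α ∈ 𝔱^*`. -/
instance : Mul (CoulombBranch ξ b) where
  mul x y := Finsupp.sum x fun v f => Finsupp.sum y fun w h =>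
    mono ξ b (v + w) (f * shift v h * structConst ξ b v w)

instance : One (CoulombBranch ξ b) where
  one := mono ξ b 0 1

theorem mono_zero (v : Fin d → ℤ) : mono ξ b v 0 = 0 := Finsupp.single_zero v

theorem mono_add (v : Fin d → ℤ) (f h : MvPolynomial (Fin d) ℂ) :
    mono ξ b v (f + h) = mono ξ b v f + mono ξ b v h := Finsupp.single_add v f h

theorem smul_mono (c : ℂ) (v : Fin d → ℤ) (f : MvPolynomial (Fin d) ℂ) :
    c • mono ξ b v f = mono ξ b v (c • f) := Finsupp.smul_single c v f

theorem induction_mono {p : CoulombBranch ξ b → Prop} (x : CoulombBranch ξ b) (h0 : p 0)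
    (hadd : ∀ x y, p x → p y → p (x + y)) (hm : ∀ v f, p (mono ξ b v f)) : p x :=
  Finsupp.induction_linear (motive := p) x h0 hadd hm

theorem mul_def' (x y : CoulombBranch ξ b) : x * y = Finsupp.sum x fun v f => Finsupp.sum y fun w h =>
    mono ξ b (v + w) (f * shift v h * structConst ξ b v w) := rfl

theorem mono_mul_mono (v w : Fin d → ℤ) (f h : MvPolynomial (Fin d) ℂ) :
    mono ξ b v f * mono ξ b w h = mono ξ b (v + w) (f * shift v h * structConst ξ b v w) := by
  rw [mul_def', mono, Finsupp.sum_single_index, mono, Finsupp.sum_single_index]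
  · simp [mono_zero]
  · simp [mono_zero, Finsupp.sum]

theorem add_mul' (x y z : CoulombBranch ξ b) : (x + y) * z = x * z + y * z := by
  simp only [mul_def']
  refine Finsupp.sum_add_index' (fun v => ?_) (fun v f h => ?_)
  · simp [mono_zero, Finsupp.sum]
  · simp [add_mul, mono_add, Finsupp.sum, Finset.sum_add_distrib]

theorem mul_add' (x y z : CoulombBranch ξ b) : x * (y + z) = x * y + x * z := by
  simp only [mul_def']
  refine Eq.trans ?_ (Finsupp.sum_add (f := x) (h₁ := fun v f => Finsupp.sum y fun w h =>
    mono ξ b (v + w) (f * shift v h * structConst ξ b v w)) (h₂ := fun v f => Finsupp.sum z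
    fun w h => mono ξ b (v + w) (f * shift v h * structConst ξ b v w)))
  refine congrArg _ (funext fun v => funext fun f => ?_)
  refine Finsupp.sum_add_index' (fun w => ?_) (fun w g h => ?_)
  · simp [mono_zero]
  · simp [add_mul, mul_add, mono_add]

theorem zero_mul' (x : CoulombBranch ξ b) : 0 * x = 0 := by
  have := add_mul' 0 0 x
  simpa using this

theorem mul_zero' (x : CoulombBranch ξ b) : x * 0 = 0 := by
  have := mul_add' x 0 0
  simpa using this

theorem pair_add (x v w : Fin d → ℤ) : pair x (v + w) = pair x v + pair x w := by
  simp [pair, mul_add, Finset.sum_add_distrib]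

theorem pair_zero (x : Fin d → ℤ) : pair x 0 = 0 := by simp [pair]

theorem shift_linForm (x v : Fin d → ℤ) :
    shift v (linForm fun k => (x k : ℂ)) = linForm (fun k => (x k : ℂ)) + C (pair x v : ℂ) := by
  simp [shift, linForm, pair, mul_add, Finset.sum_add_distrib]

theorem shift_zero (f : MvPolynomial (Fin d) ℂ) : shift 0 f = f := by
  have : shift (0 : Fin d → ℤ) = AlgHom.id ℂ _ := by
    ext k; simp [shift]
  rw [this]; rfl

theorem shift_shift (v w : Fin d → ℤ) (f : MvPolynomial (Fin d) ℂ) :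
    shift v (shift w f) = shift (v + w) f := by
  have : (shift v).comp (shift w) = shift (v + w) := by
    ext1 k; simp [shift, add_assoc]
  rw [← this]; rfl

theorem shift_factor (v : Fin d → ℤ) (x : MvPolynomial (Fin d) ℂ) (p q : ℤ) :
    shift v (factor x p q) = factor (shift v x) p q := by
  unfold factor
  split_ifs <;> simp [map_prod, algHom_C, algebraMap_eq]

theorem factor_eq_prod (x : MvPolynomial (Fin d) ℂ) (c p q M : ℤ)
    (hM : |c| + |p| + |q| ≤ M) :
    factor (x + C (c : ℂ)) p q = ∏ k ∈ Finset.Ico (-M) M,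
      if (c ≤ k ∧ c + p + q ≤ k ∧ k < c + p) ∨ (k < c ∧ c + p ≤ k ∧ k < c + p + q)
      then x + C ((k : ℂ) + 1 / 2) else 1 := by
  rw [← Finset.prod_filter]
  unfold factor
  split_ifs with h1 h2
  · refine Finset.prod_nbij' (fun j => c + p - (j : ℤ)) (fun k => (c + p - k).toNat) ?_ ?_ ?_ ?_ ?_
    · intro j hj
      simp only [Finset.mem_Icc, Finset.mem_filter, Finset.mem_Ico] at *
      rw [abs_eq_max_neg, abs_eq_max_neg, abs_eq_max_neg] at hM
      omega
    · intro k hk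
      simp only [Finset.mem_Icc, Finset.mem_filter, Finset.mem_Ico] at *
      omega
    · intro j hj
      simp
    · intro k hk
      simp only [Finset.mem_filter, Finset.mem_Ico] at *
      omega
    · intro j hj
      push_cast
      rw [add_assoc, ← C_add]
      congr 2
      ring
  · refine Finset.prod_nbij' (fun j => c + p + (j : ℤ) - 1) (fun k => (k + 1 - c - p).toNat)
      ?_ ?_ ?_ ?_ ?_
    · intro j hj
      simp only [Finset.mem_Icc, Finset.mem_filter, Finset.mem_Ico] at *
      rw [abs_eq_max_neg, abs_eq_max_neg, abs_eq_max_neg] at hM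
      omega
    · intro k hk
      simp only [Finset.mem_Icc, Finset.mem_filter, Finset.mem_Ico] at *
      omega
    · intro j hj
      simp only [Finset.mem_Icc] at hj
      omega
    · intro k hk
      simp only [Finset.mem_filter, Finset.mem_Ico] at *
      omega
    · intro j hj
      push_cast
      rw [add_assoc, ← C_add]
      congr 2
      ring
  · rw [Finset.filter_false_of_mem, Finset.prod_empty]
    intro k hk
    omega

theorem factor_cocycle (x : MvPolynomial (Fin d) ℂ) (p q r : ℤ) :
    factor x p q * factor x (p + q) r = factor (x + C (p : ℂ)) q r * factor x p (q + r) := by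
  have hx : ∀ s t, factor x s t = factor (x + C ((0 : ℤ) : ℂ)) s t := by simp
  rw [hx p q, hx (p + q) r, hx p (q + r)]
  have e : ∀ s : ℤ, |s| = max s (-s) := fun s => abs_eq_max_neg
  set M : ℤ := 2 * (|p| + |q| + |r|) with hM
  have h1 := abs_add_le p q
  have h2 := abs_add_le q r
  have a1 := abs_nonneg p
  have a2 := abs_nonneg q
  have a3 := abs_nonneg r
  rw [factor_eq_prod x 0 p q M (by rw [abs_zero]; omega),
    factor_eq_prod x 0 (p + q) r M (by rw [abs_zero]; omega),
    factor_eq_prod x p q r M (by omega),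
    factor_eq_prod x 0 p (q + r) M (by rw [abs_zero]; omega),
    ← Finset.prod_mul_distrib, ← Finset.prod_mul_distrib]
  refine Finset.prod_congr rfl fun k _ => ?_
  split_ifs <;> first | rfl | (exfalso; omega) | simp

theorem structConst_cocycle (u v w : Fin d → ℤ) :
    structConst ξ b u v * structConst ξ b (u + v) w =
      shift u (structConst ξ b v w) * structConst ξ b u (v + w) := by
  simp only [structConst, map_prod, shift_factor, ← Finset.prod_mul_distrib, pair_add]
  refine Finset.prod_congr rfl fun i _ => ?_
  rw [factor_cocycle, map_add, shift_linForm]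
  congr 2
  simp [shift]
  ring

theorem factor_zero_left (x : MvPolynomial (Fin d) ℂ) (q : ℤ) : factor x 0 q = 1 := by
  unfold factor; split_ifs <;> simp

theorem factor_zero_right (x : MvPolynomial (Fin d) ℂ) (p : ℤ) : factor x p 0 = 1 := by
  unfold factor; split_ifs <;> simp

theorem mul_assoc' (x y z : CoulombBranch ξ b) : x * y * z = x * (y * z) := by
  induction x using induction_mono with
  | h0 => simp only [zero_mul']
  | hadd x x' hx hx' => simp only [add_mul', hx, hx']
  | hm u f =>
    induction y using induction_mono with
    | h0 => simp only [zero_mul', mul_zero']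
    | hadd y y' hy hy' => simp only [add_mul', mul_add', hy, hy']
    | hm v g =>
      induction z using induction_mono with
      | h0 => simp only [mul_zero']
      | hadd z z' hz hz' => simp only [mul_add', hz, hz']
      | hm w h =>
        simp only [mono_mul_mono, map_mul, shift_shift, add_assoc]
        congr 1
        linear_combination (f * shift u g * shift (u + v) h) * structConst_cocycle u v w

theorem one_mul' (x : CoulombBranch ξ b) : 1 * x = x := by
  induction x using induction_mono with
  | h0 => exact mul_zero' 1
  | hadd x y hx hy => rw [mul_add', hx, hy]
  | hm v f =>
    change mono ξ b 0 1 * _ = _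
    rw [mono_mul_mono]
    simp [structConst, pair_zero, factor_zero_left, shift_zero]

theorem mul_one' (x : CoulombBranch ξ b) : x * 1 = x := by
  induction x using induction_mono with
  | h0 => exact zero_mul' 1
  | hadd x y hx hy => rw [add_mul', hx, hy]
  | hm v f =>
    change _ * mono ξ b 0 1 = _
    rw [mono_mul_mono]
    simp [structConst, pair_zero, factor_zero_right]

instance : Ring (CoulombBranch ξ b) :=
  { (inferInstance : AddCommGroup (CoulombBranch ξ b)), (inferInstance : Mul (CoulombBranch ξ b)),
    (inferInstance : One (CoulombBranch ξ b)) with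
    left_distrib := mul_add'
    right_distrib := add_mul'
    zero_mul := zero_mul'
    mul_zero := mul_zero'
    mul_assoc := mul_assoc'
    one_mul := one_mul'
    mul_one := mul_one' }

theorem smul_mul' (c : ℂ) (x y : CoulombBranch ξ b) : c • x * y = c • (x * y) := by
  induction x using induction_mono with
  | h0 => rw [smul_zero, zero_mul, smul_zero]
  | hadd x x' hx hx' => rw [smul_add, add_mul, hx, hx', add_mul, smul_add]
  | hm u f =>
    induction y using induction_mono with
    | h0 => rw [mul_zero, mul_zero, smul_zero]
    | hadd y y' hy hy' => rw [mul_add, hy, hy', mul_add, smul_add]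
    | hm v g => simp only [smul_mono, mono_mul_mono, smul_mul_assoc]

theorem mul_smul' (c : ℂ) (x y : CoulombBranch ξ b) : x * c • y = c • (x * y) := by
  induction x using induction_mono with
  | h0 => rw [zero_mul, zero_mul, smul_zero]
  | hadd x x' hx hx' => rw [add_mul, hx, hx', add_mul, smul_add]
  | hm u f =>
    induction y using induction_mono with
    | h0 => rw [smul_zero, mul_zero, smul_zero]
    | hadd y y' hy hy' => rw [smul_add, mul_add, hy, hy', mul_add, smul_add]
    | hm v g => simp only [smul_mono, mono_mul_mono, map_smul, mul_smul_comm, smul_mul_assoc]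

instance : Algebra ℂ (CoulombBranch ξ b) := Algebra.ofModule smul_mul' mul_smul'

/-- The class of antilinear automorphisms under consideration: they send each weight space to the
weight space of opposite weight and act by `-1` on `𝔱^*`. -/
structure IsAdmissible (ρ : CoulombBranch ξ b ≃+* CoulombBranch ξ b) : Prop where
  antilinear : ∀ (c : ℂ) (x : CoulombBranch ξ b), ρ (c • x) = (starRingEnd ℂ) c • ρ x
  weight : ∀ (v : Fin d → ℤ) (f : MvPolynomial (Fin d) ℂ), ∃ h, ρ (mono ξ b v f) = mono ξ b (-v) h
  neg : ∀ k : Fin d, ρ (mono ξ b 0 (X k)) = -mono ξ b 0 (X k)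

/-- `T` is a `ρ²`-twisted trace with `T (a ρ(a)) > 0` for all nonzero `a`. -/
structure IsPositiveTrace (ρ : CoulombBranch ξ b ≃+* CoulombBranch ξ b) (T : CoulombBranch ξ b →ₗ[ℂ] ℂ) : Prop where
  trace : ∀ x y, T (x * y) = T (y * ρ (ρ x))
  real : ∀ x, (T (x * ρ x)).im = 0
  pos : ∀ x, x ≠ 0 → 0 < (T (x * ρ x)).re

/-- The exponential generating function `u_T = ∑ T(x^k) y^k / k!`, a formal power series in the
coordinates `y` of `𝔱^*`. -/
def genFun (T : CoulombBranch ξ b →ₗ[ℂ] ℂ) : MvPowerSeries (Fin d) ℂ :=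
  fun k => T (mono ξ b 0 (monomial k 1)) / ∏ i, ((k i).factorial : ℂ)

/-- The Taylor series at zero of `e^m : y ↦ exp (∑ m_k y_k)`, for `m ∈ 𝔱`. -/
def expSeries (m : Fin d → ℂ) : MvPowerSeries (Fin d) ℂ :=
  fun k => ∏ i, m i ^ k i / ((k i).factorial : ℂ)

/-- The function `e^m` on `𝔱_ℝ^*`. -/
def expFun (m : Fin d → ℂ) (y : Fin d → ℝ) : ℂ := Complex.exp (∑ k, m k * y k)

open Classical in
variable (ξ) in
/-- The finite set `I` of all lines in `𝔱_ℝ` that are intersections of some (possibly none) of the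
hyperplanes `ξ_j = 0`. -/
def lines : Finset (Submodule ℝ (Fin d → ℝ)) :=
  (Finset.univ.image fun J : Finset (Fin n) =>
    ⨅ j ∈ J, LinearMap.ker (∑ k, (ξ j k : ℝ) • LinearMap.proj (R := ℝ) (φ := fun _ => ℝ) k)).filter
    fun l => Module.finrank ℝ l = 1

/-- A coweight as an element of `𝔱_ℝ`. -/
def toReal (v : Fin d → ℤ) : Fin d → ℝ := fun k => (v k : ℝ)

/-- `v` is a shortest nonzero coweight in the line `l`, i.e. all coweights in `l` are
integer multiples of `v`. -/
def IsShortestCoweight (l : Submodule ℝ (Fin d → ℝ)) (v : Fin d → ℤ) : Prop :=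
  v ≠ 0 ∧ toReal v ∈ l ∧ ∀ w : Fin d → ℤ, toReal w ∈ l → ∃ k : ℤ, w = k • v

/-- The number `e^{2πi ζ(v)}`. -/
def twist (ζ : Fin d → ℂ) (v : Fin d → ℤ) : ℂ :=
  Complex.exp (2 * Real.pi * Complex.I * ∑ k, ζ k * (v k : ℂ))

/-- `c • v` as an element of `𝔱`. -/
def scaled (c : ℂ) (v : Fin d → ℤ) : Fin d → ℂ := fun k => c * (v k : ℂ)

variable (ξ) in
/-- The denominator `∏_l (e^{λ_l / 2} - e^{2πi ζ(λ_l)} e^{-λ_l / 2})` as a power series. -/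
def denSeries (lam : Submodule ℝ (Fin d → ℝ) → Fin d → ℤ) (ζ : Fin d → ℂ) :
    MvPowerSeries (Fin d) ℂ :=
  ∏ l ∈ lines ξ, (expSeries (scaled (1 / 2) (lam l)) -
    MvPowerSeries.C (twist ζ (lam l)) * expSeries (scaled (-(1 / 2)) (lam l)))

variable (ξ) in
/-- The same denominator as a function on `𝔱_ℝ^*`. -/
def denFun (lam : Submodule ℝ (Fin d → ℝ) → Fin d → ℤ) (ζ : Fin d → ℂ) (y : Fin d → ℝ) : ℂ :=
  ∏ l ∈ lines ξ, (expFun (scaled (1 / 2) (lam l)) y -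
    twist ζ (lam l) * expFun (scaled (-(1 / 2)) (lam l)) y)

/-- The exponential polynomial `∑ S_m e^m` as a power series. -/
def numSeries (S : (Fin d → ℂ) →₀ MvPolynomial (Fin d) ℂ) : MvPowerSeries (Fin d) ℂ :=
  S.sum fun m p => (p : MvPowerSeries (Fin d) ℂ) * expSeries m

/-- The same exponential polynomial as a function on `𝔱_ℝ^*`. -/
def numFun (S : (Fin d → ℂ) →₀ MvPolynomial (Fin d) ℂ) (y : Fin d → ℝ) : ℂ :=
  S.sum fun m p => eval (fun k => (y k : ℂ)) p * expFun m y

/-- `∑ S_m e^m` is the numerator of `u_T`, i.e. `u_T` equals this sum divided by the denominator. -/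
def IsNumerator (T : CoulombBranch ξ b →ₗ[ℂ] ℂ) (lam : Submodule ℝ (Fin d → ℝ) → Fin d → ℤ)
    (ζ : Fin d → ℂ) (S : (Fin d → ℂ) →₀ MvPolynomial (Fin d) ℂ) : Prop :=
  denSeries ξ lam ζ * genFun T = numSeries S

variable (ξ) in
/-- The polytope `∑_l [-1/2, 1/2] λ_l` in `𝔱_ℝ`. -/
def polytope (lam : Submodule ℝ (Fin d → ℝ) → Fin d → ℤ) : Set (Fin d → ℝ) :=
  {x | ∃ t : Submodule ℝ (Fin d → ℝ) → ℝ, (∀ l, t l ∈ Set.Icc (-(1 / 2)) (1 / 2)) ∧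
    x = ∑ l ∈ lines ξ, t l • toReal (lam l)}

/-- The subalgebra `ℂ[U_ℂ^*]` of `ℂ[𝔱^*]`: polynomials in the elements of `U ⊆ 𝔱_ℝ`, which are
linear functions on `𝔱^*`. -/
def polysOn (U : Submodule ℝ (Fin d → ℝ)) : Subalgebra ℂ (MvPolynomial (Fin d) ℂ) :=
  Algebra.adjoin ℂ {p | ∃ v ∈ U, p = linForm fun k => (v k : ℂ)}

end AbelianCoulomb

end

/-! ### Functionals on polynomials and their exponential generating functions -/

noncomputable section

namespace AbelianCoulomb

open MvPolynomial

variable {d n : ℕ}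

/-! Under the duality between functionals on `ℂ[𝔱]` and power series, multiplication by e^m is
precomposition with the shift by m. The trace identity for r^v and g r^{-v} then says that T on
`ℂ[𝔱]`, precomposed with the difference operator of e^{v/2} - e^{2πiζ(v)} e^{-v/2}, kills the ideal
of a product of affine forms ξ_i + c with ξ_i(v) ≠ 0 (`exists_annihilator_trace`). Composing the
operators of all lines gives a functional φ with generating function Δ u_T that is killed by one
such product for every line. Since T(1) ≠ 0 forces the weights to span, the lines detect every
nonzero vector, and these products have only finitely many common zeros (`finite_zeroLocus`). By the
Nullstellensatz φ factors through a finite-dimensional algebra, and its decomposition into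
simultaneous generalized eigenvectors is the numerator (`exists_isNumerator`).

Positivity enters through the inner product T(f^* h) on `ℂ[𝔱]`, for which multiplication by a real
linear form y is skew-symmetric. Dividing the entire numerator by Δ bounds the moments of T
(`isGeomBounded_genFun`), so all polynomials are analytic vectors with a common radius, and exp(y)
extends to an isometry of the Hilbert completion for every y. The matrix coefficient u(y) = ⟨1,
exp(y) 1⟩ is continuous, bounded by T(1) and analytic along lines through 0 (`exists_expGenFun`). It
agrees with u_T near 0, hence Δ u is the numerator everywhere (`denFun_mul_eq_numFun`).

Finally |Δ| ≤ M e^h with h the support function of the polytope. An exponential polynomial with this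
growth has no exponent μ with Re μ(v) > h(v), and if Re μ(v) = h(v) then S_μ is invariant under
translation along v (`re_exponent_le`, `cshift_eq_of_re_exponent_eq`). Hahn–Banach turns the first
fact into membership in the polytope. For the second, every vector orthogonal to the direction of a
face is, up to scale, a difference of two functionals maximal at the given point of the face, so S_μ
depends only on that direction (`mem_polytope_and_face`). -/

/-- The shift of argument by a complex vector. -/
def cshift (m : Fin d → ℂ) : MvPolynomial (Fin d) ℂ →ₐ[ℂ] MvPolynomial (Fin d) ℂ :=
  aeval fun k => X k + C (m k)

theorem cshift_X (m : Fin d → ℂ) (k : Fin d) : cshift m (X k) = X k + C (m k) := by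
  simp [cshift]

theorem cshift_C (m : Fin d → ℂ) (c : ℂ) : cshift m (C c) = C c := by
  simp [cshift, algebraMap_eq]

theorem cshift_zero (f : MvPolynomial (Fin d) ℂ) : cshift 0 f = f := by
  have : cshift (0 : Fin d → ℂ) = AlgHom.id ℂ _ := by
    ext k; simp [cshift]
  rw [this]; rfl

theorem cshift_cshift (v w : Fin d → ℂ) (f : MvPolynomial (Fin d) ℂ) :
    cshift v (cshift w f) = cshift (v + w) f := by
  have : (cshift v).comp (cshift w) = cshift (v + w) := by
    ext1 k; simp [cshift, add_assoc]
  rw [← this]; rfl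

theorem cshift_linForm (m c : Fin d → ℂ) :
    cshift m (linForm c) = linForm c + C (∑ k, c k * m k) := by
  simp [cshift, linForm, mul_add, Finset.sum_add_distrib]

theorem shift_eq_cshift (v : Fin d → ℤ) : shift v = cshift fun k => (v k : ℂ) := rfl

/-- The exponential generating function of a linear functional on polynomials. -/
def coeffSeries (φ : MvPolynomial (Fin d) ℂ →ₗ[ℂ] ℂ) : MvPowerSeries (Fin d) ℂ :=
  fun k => φ (monomial k 1) / ∏ i, ((k i).factorial : ℂ)

theorem prod_factorial_ne_zero (k : Fin d →₀ ℕ) : ∏ i, ((k i).factorial : ℂ) ≠ 0 :=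
  Finset.prod_ne_zero_iff.2 fun i _ => by exact_mod_cast (k i).factorial_ne_zero

theorem coeff_coeffSeries (φ : MvPolynomial (Fin d) ℂ →ₗ[ℂ] ℂ) (k : Fin d →₀ ℕ) :
    MvPowerSeries.coeff k (coeffSeries φ) = φ (monomial k 1) / ∏ i, ((k i).factorial : ℂ) := rfl

theorem coeff_expSeries (m : Fin d → ℂ) (k : Fin d →₀ ℕ) :
    MvPowerSeries.coeff k (expSeries m) = ∏ i, m i ^ k i / ((k i).factorial : ℂ) := rfl

theorem coeffSeries_add (φ ψ : MvPolynomial (Fin d) ℂ →ₗ[ℂ] ℂ) :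
    coeffSeries (φ + ψ) = coeffSeries φ + coeffSeries ψ := by
  ext k; simp [coeff_coeffSeries, add_div]

theorem coeffSeries_sub (φ ψ : MvPolynomial (Fin d) ℂ →ₗ[ℂ] ℂ) :
    coeffSeries (φ - ψ) = coeffSeries φ - coeffSeries ψ := by
  ext k; simp [coeff_coeffSeries, sub_div]

theorem coeffSeries_smul (c : ℂ) (φ : MvPolynomial (Fin d) ℂ →ₗ[ℂ] ℂ) :
    coeffSeries (c • φ) = MvPowerSeries.C c * coeffSeries φ := by
  ext k; simp [coeff_coeffSeries, mul_div_assoc]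

theorem coeffSeries_injective :
    Function.Injective (coeffSeries : (MvPolynomial (Fin d) ℂ →ₗ[ℂ] ℂ) → _) := by
  intro φ ψ h
  refine (MvPolynomial.basisMonomials (Fin d) ℂ).ext fun k => ?_
  have := congrArg (MvPowerSeries.coeff k) h
  rw [coeff_coeffSeries, coeff_coeffSeries, div_left_inj' (prod_factorial_ne_zero k)] at this
  simpa using this

theorem sum_antidiagonal_prod {R : Type*} [CommSemiring R] (k : Fin d →₀ ℕ)
    (f : Fin d → ℕ × ℕ → R) :
    ∑ p ∈ Finset.HasAntidiagonal.antidiagonal k, ∏ i, f i (p.1 i, p.2 i) =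
      ∏ i, ∑ q ∈ Finset.HasAntidiagonal.antidiagonal (k i), f i q := by
  classical
  rw [Finset.prod_univ_sum]
  refine Finset.sum_nbij' (fun p i => (p.1 i, p.2 i))
    (fun q => (Finsupp.equivFunOnFinite.symm fun i => (q i).1,
      Finsupp.equivFunOnFinite.symm fun i => (q i).2)) ?_ ?_ ?_ ?_ ?_
  · intro p hp
    rw [Finset.HasAntidiagonal.mem_antidiagonal] at hp
    simp [Fintype.mem_piFinset, ← hp]
  · intro q hq
    simp only [Fintype.mem_piFinset, Finset.HasAntidiagonal.mem_antidiagonal] at hq ⊢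
    ext i
    simp [hq i]
  · intro p _
    ext <;> simp
  · intro q _
    ext <;> simp
  · intro p _
    rfl

theorem monomial_eq_prod (k : Fin d →₀ ℕ) :
    (monomial k (1 : ℂ)) = ∏ i, X i ^ k i := by
  rw [monomial_eq, C_1, one_mul, Finsupp.prod_fintype _ _ (by simp)]

/-- The coefficient of the product is the binomial expansion of φ((x + m)^k). This is the dictionary
that turns multiplication by the denominator into difference operators on functionals. -/
theorem expSeries_mul_coeffSeries (m : Fin d → ℂ) (φ : MvPolynomial (Fin d) ℂ →ₗ[ℂ] ℂ) :
    expSeries m * coeffSeries φ = coeffSeries (φ ∘ₗ (cshift m).toLinearMap) := by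
  classical
  ext k
  rw [MvPowerSeries.coeff_mul, coeff_coeffSeries, eq_div_iff (prod_factorial_ne_zero k)]
  have key : cshift m (monomial k 1) = ∑ p ∈ Finset.HasAntidiagonal.antidiagonal k,
      C (∏ i, (m i ^ p.1 i * ((k i).choose (p.1 i) : ℂ))) * monomial p.2 1 := by
    have e : ∀ p : (Fin d →₀ ℕ) × (Fin d →₀ ℕ),
        C (∏ i, (m i ^ p.1 i * ((k i).choose (p.1 i) : ℂ))) * monomial p.2 (1 : ℂ) =
        ∏ i, (fun q : ℕ × ℕ => C (m i ^ q.1 * ((k i).choose q.1 : ℂ)) * X i ^ q.2)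
          (p.1 i, p.2 i) := by
      intro p
      rw [monomial_eq_prod, map_prod, Finset.prod_mul_distrib]
    simp only [e]
    rw [sum_antidiagonal_prod k (fun i q => C (m i ^ q.1 * ((k i).choose q.1 : ℂ)) * X i ^ q.2),
      monomial_eq_prod, map_prod]
    refine Finset.prod_congr rfl fun i _ => ?_
    rw [map_pow, cshift_X, add_comm, (Commute.all _ _).add_pow']
    refine Finset.sum_congr rfl fun q _ => ?_
    simp only [nsmul_eq_mul, map_mul, map_pow, map_natCast]
    ring
  simp only [LinearMap.coe_comp, Function.comp_apply, AlgHom.toLinearMap_apply, key, map_sum,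
    ← smul_eq_C_mul, map_smul, smul_eq_mul, Finset.sum_mul]
  refine Finset.sum_congr rfl fun p hp => ?_
  rw [coeff_expSeries, coeff_coeffSeries]
  have h : ∏ i, m i ^ p.1 i / ((p.1 i).factorial : ℂ) * ((k i).factorial : ℂ) =
      ∏ i, (m i ^ p.1 i * ((k i).choose (p.1 i) : ℂ)) * ((p.2 i).factorial : ℂ) := by
    refine Finset.prod_congr rfl fun i _ => ?_
    rw [Finset.HasAntidiagonal.mem_antidiagonal] at hp
    have hk : k i = p.1 i + p.2 i := by rw [← hp]; rfl
    have h1 : ((p.1 i).factorial : ℂ) ≠ 0 := by exact_mod_cast Nat.factorial_ne_zero _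
    have h3 : (((p.1 i + p.2 i).choose (p.1 i) * (p.1 i).factorial * (p.2 i).factorial : ℕ) : ℂ) =
        ((p.1 i + p.2 i).factorial : ℂ) := by
      rw [Nat.choose_symm_add, Nat.add_choose_mul_factorial_mul_factorial]
    rw [hk, ← h3]
    push_cast
    field_simp
  rw [Finset.prod_mul_distrib, Finset.prod_mul_distrib] at h
  have h2 := prod_factorial_ne_zero p.2
  rw [mul_div_assoc', div_mul_eq_mul_div, div_eq_iff h2]
  linear_combination (φ (monomial p.2 1)) * h

theorem expSeries_eq_coeffSeries (m : Fin d → ℂ) :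
    expSeries m = coeffSeries (aeval m : MvPolynomial (Fin d) ℂ →ₐ[ℂ] ℂ).toLinearMap := by
  ext k
  simp [coeff_coeffSeries, coeff_expSeries, monomial_eq_prod, Finset.prod_div_distrib]

theorem sum_pow_eq_sum_finsuppAntidiag {R : Type*} [CommSemiring R] (a : Fin d → R) (n : ℕ) :
    (∑ i, a i) ^ n = ∑ k ∈ Finset.finsuppAntidiag Finset.univ n,
      (Nat.multinomial Finset.univ k : R) * ∏ i, a i ^ k i := by
  classical
  rw [Finset.sum_pow_eq_sum_piAntidiag]
  refine Finset.sum_nbij' (fun k => Finsupp.equivFunOnFinite.symm k) (fun k => k) ?_ ?_ ?_ ?_ ?_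
  · intro k hk
    simpa [Finset.mem_finsuppAntidiag] using hk
  · intro k hk
    simpa [Finset.mem_finsuppAntidiag] using hk
  · intro k _; rfl
  · intro k _; ext; rfl
  · intro k _; rfl

theorem multinomial_mul_prod_factorial {n : ℕ} {k : Fin d →₀ ℕ}
    (hk : k ∈ Finset.finsuppAntidiag Finset.univ n) :
    (∏ i, (k i).factorial) * Nat.multinomial Finset.univ k = n.factorial := by
  rw [Nat.multinomial_spec, (Finset.mem_finsuppAntidiag.1 hk).1]

/-- By the multinomial theorem, the homogeneous part of degree n only involves the powers of the
single linear form y. This links the multivariable series to the exponential of one multiplication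
operator. -/
theorem sum_coeffSeries_eq (φ : MvPolynomial (Fin d) ℂ →ₗ[ℂ] ℂ) (y : Fin d → ℂ) (n : ℕ) :
    ∑ k ∈ Finset.finsuppAntidiag Finset.univ n,
      MvPowerSeries.coeff k (coeffSeries φ) * ∏ i, y i ^ k i =
    φ (linForm y ^ n) / (n.factorial : ℂ) := by
  have hn : (n.factorial : ℂ) ≠ 0 := by exact_mod_cast n.factorial_ne_zero
  rw [linForm, sum_pow_eq_sum_finsuppAntidiag, map_sum, Finset.sum_div]
  refine Finset.sum_congr rfl fun k hk => ?_
  have h := multinomial_mul_prod_factorial hk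
  have h' : (∏ i, ((k i).factorial : ℂ)) * (Nat.multinomial Finset.univ k : ℂ) = n.factorial := by
    exact_mod_cast h
  have e : (Nat.multinomial Finset.univ k : MvPolynomial (Fin d) ℂ) *
      ∏ i, (C (y i) * X i) ^ k i =
      ((Nat.multinomial Finset.univ k : ℂ) * ∏ i, y i ^ k i) • monomial k 1 := by
    simp only [mul_pow, Finset.prod_mul_distrib, monomial_eq_prod, smul_eq_C_mul, map_mul,
      map_natCast, map_prod, map_pow]
    ring
  have h2 := prod_factorial_ne_zero k
  rw [e, map_smul, smul_eq_mul, coeff_coeffSeries, div_mul_eq_mul_div, div_eq_div_iff h2 hn, ← h']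
  ring

theorem mem_finsuppAntidiag_univ {n : ℕ} {k : Fin d →₀ ℕ} :
    k ∈ Finset.finsuppAntidiag Finset.univ n ↔ k.degree = n := by
  simp [Finset.mem_finsuppAntidiag, Finsupp.degree_eq_sum]

end AbelianCoulomb

end

/-! ### The difference equations of the trace and the geometry of the lines -/

noncomputable section

namespace AbelianCoulomb

open MvPolynomial

variable {d n : ℕ} {ξ : Fin n → Fin d → ℤ} {b : Fin n → ℂ}

/-- The restriction of a functional to `ℂ[𝔱]`. -/
def restrictTrace (T : CoulombBranch ξ b →ₗ[ℂ] ℂ) : MvPolynomial (Fin d) ℂ →ₗ[ℂ] ℂ where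
  toFun f := T (mono ξ b 0 f)
  map_add' f h := by rw [mono_add, map_add]
  map_smul' c f := by rw [← smul_mono, map_smul, RingHom.id_apply]

theorem restrictTrace_apply (T : CoulombBranch ξ b →ₗ[ℂ] ℂ) (f : MvPolynomial (Fin d) ℂ) :
    restrictTrace T f = T (mono ξ b 0 f) := rfl

theorem mono_zero_one : mono ξ b 0 1 = 1 := rfl

theorem mono_zero_mul (f h : MvPolynomial (Fin d) ℂ) :
    mono ξ b 0 f * mono ξ b 0 h = mono ξ b 0 (f * h) := by
  rw [mono_mul_mono, shift_zero]
  simp [structConst, pair_zero, factor_zero_left]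

theorem mono_injective (v : Fin d → ℤ) : Function.Injective (mono ξ b v) :=
  Finsupp.single_injective v

/-- The twisted trace property for r^v and g r^{-v}: both products lie in `ℂ[𝔱]`, and ρ² only
contributes the scalar of r^v. -/
theorem restrictTrace_shift {ρ : CoulombBranch ξ b ≃+* CoulombBranch ξ b} {ζ : Fin d → ℂ}
    {T : CoulombBranch ξ b →ₗ[ℂ] ℂ} (v : Fin d → ℤ)
    (hζ : ρ (ρ (mono ξ b v 1)) = twist ζ v • mono ξ b v 1)
    (hT : ∀ x y, T (x * y) = T (y * ρ (ρ x))) (g : MvPolynomial (Fin d) ℂ) :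
    restrictTrace T (shift v g * structConst ξ b v (-v)) =
      twist ζ v * restrictTrace T (g * structConst ξ b (-v) v) := by
  have h := hT (mono ξ b v 1) (mono ξ b (-v) g)
  rw [hζ, mul_smul', mono_mul_mono, mono_mul_mono, add_neg_cancel, neg_add_cancel, map_smul,
    map_one, one_mul, mul_one] at h
  exact h

/-- Associativity of r^{-v} r^v r^{-v}, read off from the cocycle identity. -/
theorem structConst_neg_left (v : Fin d → ℤ) :
    structConst ξ b (-v) v = shift (-v) (structConst ξ b v (-v)) := by
  have h := structConst_cocycle (ξ := ξ) (b := b) (-v) v (-v)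
  rw [neg_add_cancel, add_neg_cancel] at h
  simpa [structConst, pair_zero, factor_zero_left, factor_zero_right] using h

variable (ξ) in
/-- Products of affine linear forms `ξ_i + c` whose linear part does not vanish on `v`. -/
def affineProducts (v : Fin d → ℤ) : Submonoid (MvPolynomial (Fin d) ℂ) :=
  Submonoid.closure {p | ∃ (i : Fin n) (c : ℂ), pair (ξ i) v ≠ 0 ∧
    p = linForm (fun k => (ξ i k : ℂ)) + C c}

theorem linForm_add_C_mem {v : Fin d → ℤ} {i : Fin n} (hi : pair (ξ i) v ≠ 0) (c : ℂ) :
    linForm (fun k => (ξ i k : ℂ)) + C c ∈ affineProducts ξ v :=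
  Submonoid.subset_closure ⟨i, c, hi, rfl⟩

theorem structConst_mem (v w : Fin d → ℤ) : structConst ξ b v w ∈ affineProducts ξ v := by
  refine Submonoid.prod_mem _ fun i _ => ?_
  by_cases hi : pair (ξ i) v = 0
  · rw [hi, factor_zero_left]
    exact Submonoid.one_mem _
  · have h : ∀ c : ℂ, linForm (fun k => (ξ i k : ℂ)) + C (b i) + C c ∈ affineProducts ξ v := by
      intro c
      rw [add_assoc, ← C_add]
      exact linForm_add_C_mem hi _
    unfold factor
    split_ifs
    · exact Submonoid.prod_mem _ fun j _ => h _
    · exact Submonoid.prod_mem _ fun j _ => h _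
    · exact Submonoid.one_mem _

theorem cshift_mem (v : Fin d → ℤ) (m : Fin d → ℂ) {q : MvPolynomial (Fin d) ℂ}
    (hq : q ∈ affineProducts ξ v) : cshift m q ∈ affineProducts ξ v := by
  induction hq using Submonoid.closure_induction with
  | mem x hx =>
    obtain ⟨i, c, hi, rfl⟩ := hx
    rw [map_add, cshift_linForm, cshift_C, add_assoc, ← C_add]
    exact linForm_add_C_mem hi _
  | one => rw [map_one]; exact Submonoid.one_mem _
  | mul x y _ _ hx hy => rw [map_mul]; exact Submonoid.mul_mem _ hx hy

/-- The difference operator corresponding to multiplication by `e^{v/2} - c e^{-v/2}`. -/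
def diffOp (v : Fin d → ℤ) (c : ℂ) : MvPolynomial (Fin d) ℂ →ₗ[ℂ] MvPolynomial (Fin d) ℂ :=
  (cshift (scaled (1 / 2) v)).toLinearMap - c • (cshift (scaled (-(1 / 2)) v)).toLinearMap

theorem diffOp_apply (v : Fin d → ℤ) (c : ℂ) (f : MvPolynomial (Fin d) ℂ) :
    diffOp v c f = cshift (scaled (1 / 2) v) f - c • cshift (scaled (-(1 / 2)) v) f := rfl

/-- The factor `e^{v/2} - c e^{-v/2}` of the denominator. -/
def expDiff (v : Fin d → ℤ) (c : ℂ) : MvPowerSeries (Fin d) ℂ :=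
  expSeries (scaled (1 / 2) v) - MvPowerSeries.C c * expSeries (scaled (-(1 / 2)) v)

theorem coeffSeries_comp_diffOp (φ : MvPolynomial (Fin d) ℂ →ₗ[ℂ] ℂ) (v : Fin d → ℤ) (c : ℂ) :
    coeffSeries (φ ∘ₗ diffOp v c) = expDiff v c * coeffSeries φ := by
  rw [diffOp, LinearMap.comp_sub, LinearMap.comp_smul, coeffSeries_sub, coeffSeries_smul,
    ← expSeries_mul_coeffSeries, ← expSeries_mul_coeffSeries, expDiff]
  ring

theorem scaled_half_add (v : Fin d → ℤ) : scaled (1 / 2) v + scaled (-(1 / 2)) v = 0 := by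
  ext k; simp [scaled]

theorem scaled_neg_half_add (v : Fin d → ℤ) : scaled (-(1 / 2)) v + scaled (1 / 2) v = 0 := by
  rw [add_comm, scaled_half_add]

/-- With q the shift of A(v, -v) by -v/2, the two half shifts of q are A(v, -v) and A(-v, v). The
difference operator applied to q f is therefore the difference of the two sides of
`restrictTrace_shift` for g the shift of f by -v/2. -/
theorem exists_annihilator_trace {ρ : CoulombBranch ξ b ≃+* CoulombBranch ξ b} {ζ : Fin d → ℂ}
    {T : CoulombBranch ξ b →ₗ[ℂ] ℂ} (v : Fin d → ℤ)
    (hζ : ρ (ρ (mono ξ b v 1)) = twist ζ v • mono ξ b v 1)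
    (hT : ∀ x y, T (x * y) = T (y * ρ (ρ x))) :
    ∃ q ∈ affineProducts ξ v, ∀ f, (restrictTrace T ∘ₗ diffOp v (twist ζ v)) (q * f) = 0 := by
  refine ⟨cshift (scaled (-(1 / 2)) v) (structConst ξ b v (-v)),
    cshift_mem v _ (structConst_mem v (-v)), fun f => ?_⟩
  have h := restrictTrace_shift v hζ hT (cshift (scaled (-(1 / 2)) v) f)
  rw [structConst_neg_left, shift_eq_cshift, shift_eq_cshift, cshift_cshift] at h
  rw [LinearMap.comp_apply, diffOp_apply, map_sub, map_smul, map_mul (cshift _),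
    map_mul (cshift (scaled (-(1 / 2)) v)), cshift_cshift,
    cshift_cshift, scaled_half_add, cshift_zero]
  have e1 : (fun k => (v k : ℂ)) + scaled (-(1 / 2)) v = scaled (1 / 2) v := by
    ext k; simp [scaled]; ring
  have e2 : scaled (-(1 / 2)) v + scaled (-(1 / 2)) v = fun k => (((-v) k : ℤ) : ℂ) := by
    ext k; simp [scaled]; ring
  rw [e1] at h
  rw [e2, smul_eq_mul, sub_eq_zero, mul_comm, h, mul_comm (cshift _ f)]

/-- The new annihilator is the product of the two half shifts of q: each of the two terms of the
difference operator moves one of the factors back to q. -/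
theorem exists_annihilator_comp_diffOp {v : Fin d → ℤ} {ψ : MvPolynomial (Fin d) ℂ →ₗ[ℂ] ℂ}
    (h : ∃ q ∈ affineProducts ξ v, ∀ f, ψ (q * f) = 0) (w : Fin d → ℤ) (c : ℂ) :
    ∃ q ∈ affineProducts ξ v, ∀ f, (ψ ∘ₗ diffOp w c) (q * f) = 0 := by
  obtain ⟨q, hq, h⟩ := h
  refine ⟨cshift (scaled (-(1 / 2)) w) q * cshift (scaled (1 / 2) w) q,
    Submonoid.mul_mem _ (cshift_mem _ _ hq) (cshift_mem _ _ hq), fun f => ?_⟩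
  rw [LinearMap.comp_apply, diffOp_apply]
  simp only [map_mul, cshift_cshift, scaled_half_add, scaled_neg_half_add, cshift_zero, map_sub,
    map_smul]
  rw [mul_assoc, h, mul_assoc, mul_left_comm, h]
  simp

theorem exists_prod_expDiff_mul {v : Fin d → ℤ} {ι : Type*} (s : Finset ι) (w : ι → Fin d → ℤ)
    (c : ι → ℂ) (ψ : MvPolynomial (Fin d) ℂ →ₗ[ℂ] ℂ) :
    ∃ ψ' : MvPolynomial (Fin d) ℂ →ₗ[ℂ] ℂ,
      coeffSeries ψ' = (∏ l ∈ s, expDiff (w l) (c l)) * coeffSeries ψ ∧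
      ((∃ q ∈ affineProducts ξ v, ∀ f, ψ (q * f) = 0) →
        ∃ q ∈ affineProducts ξ v, ∀ f, ψ' (q * f) = 0) := by
  classical
  induction s using Finset.induction_on with
  | empty => exact ⟨ψ, by simp, id⟩
  | insert l s hl ih =>
    obtain ⟨ψ', h1, h2⟩ := ih
    refine ⟨ψ' ∘ₗ diffOp (w l) (c l), ?_, fun h =>
      exists_annihilator_comp_diffOp (h2 h) (w l) (c l)⟩
    rw [coeffSeries_comp_diffOp, h1, Finset.prod_insert hl, mul_assoc]

theorem denSeries_eq (lam : Submodule ℝ (Fin d → ℝ) → Fin d → ℤ) (ζ : Fin d → ℂ) :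
    denSeries ξ lam ζ = ∏ l ∈ lines ξ, expDiff (lam l) (twist ζ (lam l)) := rfl

/-- The factors of the denominator commute, so for each line l its own factor can be applied first.
It creates an annihilator for l, which the remaining factors preserve. -/
theorem exists_functional_denSeries_mul {ρ : CoulombBranch ξ b ≃+* CoulombBranch ξ b}
    {ζ : Fin d → ℂ} {T : CoulombBranch ξ b →ₗ[ℂ] ℂ}
    (hζ : ∀ v, ρ (ρ (mono ξ b v 1)) = twist ζ v • mono ξ b v 1)
    (hT : ∀ x y, T (x * y) = T (y * ρ (ρ x))) (lam : Submodule ℝ (Fin d → ℝ) → Fin d → ℤ) :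
    ∃ φ : MvPolynomial (Fin d) ℂ →ₗ[ℂ] ℂ, coeffSeries φ = denSeries ξ lam ζ * genFun T ∧
      ∀ l ∈ lines ξ, ∃ q ∈ affineProducts ξ (lam l), ∀ f, φ (q * f) = 0 := by
  classical
  obtain ⟨φ, hφ, -⟩ := exists_prod_expDiff_mul (ξ := ξ) (v := 0) (lines ξ) lam
    (fun l => twist ζ (lam l)) (restrictTrace T)
  refine ⟨φ, hφ, fun l hl => ?_⟩
  obtain ⟨ψ, hψ, h⟩ := exists_prod_expDiff_mul (ξ := ξ) (v := lam l) ((lines ξ).erase l) lam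
    (fun l => twist ζ (lam l)) (restrictTrace T ∘ₗ diffOp (lam l) (twist ζ (lam l)))
  have : ψ = φ := by
    apply coeffSeries_injective
    rw [hψ, hφ, coeffSeries_comp_diffOp, ← mul_assoc, mul_comm (∏ _ ∈ _, _),
      Finset.mul_prod_erase (lines ξ) (fun l => expDiff (lam l) (twist ζ (lam l))) hl]
  rw [← this]
  exact h (exists_annihilator_trace _ (hζ _) hT)

/-- The value of a weight on a real coweight, as a linear form. -/
def realForm (x : Fin d → ℤ) : (Fin d → ℝ) →ₗ[ℝ] ℝ :=
  ∑ k, (x k : ℝ) • LinearMap.proj (R := ℝ) (φ := fun _ => ℝ) k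

theorem realForm_apply (x : Fin d → ℤ) (w : Fin d → ℝ) : realForm x w = ∑ k, (x k : ℝ) * w k := by
  simp [realForm]

theorem realForm_toReal (x v : Fin d → ℤ) : realForm x (toReal v) = pair x v := by
  simp [realForm_apply, toReal, pair]

theorem mem_lines {l : Submodule ℝ (Fin d → ℝ)} : l ∈ lines ξ ↔
    (∃ J : Finset (Fin n), ⨅ j ∈ J, LinearMap.ker (realForm (ξ j)) = l) ∧
      Module.finrank ℝ l = 1 := by
  simp [lines, realForm]

/-- If all weights vanish on v, then A(v, -v) = 1 and T on `ℂ[𝔱]` is invariant under the shift by v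
up to the twist. Testing on 1 gives twist 1, and testing on a coordinate gives v_k T(1) = 0. -/
theorem eq_zero_of_not_spanning {ρ : CoulombBranch ξ b ≃+* CoulombBranch ξ b} {ζ : Fin d → ℂ}
    {T : CoulombBranch ξ b →ₗ[ℂ] ℂ}
    (hζ : ∀ v, ρ (ρ (mono ξ b v 1)) = twist ζ v • mono ξ b v 1)
    (hT : ∀ x y, T (x * y) = T (y * ρ (ρ x))) (h1 : T 1 ≠ 0) {v : Fin d → ℤ}
    (hv : ∀ i, pair (ξ i) v = 0) : v = 0 := by
  have hs : structConst ξ b v (-v) = 1 := by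
    simp [structConst, hv, factor_zero_left]
  have key : ∀ g, restrictTrace T (shift v g) = twist ζ v * restrictTrace T g := by
    intro g
    have := restrictTrace_shift v (hζ v) hT g
    rwa [structConst_neg_left, hs, map_one, mul_one, mul_one] at this
  have h1' : restrictTrace T 1 ≠ 0 := h1
  have ht : twist ζ v = 1 := by
    have := key 1
    rw [map_one] at this
    exact (mul_eq_right₀ h1').1 this.symm
  ext k
  have h := key (X k)
  rw [ht, one_mul, shift_eq_cshift, cshift_X, map_add, add_eq_left, ← mul_one (C _),
    ← smul_eq_C_mul, map_smul, smul_eq_mul, mul_eq_zero] at h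
  simpa [h1'] using h

/-- The kernel of an integer matrix is defined over ℚ: if the rational kernel were zero, a rational
left inverse would remain a left inverse over ℝ. Denominators of a rational kernel vector can be
cleared. -/
theorem exists_int_ker_of_real_ker (ξ : Fin n → Fin d → ℤ) {w : Fin d → ℝ} (hw : w ≠ 0)
    (h : ∀ i, realForm (ξ i) w = 0) : ∃ v : Fin d → ℤ, v ≠ 0 ∧ ∀ i, pair (ξ i) v = 0 := by
  by_contra! hcon
  let M : Matrix (Fin n) (Fin d) ℚ := Matrix.of fun i k => (ξ i k : ℚ)
  have hinj : Function.Injective (Matrix.toLin' M) := by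
    rw [← LinearMap.ker_eq_bot, LinearMap.ker_eq_bot']
    intro x hx
    by_contra hx0
    let D : ℕ := ∏ k, (x k).den
    have hD : (D : ℚ) ≠ 0 := by
      exact_mod_cast Finset.prod_ne_zero_iff.2 fun k _ => (x k).den_ne_zero
    have hz : ∀ k, ∃ z : ℤ, (z : ℚ) = D * x k := by
      intro k
      obtain ⟨e, he⟩ := Finset.dvd_prod_of_mem (fun k => (x k).den) (Finset.mem_univ k)
      refine ⟨(x k).num * e, ?_⟩
      have h1 : (x k).den * x k = (x k).num := Rat.den_mul_eq_num (x k)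
      have h2 : (D : ℚ) = (x k).den * e := by exact_mod_cast he
      push_cast
      rw [h2, ← h1]
      ring
    choose z hz using hz
    obtain ⟨i, hi⟩ := hcon z (fun h0 => hx0 (by
      ext k
      have := hz k
      rw [h0] at this
      simpa [hD] using this))
    apply hi
    have h3 := congrFun hx i
    have h4 : ((pair (ξ i) z : ℤ) : ℚ) = D * (Matrix.toLin' M x i) := by
      simp only [pair, Int.cast_sum, Int.cast_mul, hz, Matrix.toLin'_apply, Matrix.mulVec,
        dotProduct, M, Matrix.of_apply, Finset.mul_sum]
      exact Finset.sum_congr rfl fun k _ => by ring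
    rw [h3] at h4
    simpa using h4
  obtain ⟨g, hg⟩ := LinearMap.exists_leftInverse_of_injective _ (LinearMap.ker_eq_bot.2 hinj)
  have hm : LinearMap.toMatrix' g * M = 1 := by
    have := congrArg LinearMap.toMatrix' hg
    rwa [LinearMap.toMatrix'_comp, LinearMap.toMatrix'_toLin', LinearMap.toMatrix'_id] at this
  have hm' : (LinearMap.toMatrix' g).map (Rat.castHom ℝ) * M.map (Rat.castHom ℝ) = 1 := by
    rw [← Matrix.map_mul, hm, Matrix.map_one _ (map_zero _) (map_one _)]
  apply hw
  have h0 : (M.map (Rat.castHom ℝ)).mulVec w = 0 := by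
    ext i
    have := h i
    rw [realForm_apply] at this
    simpa [Matrix.mulVec, dotProduct, M] using this
  rw [← Matrix.one_mulVec w, ← hm', ← Matrix.mulVec_mulVec, h0, Matrix.mulVec_zero]

/-- If w ≠ 0, extend the set of weights vanishing on w to a maximal set J with nonzero common
kernel. That kernel is one of the lines, so some weight vanishes on w but not on the generator of
the line. Such a weight belongs to J, a contradiction. -/
theorem eq_zero_of_forall_lines {lam : Submodule ℝ (Fin d → ℝ) → Fin d → ℤ}
    (hspan : ∀ w : Fin d → ℝ, (∀ i, realForm (ξ i) w = 0) → w = 0)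
    (hlam : ∀ l ∈ lines ξ, toReal (lam l) ∈ l) {w : Fin d → ℝ}
    (hw : ∀ l ∈ lines ξ, ∃ i, pair (ξ i) (lam l) ≠ 0 ∧ realForm (ξ i) w = 0) : w = 0 := by
  classical
  by_contra hw0
  let W : Finset (Fin n) → Submodule ℝ (Fin d → ℝ) := fun J =>
    ⨅ j ∈ J, LinearMap.ker (realForm (ξ j))
  have hW : ∀ J x, x ∈ W J ↔ ∀ j ∈ J, realForm (ξ j) x = 0 := by
    intro J x
    simp [W, Submodule.mem_iInf]
  let J₀ : Finset (Fin n) := Finset.univ.filter fun j => realForm (ξ j) w = 0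
  obtain ⟨J, hJ, hmax⟩ := Finset.exists_max_image
    (Finset.univ.filter fun J : Finset (Fin n) => J₀ ⊆ J ∧ W J ≠ ⊥) Finset.card
    ⟨J₀, by
      simp only [Finset.mem_filter, Finset.mem_univ, true_and]
      refine ⟨subset_rfl, fun h => hw0 ?_⟩
      rw [← Submodule.mem_bot ℝ, ← h, hW]
      simp [J₀]⟩
  simp only [Finset.mem_filter, Finset.mem_univ, true_and] at hJ hmax
  obtain ⟨j, hj⟩ : ∃ j, j ∉ J := by
    by_contra! hall
    apply hJ.2
    rw [Submodule.eq_bot_iff]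
    intro x hx
    exact hspan x fun i => (hW J x).1 hx i (hall i)
  have hins : W (insert j J) = ⊥ := by
    by_contra hne
    have := hmax _ ⟨hJ.1.trans (Finset.subset_insert j J), hne⟩
    rw [Finset.card_insert_of_notMem hj] at this
    omega
  have hline : W J ∈ lines ξ := by
    rw [mem_lines]
    refine ⟨⟨J, rfl⟩, le_antisymm ?_ ?_⟩
    -- By maximality of J the weight ξ_j has no kernel on the intersection, which therefore has
    -- dimension at most one.
    · have hinj : Function.Injective ((realForm (ξ j)).comp (W J).subtype) := by
        rw [← LinearMap.ker_eq_bot, LinearMap.ker_eq_bot']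
        intro x hx
        have : (x : Fin d → ℝ) ∈ W (insert j J) := by
          rw [hW]
          intro i hi
          rcases Finset.mem_insert.1 hi with rfl | hi
          · exact hx
          · exact (hW J x).1 x.2 i hi
        rw [hins, Submodule.mem_bot] at this
        exact Subtype.ext this
      simpa using LinearMap.finrank_le_finrank_of_injective hinj
    · exact Submodule.one_le_finrank_iff.2 hJ.2
  obtain ⟨i, hi, hiw⟩ := hw _ hline
  have hiJ : i ∈ J := hJ.1 (by simp [J₀, hiw])
  have := (hW J _).1 (hlam _ hline) i hiJ
  rw [realForm_toReal] at this
  exact hi (by exact_mod_cast this)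

end AbelianCoulomb

end

/-! ### Finiteness of the common zeros and existence of the numerator -/

noncomputable section

namespace AbelianCoulomb

open MvPolynomial

variable {d n : ℕ} {ξ : Fin n → Fin d → ℤ}

theorem exists_affine_of_eval_eq_zero {v : Fin d → ℤ} {q : MvPolynomial (Fin d) ℂ}
    (hq : q ∈ affineProducts ξ v) : ∃ s : Finset (Fin n × ℂ),
      (∀ p ∈ s, pair (ξ p.1) v ≠ 0) ∧
      ∀ x : Fin d → ℂ, eval x q = 0 → ∃ p ∈ s, ∑ k, (ξ p.1 k : ℂ) * x k + p.2 = 0 := by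
  classical
  induction hq using Submonoid.closure_induction with
  | mem y hy =>
    obtain ⟨i, c, hi, rfl⟩ := hy
    refine ⟨{(i, c)}, by simpa using hi, fun x hx => ⟨(i, c), by simp, ?_⟩⟩
    simpa [linForm] using hx
  | one => exact ⟨∅, by simp, fun x hx => by simp at hx⟩
  | mul y z _ _ hy hz =>
    obtain ⟨s, hs, hs'⟩ := hy
    obtain ⟨t, ht, ht'⟩ := hz
    refine ⟨s ∪ t, fun p hp => ?_, fun x hx => ?_⟩
    · rcases Finset.mem_union.1 hp with h | h
      exacts [hs p h, ht p h]
    · rw [map_mul, mul_eq_zero] at hx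
      rcases hx with h | h
      · obtain ⟨p, hp, h⟩ := hs' x h
        exact ⟨p, Finset.mem_union_left _ hp, h⟩
      · obtain ⟨p, hp, h⟩ := ht' x h
        exact ⟨p, Finset.mem_union_right _ hp, h⟩

theorem eq_zero_of_forall_lines_complex {lam : Submodule ℝ (Fin d → ℝ) → Fin d → ℤ}
    (hspan : ∀ w : Fin d → ℝ, (∀ i, realForm (ξ i) w = 0) → w = 0)
    (hlam : ∀ l ∈ lines ξ, toReal (lam l) ∈ l) {w : Fin d → ℂ}
    (hw : ∀ l ∈ lines ξ, ∃ i, pair (ξ i) (lam l) ≠ 0 ∧ ∑ k, (ξ i k : ℂ) * w k = 0) : w = 0 := by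
  have hre : (fun k => (w k).re) = 0 := eq_zero_of_forall_lines hspan hlam fun l hl => by
    obtain ⟨i, hi, h⟩ := hw l hl
    refine ⟨i, hi, ?_⟩
    rw [realForm_apply]
    simpa using congrArg Complex.re h
  have him : (fun k => (w k).im) = 0 := eq_zero_of_forall_lines hspan hlam fun l hl => by
    obtain ⟨i, hi, h⟩ := hw l hl
    refine ⟨i, hi, ?_⟩
    rw [realForm_apply]
    simpa using congrArg Complex.im h
  ext k
  exact Complex.ext (congrFun hre k) (congrFun him k)

/-- The largest ideal contained in the kernel of a functional. -/
def kerIdeal (φ : MvPolynomial (Fin d) ℂ →ₗ[ℂ] ℂ) : Ideal (MvPolynomial (Fin d) ℂ) where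
  carrier := {q | ∀ f, φ (q * f) = 0}
  add_mem' := fun {p q} hp hq f => by rw [add_mul, map_add, hp f, hq f, add_zero]
  zero_mem' := fun f => by rw [zero_mul, map_zero]
  smul_mem' := fun c q hq f => by
    rw [smul_eq_mul, mul_comm c, mul_assoc]; exact hq (c * f)

theorem mem_kerIdeal {φ : MvPolynomial (Fin d) ℂ →ₗ[ℂ] ℂ} {q : MvPolynomial (Fin d) ℂ} :
    q ∈ kerIdeal φ ↔ ∀ f, φ (q * f) = 0 := Iff.rfl

/-- Each common zero selects, for every line, one of finitely many affine forms vanishing there. Two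
zeros with the same selection differ by a vector on which the linear parts vanish, so they coincide.
-/
theorem finite_zeroLocus {lam : Submodule ℝ (Fin d → ℝ) → Fin d → ℤ}
    (hspan : ∀ w : Fin d → ℝ, (∀ i, realForm (ξ i) w = 0) → w = 0)
    (hlam : ∀ l ∈ lines ξ, toReal (lam l) ∈ l) {I : Ideal (MvPolynomial (Fin d) ℂ)}
    (hI : ∀ l ∈ lines ξ, ∃ q ∈ affineProducts ξ (lam l), q ∈ I) :
    (zeroLocus ℂ I).Finite := by
  classical
  have h : ∀ l : lines ξ, ∃ s : Finset (Fin n × ℂ), (∀ p ∈ s, pair (ξ p.1) (lam l) ≠ 0) ∧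
      ∀ x ∈ zeroLocus ℂ I, ∃ p ∈ s, ∑ k, (ξ p.1 k : ℂ) * x k + p.2 = 0 := by
    intro l
    obtain ⟨q, hq, hqI⟩ := hI l l.2
    obtain ⟨s, hs, hs'⟩ := exists_affine_of_eval_eq_zero hq
    exact ⟨s, hs, fun x hx => hs' x (by simpa [aeval_eq_eval] using hx q hqI)⟩
  choose s hs hs' using h
  have hch : ∀ x : zeroLocus ℂ I, ∀ l : lines ξ, ∃ p : s l,
      ∑ k, (ξ p.1.1 k : ℂ) * x.1 k + p.1.2 = 0 := fun x l => by
    obtain ⟨p, hp, h⟩ := hs' l x x.2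
    exact ⟨⟨p, hp⟩, h⟩
  choose F hF using hch
  have hinj : Function.Injective F := by
    intro x y hxy
    have : x.1 - y.1 = 0 := eq_zero_of_forall_lines_complex hspan hlam fun l hl => by
      refine ⟨(F x ⟨l, hl⟩).1.1, hs ⟨l, hl⟩ _ (F x ⟨l, hl⟩).2, ?_⟩
      have h1 := hF x ⟨l, hl⟩
      have h2 := hF y ⟨l, hl⟩
      rw [← hxy] at h2
      simp only [Pi.sub_apply, mul_sub, Finset.sum_sub_distrib]
      linear_combination h1 - h2
    exact Subtype.ext (sub_eq_zero.1 this)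
  exact Set.finite_coe_iff.1 (Finite.of_injective F hinj)

/-- By the Nullstellensatz the product of x_k - z_k over the zeros z lies in the radical, so every
coordinate is integral modulo I. A finitely generated integral algebra is finite. -/
theorem finite_quotient_of_finite_zeroLocus {I : Ideal (MvPolynomial (Fin d) ℂ)}
    (hI : (zeroLocus ℂ I).Finite) : Module.Finite ℂ (MvPolynomial (Fin d) ℂ ⧸ I) := by
  classical
  have hint : ∀ k : Fin d, IsIntegral ℂ (Ideal.Quotient.mk I (X k)) := by
    intro k
    let p : Polynomial ℂ := ∏ z ∈ hI.toFinset, (Polynomial.X - Polynomial.C (z k))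
    have hp : p.Monic := Polynomial.monic_prod_of_monic _ _ fun z _ => Polynomial.monic_X_sub_C _
    have hmem : Polynomial.aeval (X k : MvPolynomial (Fin d) ℂ) p ∈ I.radical := by
      rw [← vanishingIdeal_zeroLocus_eq_radical (K := ℂ)]
      intro x hx
      rw [← Polynomial.aeval_algHom_apply, map_prod]
      refine Finset.prod_eq_zero (hI.mem_toFinset.2 hx) ?_
      simp
    obtain ⟨N, hN⟩ := hmem
    refine ⟨p ^ N, hp.pow N, ?_⟩
    change Polynomial.aeval _ _ = 0
    have e : (Ideal.Quotient.mk I (X k)) = Ideal.Quotient.mkₐ ℂ I (X k) := rfl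
    rw [e, Polynomial.aeval_algHom_apply, map_pow]
    exact Ideal.Quotient.eq_zero_iff_mem.2 hN
  have hall : Algebra.IsIntegral ℂ (MvPolynomial (Fin d) ℂ ⧸ I) := by
    refine ⟨fun x => ?_⟩
    obtain ⟨f, rfl⟩ := Ideal.Quotient.mk_surjective x
    induction f using MvPolynomial.induction_on with
    | C a => exact isIntegral_algebraMap (R := ℂ) (x := a)
    | add p q hp hq => rw [map_add]; exact hp.add hq
    | mul_X p k hp => rw [map_mul]; exact hp.mul (hint k)
  exact Algebra.IsIntegral.finite

theorem numSeries_add (S S' : (Fin d → ℂ) →₀ MvPolynomial (Fin d) ℂ) :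
    numSeries (S + S') = numSeries S + numSeries S' := by
  classical
  refine Finsupp.sum_add_index' (fun m => ?_) fun m p q => ?_
  · simp
  · simp [add_mul]

/-- Translating χ to the origin gives a functional that kills high powers of every coordinate, so
its generating function is a polynomial. Translating back multiplies by e^χ. -/
theorem exists_numSeries_of_nilpotent {φ : MvPolynomial (Fin d) ℂ →ₗ[ℂ] ℂ} {χ : Fin d → ℂ}
    {N : ℕ} (h : ∀ k f, φ ((X k - C (χ k)) ^ N * f) = 0) : ∃ S, coeffSeries φ = numSeries S := by
  classical
  let ψ := φ ∘ₗ (cshift (-χ)).toLinearMap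
  have hψ : ∀ k f, ψ (X k ^ N * f) = 0 := by
    intro k f
    have := h k (cshift (-χ) f)
    simpa [ψ, cshift_X, sub_eq_add_neg] using this
  let N' : Fin d →₀ ℕ := Finsupp.equivFunOnFinite.symm fun _ => N
  refine ⟨Finsupp.single χ (MvPowerSeries.trunc' ℂ N' (coeffSeries ψ)), ?_⟩
  have h1 : ((MvPowerSeries.trunc' ℂ N' (coeffSeries ψ) : MvPolynomial (Fin d) ℂ) :
      MvPowerSeries (Fin d) ℂ) = coeffSeries ψ := by
    ext k
    rw [coeff_coe, MvPowerSeries.coeff_trunc']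
    split_ifs with hk
    · rfl
    · obtain ⟨i, hi⟩ : ∃ i, N < k i := by
        by_contra! hcon
        exact hk fun i => hcon i
      have e : (monomial k (1 : ℂ)) = X i ^ N * monomial (k - Finsupp.single i N) 1 := by
        rw [X_pow_eq_monomial, monomial_mul, one_mul]
        congr 1
        rw [add_tsub_cancel_of_le]
        rw [Finsupp.single_le_iff]
        exact hi.le
      rw [coeff_coeffSeries, e, hψ, zero_div]
  have h2 : φ = ψ ∘ₗ (cshift χ).toLinearMap := by
    refine LinearMap.ext fun f => ?_
    simp [ψ, cshift_cshift, cshift_zero]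
  rw [numSeries, Finsupp.sum_single_index (by simp), h1, h2, ← expSeries_mul_coeffSeries, mul_comm]

/-- The transposes of multiplication by the coordinates commute on the finite-dimensional dual,
which is thus the sum of their simultaneous generalized eigenspaces. On each of these the previous
lemma applies, with the joint eigenvalue as exponent. -/
theorem exists_numSeries_comp {Q : Type*} [CommRing Q] [Algebra ℂ Q] [Module.Finite ℂ Q]
    (π : MvPolynomial (Fin d) ℂ →ₐ[ℂ] Q) (ψ : Module.Dual ℂ Q) :
    ∃ S, coeffSeries (ψ ∘ₗ π.toLinearMap) = numSeries S := by
  classical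
  let m : Fin d → Module.End ℂ (Module.Dual ℂ Q) := fun k =>
    (LinearMap.mulLeft ℂ (π (X k))).dualMap
  have hm1 : ∀ k (θ : Module.Dual ℂ Q) x, m k θ x = θ (π (X k) * x) := fun k θ x => rfl
  have hm : ∀ k (ψ : Module.Dual ℂ Q) (c : ℂ) (N : ℕ) f,
      (((m k - algebraMap ℂ _ c) ^ N) ψ) (π f) = ψ (π ((X k - C c) ^ N * f)) := by
    intro k ψ c N
    induction N with
    | zero => intro f; simp
    | succ N ih =>
      intro f
      have : ∀ θ : Module.Dual ℂ Q, ((m k - algebraMap ℂ _ c) θ) (π f) =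
          θ (π ((X k - C c) * f)) := by
        intro θ
        rw [LinearMap.sub_apply, Module.algebraMap_end_apply, LinearMap.sub_apply, hm1,
          LinearMap.smul_apply, sub_mul, map_sub, map_sub, map_mul π, ← smul_eq_C_mul, map_smul,
          map_smul]
      rw [pow_succ', Module.End.mul_apply, this, ih, pow_succ, mul_assoc]
  have hcomm : Pairwise fun i j => Commute (m i) (m j) := by
    intro i j _
    refine LinearMap.ext fun ψ => LinearMap.ext fun x => ?_
    rw [Module.End.mul_apply, Module.End.mul_apply, hm1, hm1, hm1, hm1, mul_left_comm]
  have htop :=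
    Module.End.iSup_iInf_maxGenEigenspace_eq_top_of_iSup_maxGenEigenspace_eq_top_of_commute
    m hcomm fun i => Module.End.iSup_maxGenEigenspace_eq_top (m i)
  have hψ : ψ ∈ ⨆ χ : Fin d → ℂ, ⨅ i, (m i).maxGenEigenspace (χ i) := by
    rw [htop]; trivial
  induction hψ using Submodule.iSup_induction' with
  | mem χ ψ hψ =>
    rw [Submodule.mem_iInf] at hψ
    have h1 : ∀ i, ∃ N : ℕ, ((m i - algebraMap ℂ _ (χ i)) ^ N) ψ = 0 := by
      intro i
      have := hψ i
      rw [Module.End.mem_maxGenEigenspace] at this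
      simpa only [Algebra.algebraMap_eq_smul_one] using this
    choose N hN using h1
    refine exists_numSeries_of_nilpotent (χ := χ) (N := ∑ i, N i) fun k f => ?_
    obtain ⟨M, hM⟩ : ∃ M, ∑ i, N i = N k + M :=
      ⟨_, (Nat.add_sub_of_le (Finset.single_le_sum (fun _ _ => Nat.zero_le _)
        (Finset.mem_univ k))).symm⟩
    rw [LinearMap.comp_apply, hM, pow_add, mul_assoc, AlgHom.toLinearMap_apply, ← hm, hN]
    rfl
  | zero => exact ⟨0, by ext k; simp [coeff_coeffSeries, numSeries]⟩
  | add x y _ _ hx hy =>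
    obtain ⟨S, hS⟩ := hx
    obtain ⟨S', hS'⟩ := hy
    exact ⟨S + S', by rw [LinearMap.add_comp, coeffSeries_add, hS, hS', numSeries_add]⟩

theorem exists_numSeries_of_finite_quotient {φ : MvPolynomial (Fin d) ℂ →ₗ[ℂ] ℂ}
    (hfin : Module.Finite ℂ (MvPolynomial (Fin d) ℂ ⧸ kerIdeal φ)) :
    ∃ S, coeffSeries φ = numSeries S := by
  have hker : (kerIdeal φ).restrictScalars ℂ ≤ LinearMap.ker φ := by
    intro f hf
    simpa using mem_kerIdeal.1 hf 1
  exact exists_numSeries_comp (Ideal.Quotient.mkₐ ℂ (kerIdeal φ))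
    (((kerIdeal φ).restrictScalars ℂ).liftQ φ hker)

theorem exists_isNumerator {b : Fin n → ℂ} {ρ : CoulombBranch ξ b ≃+* CoulombBranch ξ b}
    {ζ : Fin d → ℂ} {T : CoulombBranch ξ b →ₗ[ℂ] ℂ}
    (hζ : ∀ v, ρ (ρ (mono ξ b v 1)) = twist ζ v • mono ξ b v 1)
    (hT : ∀ x y, T (x * y) = T (y * ρ (ρ x))) (h1 : T 1 ≠ 0)
    {lam : Submodule ℝ (Fin d → ℝ) → Fin d → ℤ} (hlam : ∀ l ∈ lines ξ, toReal (lam l) ∈ l) :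
    ∃ S, IsNumerator T lam ζ S := by
  obtain ⟨φ, hφ, hq⟩ := exists_functional_denSeries_mul (ξ := ξ) hζ hT lam
  have hspan : ∀ w : Fin d → ℝ, (∀ i, realForm (ξ i) w = 0) → w = 0 := by
    intro w hw
    by_contra hw0
    obtain ⟨v, hv0, hv⟩ := exists_int_ker_of_real_ker ξ hw0 hw
    exact hv0 (eq_zero_of_not_spanning hζ hT h1 hv)
  obtain ⟨S, hS⟩ := exists_numSeries_of_finite_quotient (φ := φ)
    (finite_quotient_of_finite_zeroLocus (finite_zeroLocus hspan hlam hq))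
  exact ⟨S, by rw [IsNumerator, ← hφ, hS]⟩

end AbelianCoulomb

end

/-! ### Exponentials of skew-symmetric operators with analytic vectors -/

noncomputable section

namespace AbelianCoulomb

open Filter Topology

section TwoParameter

variable {H : Type*} [NormedAddCommGroup H] [NormedSpace ℂ H]

/-- The general term of the double exponential series `∑ s^j t^k a_{j+k} / (j! k!)`. -/
def doubleTerm (a : ℕ → H) (s t : ℂ) (p : ℕ × ℕ) : H :=
  (s ^ p.1 * t ^ p.2 * ((p.1.factorial : ℂ)⁻¹ * (p.2.factorial : ℂ)⁻¹)) • a (p.1 + p.2)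

theorem sum_antidiagonal_pow_div_factorial {K : Type*} [Field K] [CharZero K] (s t : K) (n : ℕ) :
    ∑ p ∈ Finset.HasAntidiagonal.antidiagonal n,
      s ^ p.1 * t ^ p.2 * ((p.1.factorial : K)⁻¹ * (p.2.factorial : K)⁻¹) =
      (s + t) ^ n * (n.factorial : K)⁻¹ := by
  rw [(Commute.all s t).add_pow', Finset.sum_mul]
  refine Finset.sum_congr rfl fun p hp => ?_
  rw [Finset.HasAntidiagonal.mem_antidiagonal] at hp
  have h : ((n.choose p.1 * p.1.factorial * p.2.factorial : ℕ) : K) = (n.factorial : K) := by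
    rw [← hp, Nat.choose_symm_add, Nat.add_choose_mul_factorial_mul_factorial]
  have h0 : (n.factorial : K) ≠ 0 := by exact_mod_cast n.factorial_ne_zero
  have h1 : (p.1.factorial : K) ≠ 0 := by exact_mod_cast p.1.factorial_ne_zero
  have h2 : (p.2.factorial : K) ≠ 0 := by exact_mod_cast p.2.factorial_ne_zero
  have h3 : (n.factorial : K)⁻¹ * n.choose p.1 = (p.1.factorial : K)⁻¹ * (p.2.factorial : K)⁻¹ := by
    push_cast at h
    field_simp
    linear_combination h
  rw [nsmul_eq_mul, ← h3]
  ring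

/-- On each antidiagonal the binomial theorem collapses the weights to (|s| + |t|)^n / n!, and the
factorial bound on a leaves a geometric series. -/
theorem summable_norm_doubleTerm {a : ℕ → H} {C ρ : ℝ} (hρ : 0 ≤ ρ)
    (ha : ∀ n, ‖a n‖ ≤ C * n.factorial * ρ ^ n) {s t : ℂ} (hst : (‖s‖ + ‖t‖) * ρ < 1) :
    Summable fun p => ‖doubleTerm a s t p‖ := by
  rw [← Finset.HasAntidiagonal.sigmaAntidiagonalEquivProd.summable_iff]
  refine (summable_sigma_of_nonneg (fun _ => norm_nonneg _)).2 ?_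
  refine ⟨fun n => (hasSum_fintype _).summable, ?_⟩
  refine Summable.of_nonneg_of_le (fun n => tsum_nonneg fun _ => norm_nonneg _) (fun n => ?_)
    ((summable_geometric_of_lt_one (by positivity) hst).mul_left C)
  rw [tsum_fintype]
  calc _ = ∑ p ∈ Finset.HasAntidiagonal.antidiagonal n, ‖doubleTerm a s t p‖ := by
        rw [← Finset.sum_coe_sort (Finset.HasAntidiagonal.antidiagonal n)]; rfl
    _ ≤ ∑ p ∈ Finset.HasAntidiagonal.antidiagonal n, (‖s‖ ^ p.1 * ‖t‖ ^ p.2 *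
          ((p.1.factorial : ℝ)⁻¹ * (p.2.factorial : ℝ)⁻¹)) * (C * n.factorial * ρ ^ n) := by
        refine Finset.sum_le_sum fun p hp => ?_
        rw [Finset.HasAntidiagonal.mem_antidiagonal] at hp
        rw [doubleTerm, norm_smul, hp]
        have := ha n
        simp only [norm_mul, norm_pow, norm_inv, Complex.norm_natCast]
        gcongr
    _ = C * ((‖s‖ + ‖t‖) * ρ) ^ n := by
        rw [← Finset.sum_mul, sum_antidiagonal_pow_div_factorial, mul_pow]
        have : (n.factorial : ℝ) ≠ 0 := by exact_mod_cast n.factorial_ne_zero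
        field_simp

theorem summable_exp_smul [CompleteSpace H] {a : ℕ → H} {C ρ : ℝ} (hρ : 0 ≤ ρ)
    (ha : ∀ n, ‖a n‖ ≤ C * n.factorial * ρ ^ n) {t : ℂ} (ht : ‖t‖ * ρ < 1) :
    Summable fun n : ℕ => (t ^ n * (n.factorial : ℂ)⁻¹) • a n := by
  refine Summable.of_norm_bounded ((summable_geometric_of_lt_one (by positivity) ht).mul_left C)
    fun n => ?_
  rw [norm_smul, norm_mul, norm_pow, norm_inv, Complex.norm_natCast]
  calc _ ≤ ‖t‖ ^ n * (n.factorial : ℝ)⁻¹ * (C * n.factorial * ρ ^ n) := by gcongr; exact ha n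
    _ = _ := by
      have : (n.factorial : ℝ) ≠ 0 := by exact_mod_cast n.factorial_ne_zero
      rw [mul_pow]; field_simp

/-- The series form of exp(sA) exp(tA) = exp((s + t)A); it gives both the isometry property (s = -1,
t = 1) and the group law. -/
theorem hasSum_doubleTerm [CompleteSpace H] {a : ℕ → H} {C ρ : ℝ} (hρ : 0 ≤ ρ)
    (ha : ∀ n, ‖a n‖ ≤ C * n.factorial * ρ ^ n) {s t : ℂ} (hst : (‖s‖ + ‖t‖) * ρ < 1) :
    HasSum (doubleTerm a s t) (∑' n : ℕ, ((s + t) ^ n * (n.factorial : ℂ)⁻¹) • a n) := by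
  have h := (summable_norm_doubleTerm hρ ha hst).of_norm.hasSum
  have h' := (Finset.HasAntidiagonal.sigmaAntidiagonalEquivProd.hasSum_iff).2 h
  have h2 := h'.sigma (g := fun n : ℕ => ((s + t) ^ n * (n.factorial : ℂ)⁻¹) • a n) fun n => by
    have h3 := hasSum_fintype (fun c : Finset.HasAntidiagonal.antidiagonal n =>
      (doubleTerm a s t ∘ Finset.HasAntidiagonal.sigmaAntidiagonalEquivProd) ⟨n, c⟩)
    convert! h3 using 1
    rw [← sum_antidiagonal_pow_div_factorial, Finset.sum_smul, ← Finset.sum_coe_sort]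
    refine Finset.sum_congr rfl fun c _ => ?_
    have hc := c.2
    rw [Finset.HasAntidiagonal.mem_antidiagonal] at hc
    change _ = doubleTerm a s t c.1
    rw [doubleTerm, hc]
  rwa [h2.tsum_eq]

end TwoParameter

open scoped InnerProductSpace

open UniformSpace (Completion)

variable {V E : Type*} [NormedAddCommGroup V] [InnerProductSpace ℂ V]
  [NormedAddCommGroup E] [NormedSpace ℝ E]

/-- A homogeneous family of skew-symmetric operators for which all vectors are analytic, with
uniform radius. -/
structure IsAnalyticSkew (A : E → Module.End ℂ V) (ρ : ℝ) : Prop where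
  pos : 0 < ρ
  smul : ∀ (s : ℝ) (y : E), A (s • y) = (s : ℂ) • A y
  skew : ∀ y p q, inner ℂ (A y p) q = -inner ℂ p (A y q)
  cont : ∀ p (n : ℕ), Continuous fun y => (A y ^ n) p
  bound : ∀ p, ∃ C, ∀ y (n : ℕ), ‖(A y ^ n) p‖ ≤ C * n.factorial * (ρ * ‖y‖) ^ n

/-- The sum of the exponential series `exp (A y) p` in the completion. -/
def expVec (A : E → Module.End ℂ V) (y : E) (p : V) : Completion V :=
  ∑' n : ℕ, ((n.factorial : ℂ)⁻¹) • (((A y ^ n) p : V) : Completion V)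

namespace IsAnalyticSkew

variable {A : E → Module.End ℂ V} {ρ : ℝ} (hA : IsAnalyticSkew A ρ)
include hA

theorem bound_coe (p : V) : ∃ C, ∀ y (n : ℕ),
    ‖(((A y ^ n) p : V) : Completion V)‖ ≤ C * n.factorial * (ρ * ‖y‖) ^ n := by
  simpa only [Completion.norm_coe] using hA.bound p

theorem nonneg (y : E) : 0 ≤ ρ * ‖y‖ := mul_nonneg hA.pos.le (norm_nonneg y)

theorem smul_pow (s : ℝ) (y : E) (n : ℕ) (p : V) :
    (A (s • y) ^ n) p = ((s : ℂ) ^ n) • (A y ^ n) p := by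
  rw [hA.smul, _root_.smul_pow, LinearMap.smul_apply]

theorem hasSum_expVec {y : E} (hy : ρ * ‖y‖ < 1) (p : V) :
    HasSum (fun n : ℕ => ((n.factorial : ℂ)⁻¹) • (((A y ^ n) p : V) : Completion V))
      (expVec A y p) := by
  obtain ⟨C, hC⟩ := hA.bound_coe p
  have := summable_exp_smul (hA.nonneg y) (hC y) (t := 1) (by simpa using hy)
  simp only [one_pow, one_mul] at this
  exact this.hasSum

theorem hasSum_expVec_smul {y : E} {s : ℝ} (hy : ρ * ‖s • y‖ < 1) (p : V) :
    HasSum (fun n : ℕ => ((s : ℂ) ^ n * (n.factorial : ℂ)⁻¹) •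
      (((A y ^ n) p : V) : Completion V)) (expVec A (s • y) p) := by
  have := hA.hasSum_expVec hy p
  simp only [hA.smul_pow, Completion.coe_smul, smul_smul] at this
  simpa only [mul_comm] using this

theorem skew_pow (y : E) (j : ℕ) (p q : V) :
    inner ℂ ((A y ^ j) p) q = (-1) ^ j * inner ℂ p ((A y ^ j) q) := by
  induction j generalizing q with
  | zero => simp
  | succ j ih =>
    rw [pow_succ', Module.End.mul_apply, hA.skew, ih, ← Module.End.mul_apply, ← pow_succ,
      ← pow_succ']
    ring

/-- Skew-symmetry moves all operators to the right and produces a double exponential series with s =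
-1 and t = 1, of which only the term n = 0 survives. The bound 1/2 ensures (|s| + |t|) ρ‖y‖ < 1. -/
theorem inner_expVec {y : E} (hy : ρ * ‖y‖ < 1 / 2) (p q : V) :
    inner ℂ (expVec A y p) (expVec A y q) = inner ℂ p q := by
  obtain ⟨C, hC⟩ := hA.bound q
  have hb : ∀ n : ℕ, ‖inner ℂ p ((A y ^ n) q)‖ ≤ (‖p‖ * C) * n.factorial * (ρ * ‖y‖) ^ n := by
    intro n
    refine (norm_inner_le_norm _ _).trans ?_
    calc _ ≤ ‖p‖ * (C * n.factorial * (ρ * ‖y‖) ^ n) := by gcongr; exact hC y n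
      _ = _ := by ring
  have h1 := hasSum_doubleTerm (hA.nonneg y) hb (s := -1) (t := 1) (by
    simp only [norm_neg, norm_one]; linarith)
  have h2 : ∀ j : ℕ, HasSum (fun k => doubleTerm (fun n => inner ℂ p ((A y ^ n) q)) (-1) 1 (j, k))
      (inner ℂ (((j.factorial : ℂ)⁻¹) • (((A y ^ j) p : V) : Completion V)) (expVec A y q)) := by
    intro j
    have := (innerSL ℂ (((j.factorial : ℂ)⁻¹) • (((A y ^ j) p : V) : Completion V))).hasSum
      (hA.hasSum_expVec (by linarith) q)
    convert! this using 2 with k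
    rw [innerSL_apply_apply, inner_smul_left, inner_smul_right, Completion.inner_coe, hA.skew_pow,
      ← Module.End.mul_apply, ← pow_add]
    simp [doubleTerm]
    ring
  have h3 := h1.prod_fiberwise h2
  have h4 := (innerSLFlip ℂ (expVec A y q)).hasSum (hA.hasSum_expVec (y := y) (by linarith) p)
  have h5 := h3.unique (by simpa only [innerSLFlip_apply_apply] using! h4)
  rw [← h5, tsum_eq_single 0]
  · simp
  · intro n hn
    simp [hn]

theorem expVec_add {y : E} (hy : ρ * ‖y‖ < 1) (p q : V) :
    expVec A y (p + q) = expVec A y p + expVec A y q := by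
  refine (hA.hasSum_expVec hy (p + q)).unique ?_
  simpa [smul_add, Completion.coe_add] using! (hA.hasSum_expVec hy p).add (hA.hasSum_expVec hy q)

theorem expVec_smul {y : E} (hy : ρ * ‖y‖ < 1) (c : ℂ) (p : V) :
    expVec A y (c • p) = c • expVec A y p := by
  refine (hA.hasSum_expVec hy (c • p)).unique ?_
  simpa [smul_comm c, Completion.coe_smul] using! (hA.hasSum_expVec hy p).const_smul c

theorem norm_expVec {y : E} (hy : ρ * ‖y‖ < 1 / 2) (p : V) : ‖expVec A y p‖ = ‖p‖ := by
  have h := hA.inner_expVec hy p p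
  rw [inner_self_eq_norm_sq_to_K, inner_self_eq_norm_sq_to_K] at h
  have h' : ‖expVec A y p‖ ^ 2 = ‖p‖ ^ 2 := by exact_mod_cast h
  exact (sq_eq_sq₀ (norm_nonneg _) (norm_nonneg _)).1 h'

omit hA in
open Classical in
/-- The unitary operator `exp (A y)` for small `y`, defined on the whole completion. -/
def _root_.AbelianCoulomb.smallExp (A : E → Module.End ℂ V) (ρ : ℝ) (hA : IsAnalyticSkew A ρ)
    (y : E) : Completion V →L[ℂ] Completion V :=
  if hy : ρ * ‖y‖ < 1 / 2 then
    LinearMap.extendOfNorm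
      { toFun := expVec A y
        map_add' := hA.expVec_add (by linarith)
        map_smul' := hA.expVec_smul (by linarith) }
      (Completion.toComplL (𝕜 := ℂ) (E := V)).toLinearMap
  -- A junk value: a general y is first divided by a large integer to bring it inside this radius.
  else 0

theorem smallExp_coe {y : E} (hy : ρ * ‖y‖ < 1 / 2) (p : V) :
    smallExp A ρ hA y (p : Completion V) = expVec A y p := by
  rw [smallExp, dif_pos hy]
  exact LinearMap.extendOfNorm_eq (e := (Completion.toComplL (𝕜 := ℂ) (E := V)).toLinearMap)
    Completion.denseRange_coe ⟨1, fun x => by simp [hA.norm_expVec hy]⟩ p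

theorem norm_smallExp {y : E} (hy : ρ * ‖y‖ < 1 / 2) (x : Completion V) :
    ‖smallExp A ρ hA y x‖ = ‖x‖ := by
  induction x using Completion.induction_on with
  | hp => exact isClosed_eq (by fun_prop) continuous_norm
  | ih p => rw [hA.smallExp_coe hy, hA.norm_expVec hy, Completion.norm_coe]

/-- On V the inner exponential is expanded, the outer bounded operator is applied term by term, and
the double series is resummed. Density gives the completion. -/
theorem smallExp_smul_comp {y : E} {s t : ℝ} (h : (|s| + |t|) * (ρ * ‖y‖) < 1 / 2)
    (x : Completion V) : smallExp A ρ hA (s • y) (smallExp A ρ hA (t • y) x) =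
      smallExp A ρ hA ((s + t) • y) x := by
  have e : ∀ r : ℝ, |r| ≤ |s| + |t| → ρ * ‖r • y‖ < 1 / 2 := fun r hr => by
    rw [norm_smul, Real.norm_eq_abs]
    nlinarith [mul_le_mul_of_nonneg_right hr (hA.nonneg y)]
  have hs := e s (by linarith [abs_nonneg t])
  have ht := e t (by linarith [abs_nonneg s])
  have hst := e (s + t) (abs_add_le s t)
  induction x using Completion.induction_on with
  | hp => exact isClosed_eq (by fun_prop) (by fun_prop)
  | ih p =>
    rw [hA.smallExp_coe ht, hA.smallExp_coe hst]
    obtain ⟨C, hC⟩ := hA.bound_coe p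
    have h1 := hasSum_doubleTerm (hA.nonneg y) (hC y) (s := t) (t := s) (by
      simp only [Complex.norm_real, Real.norm_eq_abs]; linarith)
    have h2 : ∀ k : ℕ, HasSum (fun j => doubleTerm
        (fun n => (((A y ^ n) p : V) : Completion V)) t s (k, j))
        (smallExp A ρ hA (s • y) (((t : ℂ) ^ k * (k.factorial : ℂ)⁻¹) •
          (((A y ^ k) p : V) : Completion V))) := by
      intro k
      rw [map_smul, hA.smallExp_coe hs]
      convert! (hA.hasSum_expVec_smul (y := y) (s := s) (by linarith)
        ((A y ^ k) p)).const_smul ((t : ℂ) ^ k * (k.factorial : ℂ)⁻¹) using 2 with j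
      rw [← Module.End.mul_apply, ← pow_add, smul_smul, doubleTerm, add_comm k j]
      congr 1
      ring
    have h3 := h1.prod_fiberwise h2
    have h4 := (smallExp A ρ hA (s • y)).hasSum
      (hA.hasSum_expVec_smul (y := y) (s := t) (by linarith) p)
    rw [h4.unique h3]
    have h5 := hA.hasSum_expVec_smul (y := y) (s := s + t) (by linarith) p
    rw [← h5.tsum_eq]
    simp [add_comm (s : ℂ)]

theorem continuousOn_expVec (p : V) :
    ContinuousOn (fun y => expVec A y p) {y | ρ * ‖y‖ < 1 / 2} := by
  obtain ⟨C, hC⟩ := hA.bound_coe p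
  have hC0 : 0 ≤ C := by simpa using (norm_nonneg _).trans (hC 0 0)
  refine continuousOn_tsum (u := fun n => C * (1 / 2) ^ n) (fun n => ?_)
    ((summable_geometric_of_lt_one (by norm_num) (by norm_num)).mul_left C) fun n y hy => ?_
  · have := (Completion.continuous_coe V).comp (hA.cont p n)
    exact (this.const_smul ((n.factorial : ℂ)⁻¹)).continuousOn
  · rw [norm_smul, norm_inv, Complex.norm_natCast]
    have h0 : (n.factorial : ℝ) ≠ 0 := by exact_mod_cast n.factorial_ne_zero
    calc _ ≤ (n.factorial : ℝ)⁻¹ * (C * n.factorial * (ρ * ‖y‖) ^ n) := by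
          gcongr; exact hC y n
      _ = C * (ρ * ‖y‖) ^ n := by field_simp
      _ ≤ _ := by
        have := hA.nonneg y
        have hy' : ρ * ‖y‖ < 1 / 2 := hy
        gcongr

/-- Joint continuity in the parameter and the vector: x is approximated by an element of V, where
the series converges uniformly, and the isometry property controls the error uniformly in the
parameter. -/
theorem tendsto_smallExp {α : Type*} {l : Filter α} {f : α → E} {g : α → Completion V} {y : E}
    {x : Completion V} (hy : ρ * ‖y‖ < 1 / 2) (hf : Tendsto f l (𝓝 y)) (hg : Tendsto g l (𝓝 x)) :
    Tendsto (fun a => smallExp A ρ hA (f a) (g a)) l (𝓝 (smallExp A ρ hA y x)) := by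
  have hopen : IsOpen {y : E | ρ * ‖y‖ < 1 / 2} :=
    isOpen_lt (by fun_prop) continuous_const
  rw [Metric.tendsto_nhds]
  intro ε hε
  -- The difference splits into four terms, each smaller than ε / 4.
  obtain ⟨p, hp⟩ := Metric.denseRange_iff.1 (Completion.denseRange_coe (α := V)) x (ε / 4)
    (by linarith)
  have h1 : ∀ᶠ a in l, ρ * ‖f a‖ < 1 / 2 := hf.eventually (hopen.mem_nhds hy)
  have h2 : Tendsto (fun a => expVec A (f a) p) l (𝓝 (expVec A y p)) :=
    ((hA.continuousOn_expVec p).continuousAt (hopen.mem_nhds hy)).tendsto.comp hf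
  filter_upwards [h1, Metric.tendsto_nhds.1 h2 (ε / 4) (by linarith),
    Metric.tendsto_nhds.1 hg (ε / 4) (by linarith)] with a ha1 ha2 ha3
  rw [dist_eq_norm] at *
  rw [← hA.smallExp_coe hy, ← hA.smallExp_coe ha1] at ha2
  have e : smallExp A ρ hA (f a) (g a) - smallExp A ρ hA y x =
      smallExp A ρ hA (f a) (g a - x) + smallExp A ρ hA (f a) (x - p) +
      (smallExp A ρ hA (f a) p - smallExp A ρ hA y p) - smallExp A ρ hA y (x - p) := by
    simp only [map_sub]; abel
  rw [e]
  refine (norm_sub_le _ _).trans_lt ?_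
  refine lt_of_le_of_lt (add_le_add_left (norm_add₃_le) _) ?_
  rw [hA.norm_smallExp hy, hA.norm_smallExp ha1, hA.norm_smallExp ha1]
  linarith

/-- The operator `exp (A y)` as the `K`-th power of `exp (A (y / K))`. -/
def _root_.AbelianCoulomb.powExp (A : E → Module.End ℂ V) (ρ : ℝ) (hA : IsAnalyticSkew A ρ)
    (K : ℕ) (y : E) : Completion V →L[ℂ] Completion V :=
  smallExp A ρ hA ((K : ℝ)⁻¹ • y) ^ K

theorem smallExp_zero : smallExp A ρ hA 0 = 1 := by
  ext x
  have h0 : ρ * ‖(0 : E)‖ < 1 / 2 := by simp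
  induction x using Completion.induction_on with
  | hp => exact isClosed_eq (by fun_prop) (by fun_prop)
  | ih p =>
    have h := hA.hasSum_expVec_smul (y := (0 : E)) (s := 0) (by simp) p
    rw [hA.smallExp_coe h0, ← smul_zero (0 : ℝ), ← h.tsum_eq, tsum_eq_single 0]
    · simp
    · intro n hn
      simp [hn]

theorem smallExp_pow {y : E} (K j : ℕ) (hj : j ≤ K) (hy : ρ * ‖y‖ < 1 / 2) :
    smallExp A ρ hA ((K : ℝ)⁻¹ • y) ^ j = smallExp A ρ hA (((j : ℝ) * (K : ℝ)⁻¹) • y) := by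
  induction j with
  | zero => simp [hA.smallExp_zero]
  | succ j ih =>
    rw [pow_succ', ih (by omega)]
    ext x
    have hK : (0 : ℝ) < K := by exact_mod_cast (by omega : 0 < K)
    have hj' : ((j : ℝ) + 1) ≤ K := by exact_mod_cast hj
    rw [mul_apply_eq_comp, hA.smallExp_smul_comp]
    · congr 3
      push_cast
      ring
    · rw [abs_of_pos (inv_pos.2 hK), abs_of_nonneg (by positivity)]
      have : (K : ℝ)⁻¹ + j * (K : ℝ)⁻¹ ≤ 1 := by
        rw [← one_add_mul, ← div_eq_mul_inv, div_le_one hK]; linarith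
      nlinarith [hA.nonneg y, mul_le_mul_of_nonneg_right this (hA.nonneg y)]

theorem small_div {y : E} {K : ℕ} (hK : 2 * (ρ * ‖y‖) < K) : ρ * ‖(K : ℝ)⁻¹ • y‖ < 1 / 2 := by
  have h0 : (0 : ℝ) < K := lt_of_le_of_lt (by have := hA.nonneg y; positivity) hK
  rw [norm_smul, norm_inv, Real.norm_natCast, mul_left_comm, inv_mul_lt_iff₀ h0]
  linarith

theorem powExp_eq_smallExp {y : E} {K : ℕ} (hK : 0 < K) (hy : ρ * ‖y‖ < 1 / 2) :
    powExp A ρ hA K y = smallExp A ρ hA y := by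
  have h0 : (K : ℝ) ≠ 0 := by exact_mod_cast hK.ne'
  rw [powExp, hA.smallExp_pow K K le_rfl hy, mul_inv_cancel₀ h0, one_smul]

theorem powExp_mul {y : E} {K L : ℕ} (hL : 0 < L) (hK : 2 * (ρ * ‖y‖) < K) :
    powExp A ρ hA (K * L) y = powExp A ρ hA K y := by
  have h := hA.powExp_eq_smallExp hL (hA.small_div hK)
  rw [powExp, smul_smul] at h
  rw [powExp, powExp, ← h, ← pow_mul, mul_comm K L]
  congr 3
  push_cast
  rw [mul_inv]

/-- Both sides agree with the subdivision into K L parts, so exp(A y) does not depend on the number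
of subdivisions once it is large enough. -/
theorem powExp_congr {y : E} {K L : ℕ} (hK : 2 * (ρ * ‖y‖) < K) (hL : 2 * (ρ * ‖y‖) < L) :
    powExp A ρ hA K y = powExp A ρ hA L y := by
  have hy := hA.nonneg y
  have hK' : 0 < K := by exact_mod_cast (lt_of_le_of_lt (by positivity) hK : (0 : ℝ) < K)
  have hL' : 0 < L := by exact_mod_cast (lt_of_le_of_lt (by positivity) hL : (0 : ℝ) < L)
  rw [← hA.powExp_mul hL' hK, mul_comm, hA.powExp_mul hK' hL]

theorem norm_powExp {y : E} {K : ℕ} (hK : 2 * (ρ * ‖y‖) < K) (x : Completion V) :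
    ‖powExp A ρ hA K y x‖ = ‖x‖ := by
  have : ∀ j : ℕ, ‖(smallExp A ρ hA ((K : ℝ)⁻¹ • y) ^ j) x‖ = ‖x‖ := by
    intro j
    induction j with
    | zero => simp
    | succ j ih =>
      rw [pow_succ', mul_apply_eq_comp, hA.norm_smallExp (hA.small_div hK), ih]
  exact this K

theorem continuousAt_powExp {y : E} {K : ℕ} (hK : 2 * (ρ * ‖y‖) < K) (x : Completion V) :
    ContinuousAt (fun z => powExp A ρ hA K z x) y := by
  have : ∀ j : ℕ, Tendsto (fun z => (smallExp A ρ hA ((K : ℝ)⁻¹ • z) ^ j) x) (𝓝 y)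
      (𝓝 ((smallExp A ρ hA ((K : ℝ)⁻¹ • y) ^ j) x)) := by
    intro j
    induction j with
    | zero => simp
    | succ j ih =>
      simp only [pow_succ', mul_apply_eq_comp]
      exact hA.tendsto_smallExp (hA.small_div hK)
        ((continuous_const_smul ((K : ℝ)⁻¹)).tendsto y) ih
  exact this K

theorem powExp_add_smul {y : E} {K : ℕ} {s t : ℝ} (h : 2 * ((|s| + |t|) * (ρ * ‖y‖)) < K)
    (ht : |t| * (ρ * ‖y‖) < 1 / 2) :
    powExp A ρ hA K ((s + t) • y) = powExp A ρ hA K (s • y) * smallExp A ρ hA (t • y) := by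
  have hy := hA.nonneg y
  have hK : (0 : ℝ) < K := lt_of_le_of_lt (by positivity) h
  have hK' : 0 < K := by exact_mod_cast hK
  rw [← hA.powExp_eq_smallExp (y := t • y) hK' (by
    rw [norm_smul, Real.norm_eq_abs]; linarith)]
  have key : ∀ a b : ℝ, |a| + |b| = |s| + |t| →
      smallExp A ρ hA ((K : ℝ)⁻¹ • a • y) * smallExp A ρ hA ((K : ℝ)⁻¹ • b • y) =
      smallExp A ρ hA ((K : ℝ)⁻¹ • (a + b) • y) := by
    intro a b hab
    ext x
    rw [mul_apply_eq_comp, smul_smul, smul_smul, hA.smallExp_smul_comp, smul_smul,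
      mul_add]
    rw [abs_mul, abs_mul, ← mul_add, hab, abs_of_pos (inv_pos.2 hK), mul_assoc,
      inv_mul_lt_iff₀ hK]
    linarith
  have hc : Commute (smallExp A ρ hA ((K : ℝ)⁻¹ • s • y))
      (smallExp A ρ hA ((K : ℝ)⁻¹ • t • y)) := by
    rw [Commute, SemiconjBy, key s t rfl, key t s (add_comm _ _), add_comm]
  rw [powExp, powExp, powExp, ← hc.mul_pow, key s t rfl]

omit hA in
/-- The matrix coefficient of `exp (A y)` at a vector. -/
def _root_.AbelianCoulomb.matrixCoeff (A : E → Module.End ℂ V) (ρ : ℝ) (hA : IsAnalyticSkew A ρ)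
    (e : V) (y : E) : ℂ :=
  -- The chosen number of parts is the least K with ρ‖y‖ / K < 1/2.
  inner ℂ (e : Completion V) (powExp A ρ hA (⌊2 * (ρ * ‖y‖)⌋₊ + 1) y e)

theorem matrixCoeff_eq (e : V) {y : E} {K : ℕ} (hK : 2 * (ρ * ‖y‖) < K) :
    matrixCoeff A ρ hA e y = inner ℂ (e : Completion V) (powExp A ρ hA K y e) := by
  rw [matrixCoeff, hA.powExp_congr _ hK]
  exact_mod_cast Nat.lt_floor_add_one _

theorem continuous_matrixCoeff (e : V) : Continuous (matrixCoeff A ρ hA e) := by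
  rw [continuous_iff_continuousAt]
  intro y
  obtain ⟨K, hK⟩ := exists_nat_gt (2 * (ρ * ‖y‖))
  have hopen : IsOpen {z : E | 2 * (ρ * ‖z‖) < K} := isOpen_lt (by fun_prop) continuous_const
  have h := ((innerSL ℂ (e : Completion V)).continuous.continuousAt).comp
    (hA.continuousAt_powExp hK (e : Completion V))
  refine h.congr ?_
  filter_upwards [hopen.mem_nhds hK] with z hz
  rw [hA.matrixCoeff_eq e hz]; rfl

theorem norm_matrixCoeff_le (e : V) (y : E) : ‖matrixCoeff A ρ hA e y‖ ≤ ‖e‖ ^ 2 := by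
  obtain ⟨K, hK⟩ := exists_nat_gt (2 * (ρ * ‖y‖))
  rw [hA.matrixCoeff_eq e hK]
  refine (norm_inner_le_norm _ _).trans ?_
  rw [hA.norm_powExp hK, Completion.norm_coe, sq]

theorem hasSum_matrixCoeff (e : V) {y : E} (hy : ρ * ‖y‖ < 1 / 2) :
    HasSum (fun n : ℕ => inner ℂ e ((A y ^ n) e) / (n.factorial : ℂ)) (matrixCoeff A ρ hA e y) := by
  rw [hA.matrixCoeff_eq e (K := 1) (by push_cast; linarith),
    hA.powExp_eq_smallExp one_pos hy, hA.smallExp_coe hy]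
  have := (innerSL ℂ (e : Completion V)).hasSum (hA.hasSum_expVec (y := y) (by linarith) e)
  convert! this using 2 with n
  rw [innerSL_apply_apply, inner_smul_right, Completion.inner_coe]
  ring

theorem matrixCoeff_zero (e : V) : matrixCoeff A ρ hA e 0 = (‖e‖ ^ 2 : ℝ) := by
  rw [hA.matrixCoeff_eq e (K := 1) (by simp), hA.powExp_eq_smallExp one_pos (by simp),
    hA.smallExp_zero]
  simp [inner_self_eq_norm_sq_to_K]

/-- Near t₀ one has exp((t₀ + t)y) = exp(t₀ y) exp(t y). The second factor applied to e is a
convergent power series in t, and the first is absorbed into a bounded functional. -/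
theorem analyticAt_matrixCoeff (e : V) (y : E) (t₀ : ℝ) :
    AnalyticAt ℝ (fun t : ℝ => matrixCoeff A ρ hA e (t • y)) t₀ := by
  have hy := hA.nonneg y
  -- The summand 1 leaves room for |t| < 1, so one K serves a whole neighbourhood of t₀.
  obtain ⟨K, hK⟩ := exists_nat_gt (2 * ((|t₀| + 1) * (ρ * ‖y‖)))
  set B := innerSL ℂ (e : Completion V) ∘L powExp A ρ hA K (t₀ • y) with hB
  let q : FormalMultilinearSeries ℝ ℝ ℂ := fun n => ContinuousMultilinearMap.mkPiRing ℝ (Fin n)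
    ((n.factorial : ℂ)⁻¹ * B (((A y ^ n) e : V) : Completion V))
  refine ⟨q, hasFPowerSeriesAt_iff.2 ?_⟩
  have hopen : IsOpen {t : ℝ | |t| * (ρ * ‖y‖) < 1 / 2} := isOpen_lt (by fun_prop) continuous_const
  filter_upwards [hopen.mem_nhds (by simp : |(0 : ℝ)| * (ρ * ‖y‖) < 1 / 2),
    (isOpen_lt continuous_abs continuous_const).mem_nhds (by simp : |(0 : ℝ)| < 1)] with t ht ht1
  have ht' : |t| * (ρ * ‖y‖) < 1 / 2 := ht
  have ht1' : |t| < 1 := ht1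
  have hk : 2 * ((|t₀| + |t|) * (ρ * ‖y‖)) < K := by
    refine lt_of_le_of_lt ?_ hK
    gcongr
  have hk' : 2 * (ρ * ‖(t₀ + t) • y‖) < K := by
    refine lt_of_le_of_lt ?_ hk
    rw [norm_smul, Real.norm_eq_abs, mul_left_comm ρ]
    have := abs_add_le t₀ t
    gcongr
  have hs : ρ * ‖t • y‖ < 1 / 2 := by rw [norm_smul, Real.norm_eq_abs]; linarith
  rw [hA.matrixCoeff_eq e hk', hA.powExp_add_smul hk ht', mul_apply_eq_comp,
    hA.smallExp_coe hs]
  have := B.hasSum (hA.hasSum_expVec_smul (y := y) (s := t) (by linarith) e)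
  change HasSum _ (B (expVec A (t • y) e))
  convert! this using 2 with n
  rw [FormalMultilinearSeries.coeff, ContinuousMultilinearMap.mkPiRing_apply, map_smul]
  simp only [Finset.prod_const_one, one_smul, Pi.one_apply, smul_eq_mul, Complex.real_smul]
  push_cast
  ring

end IsAnalyticSkew

end AbelianCoulomb

end

/-! ### Convergence of power series and of the generating function near the origin -/

noncomputable section

namespace AbelianCoulomb

open MvPolynomial

variable {d n : ℕ} {ξ : Fin n → Fin d → ℤ}

/-- The term of degree `k` of a power series evaluated at a point. -/
def term (f : MvPowerSeries (Fin d) ℂ) (y : Fin d → ℂ) (k : Fin d →₀ ℕ) : ℂ :=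
  MvPowerSeries.coeff k f * ∏ i, y i ^ k i

/-- Absolute convergence of a power series at a point. -/
def AbsConv (f : MvPowerSeries (Fin d) ℂ) (y : Fin d → ℂ) : Prop :=
  Summable fun k => ‖term f y k‖

/-- The value of a power series at a point. -/
def evalSeries (f : MvPowerSeries (Fin d) ℂ) (y : Fin d → ℂ) : ℂ := ∑' k, term f y k

theorem AbsConv.hasSum {f : MvPowerSeries (Fin d) ℂ} {y : Fin d → ℂ} (h : AbsConv f y) :
    HasSum (term f y) (evalSeries f y) := (Summable.of_norm h).hasSum

theorem term_add (f g : MvPowerSeries (Fin d) ℂ) (y : Fin d → ℂ) (k : Fin d →₀ ℕ) :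
    term (f + g) y k = term f y k + term g y k := by simp [term, add_mul]

theorem term_sub (f g : MvPowerSeries (Fin d) ℂ) (y : Fin d → ℂ) (k : Fin d →₀ ℕ) :
    term (f - g) y k = term f y k - term g y k := by simp [term, sub_mul]

theorem term_mul (f g : MvPowerSeries (Fin d) ℂ) (y : Fin d → ℂ) (k : Fin d →₀ ℕ) :
    term (f * g) y k =
      ∑ p ∈ Finset.HasAntidiagonal.antidiagonal k, term f y p.1 * term g y p.2 := by
  classical
  rw [term, MvPowerSeries.coeff_mul, Finset.sum_mul]
  refine Finset.sum_congr rfl fun p hp => ?_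
  rw [Finset.HasAntidiagonal.mem_antidiagonal] at hp
  rw [term, term, ← hp]
  simp only [Finsupp.add_apply, pow_add, Finset.prod_mul_distrib]
  ring

theorem AbsConv.add {f g : MvPowerSeries (Fin d) ℂ} {y : Fin d → ℂ} (hf : AbsConv f y)
    (hg : AbsConv g y) : AbsConv (f + g) y := by
  refine Summable.of_nonneg_of_le (fun _ => norm_nonneg _) (fun k => ?_) (Summable.add hf hg)
  rw [term_add]; exact norm_add_le _ _

theorem AbsConv.sub {f g : MvPowerSeries (Fin d) ℂ} {y : Fin d → ℂ} (hf : AbsConv f y)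
    (hg : AbsConv g y) : AbsConv (f - g) y := by
  refine Summable.of_nonneg_of_le (fun _ => norm_nonneg _) (fun k => ?_) (Summable.add hf hg)
  rw [term_sub]; exact norm_sub_le _ _

theorem AbsConv.mul {f g : MvPowerSeries (Fin d) ℂ} {y : Fin d → ℂ} (hf : AbsConv f y)
    (hg : AbsConv g y) : AbsConv (f * g) y := by
  have hf' : Summable fun k => ‖term f y k‖ := hf
  have hg' : Summable fun k => ‖term g y k‖ := hg
  have hfg : Summable fun p : (Fin d →₀ ℕ) × (Fin d →₀ ℕ) => ‖term f y p.1‖ * ‖term g y p.2‖ :=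
    hf'.mul_of_nonneg hg' (fun _ => norm_nonneg _) (fun _ => norm_nonneg _)
  have h := summable_sum_mul_antidiagonal_of_summable_mul (f := fun k => ‖term f y k‖)
    (g := fun k => ‖term g y k‖) hfg
  refine Summable.of_nonneg_of_le (fun _ => norm_nonneg _) (fun k => ?_) h
  rw [term_mul]
  refine (norm_sum_le _ _).trans (le_of_eq ?_)
  simp only [norm_mul]

theorem evalSeries_add {f g : MvPowerSeries (Fin d) ℂ} {y : Fin d → ℂ} (hf : AbsConv f y)
    (hg : AbsConv g y) : evalSeries (f + g) y = evalSeries f y + evalSeries g y := by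
  refine (hf.add hg).hasSum.unique ?_
  rw [funext (term_add f g y)]
  exact hf.hasSum.add hg.hasSum

theorem evalSeries_sub {f g : MvPowerSeries (Fin d) ℂ} {y : Fin d → ℂ} (hf : AbsConv f y)
    (hg : AbsConv g y) : evalSeries (f - g) y = evalSeries f y - evalSeries g y := by
  refine (hf.sub hg).hasSum.unique ?_
  rw [funext (term_sub f g y)]
  exact hf.hasSum.sub hg.hasSum

theorem evalSeries_mul {f g : MvPowerSeries (Fin d) ℂ} {y : Fin d → ℂ} (hf : AbsConv f y)
    (hg : AbsConv g y) : evalSeries (f * g) y = evalSeries f y * evalSeries g y := by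
  rw [evalSeries, evalSeries, evalSeries,
    (Summable.of_norm hf).tsum_mul_tsum_eq_tsum_sum_antidiagonal (Summable.of_norm hg)
      (summable_mul_of_summable_norm hf hg)]
  simp only [term_mul]

theorem absConv_coe (p : MvPolynomial (Fin d) ℂ) (y : Fin d → ℂ) :
    AbsConv (p : MvPowerSeries (Fin d) ℂ) y := by
  refine summable_of_ne_finset_zero (s := p.support) fun k hk => ?_
  rw [term, coeff_coe, notMem_support_iff.1 hk, zero_mul, norm_zero]

theorem evalSeries_coe (p : MvPolynomial (Fin d) ℂ) (y : Fin d → ℂ) :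
    evalSeries (p : MvPowerSeries (Fin d) ℂ) y = eval y p := by
  rw [evalSeries, tsum_eq_sum (s := p.support), eval_eq']
  · rfl
  · intro k hk
    rw [term, coeff_coe, notMem_support_iff.1 hk, zero_mul]

theorem absConv_C (c : ℂ) (y : Fin d → ℂ) : AbsConv (MvPowerSeries.C c) y := by
  rw [← coe_C]; exact absConv_coe _ _

theorem evalSeries_C (c : ℂ) (y : Fin d → ℂ) : evalSeries (MvPowerSeries.C c) y = c := by
  rw [← coe_C, evalSeries_coe, eval_C]

theorem absConv_sum {ι : Type*} (s : Finset ι) (f : ι → MvPowerSeries (Fin d) ℂ) {y : Fin d → ℂ}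
    (h : ∀ i ∈ s, AbsConv (f i) y) : AbsConv (∑ i ∈ s, f i) y ∧
      evalSeries (∑ i ∈ s, f i) y = ∑ i ∈ s, evalSeries (f i) y := by
  classical
  induction s using Finset.induction_on with
  | empty =>
    simp only [Finset.sum_empty]
    rw [← map_zero (MvPowerSeries.C (σ := Fin d) (R := ℂ))]
    exact ⟨absConv_C _ _, evalSeries_C _ _⟩
  | insert a s ha ih =>
    obtain ⟨h1, h2⟩ := ih fun i hi => h i (Finset.mem_insert_of_mem hi)
    have h3 := h a (Finset.mem_insert_self a s)
    rw [Finset.sum_insert ha, Finset.sum_insert ha, evalSeries_add h3 h1, h2]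
    exact ⟨h3.add h1, rfl⟩

theorem absConv_prod {ι : Type*} (s : Finset ι) (f : ι → MvPowerSeries (Fin d) ℂ) {y : Fin d → ℂ}
    (h : ∀ i ∈ s, AbsConv (f i) y) : AbsConv (∏ i ∈ s, f i) y ∧
      evalSeries (∏ i ∈ s, f i) y = ∏ i ∈ s, evalSeries (f i) y := by
  classical
  induction s using Finset.induction_on with
  | empty =>
    simp only [Finset.prod_empty]
    rw [← map_one (MvPowerSeries.C (σ := Fin d) (R := ℂ))]
    exact ⟨absConv_C _ _, evalSeries_C _ _⟩
  | insert a s ha ih =>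
    obtain ⟨h1, h2⟩ := ih fun i hi => h i (Finset.mem_insert_of_mem hi)
    have h3 := h a (Finset.mem_insert_self a s)
    rw [Finset.prod_insert ha, Finset.prod_insert ha, evalSeries_mul h3 h1, h2]
    exact ⟨h3.mul h1, rfl⟩

theorem tsum_degree_fiber {H : Type*} [AddCommMonoid H] [TopologicalSpace H]
    (F : (Fin d →₀ ℕ) → H) (n : ℕ) :
    ∑' k : (Finsupp.degree ⁻¹' {n} : Set (Fin d →₀ ℕ)), F k =
      ∑ k ∈ Finset.finsuppAntidiag Finset.univ n, F k := by
  rw [← Finset.tsum_subtype']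
  have : (Finsupp.degree ⁻¹' {n} : Set (Fin d →₀ ℕ)) =
      ↑(Finset.finsuppAntidiag (Finset.univ : Finset (Fin d)) n) := by
    ext k
    simp only [Set.mem_preimage, Set.mem_singleton_iff, Finset.mem_coe, mem_finsuppAntidiag_univ]
  rw [this]

theorem hasSum_degree {F : (Fin d →₀ ℕ) → ℂ} {a : ℂ} (h : HasSum F a) :
    HasSum (fun n => ∑ k ∈ Finset.finsuppAntidiag Finset.univ n, F k) a := by
  simpa only [tsum_degree_fiber] using h.tsum_fiberwise Finsupp.degree

theorem summable_of_degree {F : (Fin d →₀ ℕ) → ℝ} (h0 : ∀ k, 0 ≤ F k)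
    (h : Summable fun n => ∑ k ∈ Finset.finsuppAntidiag Finset.univ n, F k) : Summable F := by
  rw [← (Equiv.sigmaFiberEquiv (Finsupp.degree : (Fin d →₀ ℕ) → ℕ)).summable_iff]
  refine (summable_sigma_of_nonneg fun _ => h0 _).2 ⟨fun n => ?_, ?_⟩
  · have : Finite {k : Fin d →₀ ℕ // k.degree = n} := by
      refine Set.finite_coe_iff.2 ((Finset.finite_toSet
        (Finset.finsuppAntidiag (Finset.univ : Finset (Fin d)) n)).subset fun k hk => ?_)
      exact mem_finsuppAntidiag_univ.2 hk
    have := Fintype.ofFinite {k : Fin d →₀ ℕ // k.degree = n}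
    exact (hasSum_fintype _).summable
  · refine h.congr fun n => ?_
    rw [← tsum_degree_fiber]
    rfl

theorem sum_prod_pow_div_factorial (a : Fin d → ℝ) (n : ℕ) :
    ∑ k ∈ Finset.finsuppAntidiag Finset.univ n, ∏ i, (a i ^ k i / ((k i).factorial : ℝ)) =
      (∑ i, a i) ^ n / (n.factorial : ℝ) := by
  have hn : (n.factorial : ℝ) ≠ 0 := by exact_mod_cast n.factorial_ne_zero
  rw [sum_pow_eq_sum_finsuppAntidiag, Finset.sum_div]
  refine Finset.sum_congr rfl fun k hk => ?_
  have h' : (∏ i, ((k i).factorial : ℝ)) * (Nat.multinomial Finset.univ k : ℝ) = n.factorial := by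
    exact_mod_cast multinomial_mul_prod_factorial hk
  have h2 : ∏ i, ((k i).factorial : ℝ) ≠ 0 :=
    Finset.prod_ne_zero_iff.2 fun i _ => by exact_mod_cast (k i).factorial_ne_zero
  rw [Finset.prod_div_distrib, div_eq_div_iff h2 hn, ← h']
  ring

theorem absConv_expSeries (m y : Fin d → ℂ) : AbsConv (expSeries m) y := by
  have e : ∀ k, ‖term (expSeries m) y k‖ =
      ∏ i, ((‖m i‖ * ‖y i‖) ^ k i / ((k i).factorial : ℝ)) := by
    intro k
    rw [term, coeff_expSeries, ← Finset.prod_mul_distrib, norm_prod]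
    refine Finset.prod_congr rfl fun i _ => ?_
    rw [norm_mul, norm_div, norm_pow, norm_pow, Complex.norm_natCast, mul_pow]
    ring
  rw [AbsConv]
  simp only [e]
  refine summable_of_degree (fun k => Finset.prod_nonneg fun i _ => by positivity) ?_
  simp only [sum_prod_pow_div_factorial]
  exact Real.summable_pow_div_factorial _

theorem hasSum_evalSeries_coeffSeries {φ : MvPolynomial (Fin d) ℂ →ₗ[ℂ] ℂ} {y : Fin d → ℂ}
    (h : AbsConv (coeffSeries φ) y) :
    HasSum (fun n : ℕ => φ (linForm y ^ n) / (n.factorial : ℂ)) (evalSeries (coeffSeries φ) y) := by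
  have := hasSum_degree h.hasSum
  simpa only [term, sum_coeffSeries_eq] using this

theorem evalSeries_expSeries (m y : Fin d → ℂ) :
    evalSeries (expSeries m) y = Complex.exp (∑ k, m k * y k) := by
  have h := absConv_expSeries m y
  rw [expSeries_eq_coeffSeries] at h ⊢
  refine (hasSum_evalSeries_coeffSeries h).unique ?_
  rw [Complex.exp_eq_exp_ℂ]
  convert! NormedSpace.expSeries_div_hasSum_exp (∑ k, m k * y k) using 3 with n
  simp [linForm, mul_comm]

theorem absConv_expDiff (v : Fin d → ℤ) (c : ℂ) (y : Fin d → ℂ) : AbsConv (expDiff v c) y :=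
  (absConv_expSeries _ _).sub ((absConv_C _ _).mul (absConv_expSeries _ _))

theorem evalSeries_expDiff (v : Fin d → ℤ) (c : ℂ) (y : Fin d → ℝ) :
    evalSeries (expDiff v c) (fun k => (y k : ℂ)) =
      expFun (scaled (1 / 2) v) y - c * expFun (scaled (-(1 / 2)) v) y := by
  rw [expDiff, evalSeries_sub (absConv_expSeries _ _) ((absConv_C _ _).mul (absConv_expSeries _ _)),
    evalSeries_mul (absConv_C _ _) (absConv_expSeries _ _), evalSeries_C, evalSeries_expSeries,
    evalSeries_expSeries]
  rfl

theorem absConv_denSeries (lam : Submodule ℝ (Fin d → ℝ) → Fin d → ℤ) (ζ : Fin d → ℂ)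
    (y : Fin d → ℂ) : AbsConv (denSeries ξ lam ζ) y :=
  (absConv_prod _ _ fun _ _ => absConv_expDiff _ _ _).1

theorem evalSeries_denSeries (lam : Submodule ℝ (Fin d → ℝ) → Fin d → ℤ) (ζ : Fin d → ℂ)
    (y : Fin d → ℝ) : evalSeries (denSeries ξ lam ζ) (fun k => (y k : ℂ)) = denFun ξ lam ζ y := by
  rw [denSeries_eq, (absConv_prod _ _ fun _ _ => absConv_expDiff _ _ _).2]
  simp only [evalSeries_expDiff]
  rfl

theorem absConv_numSeries (S : (Fin d → ℂ) →₀ MvPolynomial (Fin d) ℂ) (y : Fin d → ℂ) :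
    AbsConv (numSeries S) y :=
  (absConv_sum _ _ fun _ _ => (absConv_coe _ _).mul (absConv_expSeries _ _)).1

theorem evalSeries_numSeries (S : (Fin d → ℂ) →₀ MvPolynomial (Fin d) ℂ) (y : Fin d → ℝ) :
    evalSeries (numSeries S) (fun k => (y k : ℂ)) = numFun S y := by
  rw [numSeries, Finsupp.sum,
    (absConv_sum _ _ fun _ _ => (absConv_coe _ _).mul (absConv_expSeries _ _)).2, numFun,
    Finsupp.sum]
  refine Finset.sum_congr rfl fun m _ => ?_
  rw [evalSeries_mul (absConv_coe _ _) (absConv_expSeries _ _), evalSeries_coe,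
    evalSeries_expSeries]
  rfl

/-- The value of the weight function `k ↦ ∑ w_i k_i`. -/
def wt (w : Fin d → ℕ) (k : Fin d →₀ ℕ) : ℕ := ∑ i, w i * k i

theorem wt_add (w : Fin d → ℕ) (k l : Fin d →₀ ℕ) : wt w (k + l) = wt w k + wt w l := by
  simp [wt, mul_add, Finset.sum_add_distrib]

/-- The coefficients of a power series are bounded by those of a geometric series. -/
def IsGeomBounded (f : MvPowerSeries (Fin d) ℂ) : Prop :=
  ∃ r : Fin d → ℝ, (∀ i, 0 < r i) ∧ ∃ G, ∀ k, ‖MvPowerSeries.coeff k f‖ * ∏ i, r i ^ k i ≤ G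

/-- Induction on the weight: the coefficient of E f at a + k is solved for E_a f_k. The other terms
involve coefficients of f of smaller weight, and together they cost at most half of the leading
coefficient of E. -/
theorem coeff_bound_of_mul {E f : MvPowerSeries (Fin d) ℂ} {w : Fin d → ℕ} {a : Fin d →₀ ℕ}
    {r : Fin d → ℝ} (hr : ∀ i, 0 < r i) {G : ℝ}
    (hw : ∀ k, MvPowerSeries.coeff k E ≠ 0 → k ≠ a → wt w a < wt w k)
    (ha : MvPowerSeries.coeff a E ≠ 0)
    (hs : Summable fun k => if k = a then 0 else ‖MvPowerSeries.coeff k E‖ * ∏ i, r i ^ k i)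
    (hE : ∑' k, (if k = a then 0 else ‖MvPowerSeries.coeff k E‖ * ∏ i, r i ^ k i) ≤
      1 / 2 * (‖MvPowerSeries.coeff a E‖ * ∏ i, r i ^ a i))
    (hg : ∀ k, ‖MvPowerSeries.coeff k (E * f)‖ * ∏ i, r i ^ k i ≤ G) (k : Fin d →₀ ℕ) :
    ‖MvPowerSeries.coeff k f‖ * ∏ i, r i ^ k i ≤
      2 * G / (‖MvPowerSeries.coeff a E‖ * ∏ i, r i ^ a i) := by
  classical
  set c := ‖MvPowerSeries.coeff a E‖ * ∏ i, r i ^ a i with hc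
  have hR : ∀ k : Fin d →₀ ℕ, 0 < ∏ i, r i ^ k i := fun k =>
    Finset.prod_pos fun i _ => pow_pos (hr i) _
  have hRadd : ∀ k l : Fin d →₀ ℕ, ∏ i, r i ^ (k + l) i = (∏ i, r i ^ k i) * ∏ i, r i ^ l i := by
    intro k l
    simp [pow_add, Finset.prod_mul_distrib]
  have hc0 : 0 < c := mul_pos (norm_pos_iff.2 ha) (hR a)
  have hG : 0 ≤ G := (mul_nonneg (norm_nonneg _) (hR 0).le).trans (hg 0)
  set B := 2 * G / c with hB
  have hB0 : 0 ≤ B := by positivity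
  -- B solves this fixed-point equation, so the bound reproduces itself in the induction.
  have hBc : G + 1 / 2 * c * B = c * B := by
    rw [hB]; field_simp; ring
  induction hN : wt w k using Nat.strong_induction_on generalizing k with
  | _ N ih =>
    have hmem : (a, k) ∈ Finset.HasAntidiagonal.antidiagonal (a + k) := by simp
    have h1 : MvPowerSeries.coeff a E * MvPowerSeries.coeff k f =
        MvPowerSeries.coeff (a + k) (E * f) -
        ∑ p ∈ (Finset.HasAntidiagonal.antidiagonal (a + k)).erase (a, k),
          MvPowerSeries.coeff p.1 E * MvPowerSeries.coeff p.2 f := by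
      rw [MvPowerSeries.coeff_mul, ← Finset.add_sum_erase _ _ hmem]
      ring
    have h2 : ∑ p ∈ (Finset.HasAntidiagonal.antidiagonal (a + k)).erase (a, k),
          ‖MvPowerSeries.coeff p.1 E * MvPowerSeries.coeff p.2 f‖ * ∏ i, r i ^ (a + k) i ≤
        1 / 2 * c * B := by
      calc _ ≤ ∑ p ∈ (Finset.HasAntidiagonal.antidiagonal (a + k)).erase (a, k),
          (if p.1 = a then 0 else ‖MvPowerSeries.coeff p.1 E‖ * ∏ i, r i ^ p.1 i) * B := by
            refine Finset.sum_le_sum fun p hp => ?_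
            rw [Finset.mem_erase, Finset.HasAntidiagonal.mem_antidiagonal] at hp
            have hpa : p.1 ≠ a := by
              intro h
              apply hp.1
              have := hp.2
              rw [h, add_right_inj] at this
              exact Prod.ext h this
            rw [if_neg hpa, ← hp.2, hRadd, norm_mul]
            by_cases hE0 : MvPowerSeries.coeff p.1 E = 0
            · simp [hE0]
            · have hlt := hw _ hE0 hpa
              have hsum := congrArg (wt w) hp.2
              rw [wt_add, wt_add] at hsum
              have := ih (wt w p.2) (by omega) p.2 rfl
              calc _ = (‖MvPowerSeries.coeff p.1 E‖ * ∏ i, r i ^ p.1 i) *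
                    (‖MvPowerSeries.coeff p.2 f‖ * ∏ i, r i ^ p.2 i) := by ring
                _ ≤ _ := mul_le_mul_of_nonneg_left this
                    (mul_nonneg (norm_nonneg _) (hR _).le)
        _ = (∑ i ∈ ((Finset.HasAntidiagonal.antidiagonal (a + k)).erase (a, k)).image Prod.fst,
              (if i = a then 0 else ‖MvPowerSeries.coeff i E‖ * ∏ j, r j ^ i j)) * B := by
            rw [← Finset.sum_mul, Finset.sum_image]
            intro p hp q hq hpq
            simp only [Finset.coe_erase, Set.mem_sdiff, Finset.mem_coe,
              Finset.HasAntidiagonal.mem_antidiagonal] at hp hq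
            refine Prod.ext hpq ?_
            have := hp.1.trans hq.1.symm
            rwa [hpq, add_right_inj] at this
        _ ≤ _ := by
            refine mul_le_mul_of_nonneg_right (le_trans ?_ hE) hB0
            refine hs.sum_le_tsum _ fun i _ => ?_
            split_ifs
            · exact le_rfl
            · exact mul_nonneg (norm_nonneg _) (hR _).le
    have h3 : c * (‖MvPowerSeries.coeff k f‖ * ∏ i, r i ^ k i) ≤ c * B := by
      calc _ = ‖MvPowerSeries.coeff a E * MvPowerSeries.coeff k f‖ * ∏ i, r i ^ (a + k) i := by
            rw [hRadd, norm_mul, hc]; ring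
        _ ≤ (‖MvPowerSeries.coeff (a + k) (E * f)‖ +
            ∑ p ∈ (Finset.HasAntidiagonal.antidiagonal (a + k)).erase (a, k),
            ‖MvPowerSeries.coeff p.1 E * MvPowerSeries.coeff p.2 f‖) * ∏ i, r i ^ (a + k) i := by
            rw [h1]
            refine mul_le_mul_of_nonneg_right ?_ (hR _).le
            exact (norm_sub_le _ _).trans (add_le_add_right (norm_sum_le _ _) _)
        _ ≤ c * B := by
            rw [add_mul, Finset.sum_mul, ← hBc]
            exact add_le_add (hg _) h2
    exact le_of_mul_le_mul_left h3 hc0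

/-- Shrinking the radii to r_i ε^{w_i} multiplies the k-th term of E by ε^{wt k}. Every other
nonzero term gains at least one more factor ε than the leading one, which therefore dominates for
small ε. -/
theorem IsGeomBounded.of_mul {E f : MvPowerSeries (Fin d) ℂ} {w : Fin d → ℕ} {a : Fin d →₀ ℕ}
    (hw : ∀ k, MvPowerSeries.coeff k E ≠ 0 → k ≠ a → wt w a < wt w k)
    (ha : MvPowerSeries.coeff a E ≠ 0) (hE : ∀ y, AbsConv E y) (hg : IsGeomBounded (E * f)) :
    IsGeomBounded f := by
  classical
  obtain ⟨r, hr, G, hG⟩ := hg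
  have hR : ∀ k : Fin d →₀ ℕ, 0 < ∏ i, r i ^ k i := fun k =>
    Finset.prod_pos fun i _ => pow_pos (hr i) _
  have hsum : Summable fun k => ‖MvPowerSeries.coeff k E‖ * ∏ i, r i ^ k i := by
    refine (hE fun i => (r i : ℂ)).congr fun k => ?_
    rw [term, norm_mul, norm_prod]
    congr 1
    refine Finset.prod_congr rfl fun i _ => ?_
    rw [norm_pow, Complex.norm_real, Real.norm_of_nonneg (hr i).le]
  set M := ∑' k, ‖MvPowerSeries.coeff k E‖ * ∏ i, r i ^ k i with hM
  have hM0 : 0 ≤ M := tsum_nonneg fun k => mul_nonneg (norm_nonneg _) (hR k).le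
  set c := ‖MvPowerSeries.coeff a E‖ * ∏ i, r i ^ a i with hc
  have hc0 : 0 < c := mul_pos (norm_pos_iff.2 ha) (hR a)
  -- Chosen so that ε M ≤ c / 2.
  set ε := min 1 (c / (2 * (M + 1))) with hε
  have hε0 : 0 < ε := lt_min one_pos (by positivity)
  have hε1 : ε ≤ 1 := min_le_left _ _
  have hεM : ε * M ≤ 1 / 2 * c := by
    have h1 : ε ≤ c / (2 * (M + 1)) := min_le_right _ _
    rw [le_div_iff₀ (by positivity)] at h1
    nlinarith
  have hRε : ∀ k : Fin d →₀ ℕ, ∏ i, (r i * ε ^ w i) ^ k i = (∏ i, r i ^ k i) * ε ^ wt w k := by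
    intro k
    simp only [mul_pow, Finset.prod_mul_distrib, wt, ← pow_mul, Finset.prod_pow_eq_pow_sum]
  have hle : ∀ k, (if k = a then 0 else
      ‖MvPowerSeries.coeff k E‖ * ∏ i, (r i * ε ^ w i) ^ k i) ≤
      (‖MvPowerSeries.coeff k E‖ * ∏ i, r i ^ k i) * ε ^ (wt w a + 1) := by
    intro k
    have h0 := (hR k).le
    split_ifs with hk
    · positivity
    · by_cases hk0 : MvPowerSeries.coeff k E = 0
      · simp [hk0]
      · rw [hRε, ← mul_assoc]
        exact mul_le_mul_of_nonneg_left (pow_le_pow_of_le_one hε0.le hε1 (hw k hk0 hk))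
          (by positivity)
  have hnn : ∀ k, 0 ≤ (if k = a then 0 else
      ‖MvPowerSeries.coeff k E‖ * ∏ i, (r i * ε ^ w i) ^ k i) := by
    intro k
    have h0 := (hR k).le
    split_ifs
    · exact le_rfl
    · rw [hRε]; positivity
  have hs := Summable.of_nonneg_of_le hnn hle (hsum.mul_right _)
  refine ⟨fun i => r i * ε ^ w i, fun i => mul_pos (hr i) (pow_pos hε0 _), _,
    coeff_bound_of_mul (w := w) (G := G) (fun i => mul_pos (hr i) (pow_pos hε0 _)) hw ha hs ?_ ?_⟩
  · refine (hs.tsum_le_tsum hle (hsum.mul_right _)).trans ?_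
    rw [tsum_mul_right, hRε, pow_succ]
    have : 0 ≤ ε ^ wt w a := by positivity
    nlinarith [mul_le_mul_of_nonneg_left hεM this]
  · intro k
    rw [hRε, ← mul_assoc]
    have h0 : 0 ≤ ‖MvPowerSeries.coeff k (E * f)‖ * ∏ i, r i ^ k i :=
      mul_nonneg (norm_nonneg _) (hR k).le
    exact (mul_le_of_le_one_right h0 (pow_le_one₀ hε0.le hε1)).trans (hG k)

theorem coeff_expDiff (v : Fin d → ℤ) (c : ℂ) (k : Fin d →₀ ℕ) :
    MvPowerSeries.coeff k (expDiff v c) =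
      ∏ i, (1 / 2 * (v i : ℂ)) ^ k i / ((k i).factorial : ℂ) -
      c * ∏ i, (-(1 / 2) * (v i : ℂ)) ^ k i / ((k i).factorial : ℂ) := by
  rw [expDiff, map_sub, MvPowerSeries.coeff_C_mul, coeff_expSeries, coeff_expSeries]
  rfl

/-- If c ≠ 1, the constant term 1 - c is the leading one. If c = 1, it vanishes and a linear
monomial y_{i₀} with v_{i₀} ≠ 0 takes its place; weight 1 for i₀ and 2 for the other variables makes
it the unique nonzero term of least weight. -/
theorem IsGeomBounded.of_expDiff_mul {v : Fin d → ℤ} (hv : v ≠ 0) {c : ℂ}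
    {f : MvPowerSeries (Fin d) ℂ} (h : IsGeomBounded (expDiff v c * f)) : IsGeomBounded f := by
  classical
  by_cases hc : c = 1
  · subst hc
    obtain ⟨i₀, hi₀⟩ := Function.ne_iff.1 hv
    have hi₀' : v i₀ ≠ 0 := hi₀
    have hwa : wt (fun i => if i = i₀ then 1 else 2) (Finsupp.single i₀ 1) = 1 := by
      rw [wt, Finset.sum_eq_single i₀]
      · simp
      · intro i _ hi; simp [hi.symm]
      · simp
    refine IsGeomBounded.of_mul (w := fun i => if i = i₀ then 1 else 2)
      (a := Finsupp.single i₀ 1) (fun k hk0 hka => ?_) ?_ (absConv_expDiff v 1) h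
    · rw [hwa]
      by_contra! hle
      have hk1 : ∀ i, i ≠ i₀ → k i = 0 := by
        intro i hi
        have := (Finset.single_le_sum (f := fun i => (if i = i₀ then 1 else 2) * k i)
          (fun _ _ => Nat.zero_le _) (Finset.mem_univ i)).trans hle
        simp only [if_neg hi] at this
        omega
      have hk2 : k i₀ ≤ 1 := by
        have := (Finset.single_le_sum (f := fun i => (if i = i₀ then 1 else 2) * k i)
          (fun _ _ => Nat.zero_le _) (Finset.mem_univ i₀)).trans hle
        simpa using this
      have hk3 : k = Finsupp.single i₀ (k i₀) := by
        ext i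
        by_cases hi : i = i₀
        · simp [hi]
        · simp [hk1 i hi, Ne.symm hi]
      interval_cases hki : k i₀
      · apply hk0
        rw [hk3, coeff_expDiff]
        simp
      · exact hka hk3
    · rw [coeff_expDiff]
      have e : ∀ t : ℂ, ∏ i, (t * (v i : ℂ)) ^ (Finsupp.single i₀ 1 : Fin d →₀ ℕ) i /
          (((Finsupp.single i₀ 1 : Fin d →₀ ℕ) i).factorial : ℂ) = t * v i₀ := by
        intro t
        rw [Finset.prod_eq_single i₀]
        · simp
        · intro i _ hi; simp [hi.symm]
        · simp
      rw [e, e]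
      have : (v i₀ : ℂ) ≠ 0 := by exact_mod_cast hi₀'
      ring_nf
      exact this
  · refine IsGeomBounded.of_mul (w := fun _ => 1) (a := 0) (fun k _ hk => ?_) ?_
      (absConv_expDiff v c) h
    · obtain ⟨i, hi⟩ := Finsupp.ne_iff.1 hk
      have := Finset.single_le_sum (f := fun i => 1 * k i)
          (fun _ _ => Nat.zero_le _) (Finset.mem_univ i)
      have h0 : wt (fun _ => 1) (0 : Fin d →₀ ℕ) = 0 := by simp [wt]
      rw [h0]
      refine lt_of_lt_of_le ?_ this
      simpa [Nat.pos_iff_ne_zero] using hi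
    · rw [coeff_expDiff]
      simpa [sub_eq_zero] using Ne.symm hc

theorem AbsConv.isGeomBounded {f : MvPowerSeries (Fin d) ℂ} (h : AbsConv f 1) :
    IsGeomBounded f := by
  refine ⟨1, fun _ => one_pos, ∑' k, ‖term f 1 k‖, fun k => ?_⟩
  have := Summable.le_tsum h k fun _ _ => norm_nonneg _
  simpa [term] using this

/-- The numerator converges everywhere, and the factors of the denominator are divided out one at a
time. -/
theorem isGeomBounded_genFun {b : Fin n → ℂ} {T : CoulombBranch ξ b →ₗ[ℂ] ℂ}
    {lam : Submodule ℝ (Fin d → ℝ) → Fin d → ℤ} {ζ : Fin d → ℂ}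
    {S : (Fin d → ℂ) →₀ MvPolynomial (Fin d) ℂ} (hlam : ∀ l ∈ lines ξ, lam l ≠ 0)
    (h : IsNumerator T lam ζ S) : IsGeomBounded (genFun T) := by
  classical
  have key : ∀ s ⊆ lines ξ, IsGeomBounded ((∏ l ∈ s, expDiff (lam l) (twist ζ (lam l))) * genFun T) →
      IsGeomBounded (genFun T) := by
    intro s
    induction s using Finset.induction_on with
    | empty => intro _ h; simpa using h
    | insert a s ha ih =>
      intro hs h
      rw [Finset.prod_insert ha, mul_assoc] at h
      exact ih ((Finset.subset_insert a s).trans hs)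
        (h.of_expDiff_mul (hlam a (hs (Finset.mem_insert_self a s))))
  refine key (lines ξ) subset_rfl ?_
  rw [← denSeries_eq, show denSeries ξ lam ζ * genFun T = numSeries S from h]
  exact (absConv_numSeries S 1).isGeomBounded

theorem norm_linForm_pow_le {φ : MvPolynomial (Fin d) ℂ →ₗ[ℂ] ℂ} {r : Fin d → ℝ}
    (hr : ∀ i, 0 < r i) {G : ℝ}
    (hG : ∀ k, ‖MvPowerSeries.coeff k (coeffSeries φ)‖ * ∏ i, r i ^ k i ≤ G) (y : Fin d → ℂ)
    (n : ℕ) :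
    ∑ k ∈ Finset.finsuppAntidiag Finset.univ n, ‖term (coeffSeries φ) y k‖ ≤
      G * (∑ i, ‖y i‖ / r i) ^ n := by
  have hR : ∀ k : Fin d →₀ ℕ, 0 < ∏ i, r i ^ k i := fun k =>
    Finset.prod_pos fun i _ => pow_pos (hr i) _
  have hG0 : 0 ≤ G := (mul_nonneg (norm_nonneg _) (hR 0).le).trans (hG 0)
  rw [sum_pow_eq_sum_finsuppAntidiag, Finset.mul_sum]
  refine Finset.sum_le_sum fun k _ => ?_
  have h1 : (1 : ℝ) ≤ Nat.multinomial Finset.univ k := by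
    exact_mod_cast Nat.multinomial_pos Finset.univ k
  have h2 : 0 ≤ ∏ i, (‖y i‖ / r i) ^ k i :=
    Finset.prod_nonneg fun i _ => pow_nonneg (div_nonneg (norm_nonneg _) (hr i).le) _
  calc ‖term (coeffSeries φ) y k‖
      = (‖MvPowerSeries.coeff k (coeffSeries φ)‖ * ∏ i, r i ^ k i) *
          ∏ i, (‖y i‖ / r i) ^ k i := by
        have h3 := (hR k).ne'
        rw [term, norm_mul, norm_prod]
        simp only [div_pow, Finset.prod_div_distrib, norm_pow]
        field_simp
    _ ≤ G * ∏ i, (‖y i‖ / r i) ^ k i := mul_le_mul_of_nonneg_right (hG k) h2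
    _ ≤ _ := by
        refine mul_le_mul_of_nonneg_left ?_ hG0
        exact le_mul_of_one_le_left h2 h1

theorem IsGeomBounded.exists_bound {φ : MvPolynomial (Fin d) ℂ →ₗ[ℂ] ℂ}
    (h : IsGeomBounded (coeffSeries φ)) : ∃ ρ > 0, ∃ G, ∀ (y : Fin d → ℝ) (n : ℕ),
      ∑ k ∈ Finset.finsuppAntidiag Finset.univ n,
        ‖term (coeffSeries φ) (fun i => (y i : ℂ)) k‖ ≤ G * (ρ * ‖y‖) ^ n := by
  obtain ⟨r, hr, G, hG⟩ := h
  have hG0 : 0 ≤ G := (mul_nonneg (norm_nonneg _) (Finset.prod_nonneg fun i _ =>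
    pow_nonneg (hr i).le _)).trans (hG 0)
  have h0 : 0 ≤ ∑ i, (r i)⁻¹ := Finset.sum_nonneg fun i _ => (inv_pos.2 (hr i)).le
  refine ⟨∑ i, (r i)⁻¹ + 1, by positivity, G, fun y n =>
    (norm_linForm_pow_le hr hG _ n).trans ?_⟩
  refine mul_le_mul_of_nonneg_left (pow_le_pow_left₀ (Finset.sum_nonneg fun i _ =>
    div_nonneg (norm_nonneg _) (hr i).le) ?_ n) hG0
  calc ∑ i, ‖(y i : ℂ)‖ / r i ≤ ∑ i, (r i)⁻¹ * ‖y‖ := by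
        refine Finset.sum_le_sum fun i _ => ?_
        rw [div_eq_inv_mul, Complex.norm_real]
        exact mul_le_mul_of_nonneg_left (norm_le_pi_norm y i) (inv_pos.2 (hr i)).le
    _ ≤ _ := by
        rw [← Finset.sum_mul]
        exact mul_le_mul_of_nonneg_right (by linarith) (norm_nonneg _)

end AbelianCoulomb

end

/-! ### Growth of exponential polynomials along rays -/

noncomputable section

namespace AbelianCoulomb

open MvPolynomial Filter Topology

variable {d n : ℕ}

theorem polynomial_of_bounded {c : ℂ} {p : Polynomial ℂ} {M : ℝ}
    (h : ∀ t : ℝ, 0 ≤ t → ‖p.eval (t : ℂ) * Complex.exp (c * t)‖ ≤ M) :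
    (0 < c.re → p = 0) ∧ (c.re = 0 → p.natDegree = 0) := by
  have hre : ∀ t : ℝ, (c * t).re = c.re * t := fun t => by simp
  have h' : ∀ t : ℝ, 0 ≤ t → ‖p.eval (t : ℂ)‖ * Real.exp (c.re * t) ≤ M := by
    intro t ht
    have := h t ht
    rwa [norm_mul, Complex.norm_exp, hre] at this
  have hdeg : 0 ≤ c.re → p.natDegree = 0 := by
    intro hc
    by_contra hne
    have htop : Tendsto (fun t : ℝ => ‖p.eval (t : ℂ)‖) atTop atTop := by
      refine Polynomial.tendsto_norm_atTop p
        (Polynomial.natDegree_pos_iff_degree_pos.1 (Nat.pos_of_ne_zero hne)) ?_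
      simpa using tendsto_abs_atTop_atTop (G := ℝ)
    obtain ⟨t, ht, ht0⟩ := ((htop.eventually_gt_atTop M).and (eventually_ge_atTop 0)).exists
    have h1 := h' t ht0
    have h2 : 1 ≤ Real.exp (c.re * t) := Real.one_le_exp (mul_nonneg hc ht0)
    exact absurd (le_mul_of_one_le_right (norm_nonneg _) h2) (not_le.2 (h1.trans_lt ht))
  refine ⟨fun hc => ?_, fun hc => hdeg hc.ge⟩
  obtain ⟨a, rfl⟩ := Polynomial.natDegree_eq_zero.1 (hdeg hc.le)
  by_contra hne
  have ha : 0 < ‖a‖ := norm_pos_iff.2 fun h0 => hne (by rw [h0, Polynomial.C_0])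
  have htop : Tendsto (fun t : ℝ => ‖a‖ * Real.exp (c.re * t)) atTop atTop :=
    (Real.tendsto_exp_atTop.comp (tendsto_id.const_mul_atTop hc)).const_mul_atTop ha
  obtain ⟨t, ht, ht0⟩ := ((htop.eventually_gt_atTop M).and (eventually_ge_atTop 0)).exists
  have := h' t ht0
  rw [Polynomial.eval_C] at this
  linarith

theorem exists_exp_mul_ne {c c' : ℂ} (h : c ≠ c') :
    ∃ τ : ℝ, 0 ≤ τ ∧ Complex.exp (c * τ) ≠ Complex.exp (c' * τ) := by
  have hpos : 0 < ‖c - c'‖ := norm_pos_iff.2 (sub_ne_zero.2 h)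
  -- With this τ the number (c - c')τ has absolute value 1, so it is not an integer multiple of 2πi.
  refine ⟨1 / ‖c - c'‖, by positivity, fun he => ?_⟩
  rw [Complex.exp_eq_exp_iff_exists_int] at he
  obtain ⟨k, hk⟩ := he
  have h1 : (c - c') * ((1 / ‖c - c'‖ : ℝ) : ℂ) = k * (2 * Real.pi * Complex.I) := by
    rw [sub_mul, hk]; ring
  have h2 := congrArg norm h1
  rw [norm_mul, Complex.norm_real, Real.norm_of_nonneg (by positivity),
    mul_one_div_cancel hpos.ne', norm_mul, norm_mul, norm_mul, Complex.norm_I, Complex.norm_real,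
    Real.norm_of_nonneg Real.pi_pos.le, Complex.norm_intCast, Complex.norm_ofNat, mul_one] at h2
  rcases eq_or_ne k 0 with rfl | hk0
  · simp at h2
  · have h3 : (1 : ℝ) ≤ |(k : ℝ)| := by exact_mod_cast Int.one_le_abs hk0
    nlinarith [Real.pi_gt_three]

/-- The coefficient polynomial of `e^{ct}` in `g(t + τ) - e^{c'τ} g(t)`. -/
def diffPoly (τ : ℝ) (c c' : ℂ) (p : Polynomial ℂ) : Polynomial ℂ :=
  Polynomial.C (Complex.exp (c * τ)) * Polynomial.taylor (τ : ℂ) p -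
    Polynomial.C (Complex.exp (c' * τ)) * p

theorem eval_diffPoly_mul_exp (τ : ℝ) (c c' : ℂ) (p : Polynomial ℂ) (t : ℝ) :
    (diffPoly τ c c' p).eval (t : ℂ) * Complex.exp (c * t) =
      p.eval ((t + τ : ℝ) : ℂ) * Complex.exp (c * (t + τ : ℝ)) -
        Complex.exp (c' * τ) * (p.eval (t : ℂ) * Complex.exp (c * t)) := by
  rw [diffPoly]
  simp only [Polynomial.eval_sub, Polynomial.eval_mul, Polynomial.eval_C, Polynomial.taylor_eval]
  push_cast
  rw [mul_add, Complex.exp_add]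
  ring

theorem degree_diffPoly_lt (τ : ℝ) (c : ℂ) {p : Polynomial ℂ} (hp : p ≠ 0) :
    (diffPoly τ c c p).degree < p.degree := by
  rw [diffPoly, ← mul_sub]
  refine (Polynomial.degree_mul_le _ _).trans_lt ?_
  rw [Polynomial.degree_C (Complex.exp_ne_zero _), zero_add]
  have h := Polynomial.degree_sub_lt_left (p := Polynomial.taylor (τ : ℂ) p) (q := p)
    (Polynomial.degree_taylor _ _) (by simpa using hp)
    (by simp)
  rwa [Polynomial.degree_taylor] at h

theorem coeff_diffPoly (τ : ℝ) (c c' : ℂ) (p : Polynomial ℂ) :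
    (diffPoly τ c c' p).coeff p.natDegree =
      (Complex.exp (c * τ) - Complex.exp (c' * τ)) * p.leadingCoeff := by
  have h : (Polynomial.taylor (τ : ℂ) p).coeff p.natDegree = p.leadingCoeff := by
    have := Polynomial.leadingCoeff_taylor (r := (τ : ℂ)) p
    rwa [Polynomial.leadingCoeff, Polynomial.natDegree_taylor] at this
  rw [diffPoly, Polynomial.coeff_sub, Polynomial.coeff_C_mul, Polynomial.coeff_C_mul, h,
    Polynomial.coeff_natDegree]
  ring

/-- The operator g(t + τ) - e^{c'τ} g(t) preserves boundedness on the half-line and lowers the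
degree of the coefficient at c'. For e^{c₀τ} ≠ e^{c'τ} it keeps the coefficient of p₀ at its top
degree nonzero. Induction on the degree removes c', and induction on the set removes the other
frequencies. -/
theorem expPoly_of_bounded (c₀ : ℂ) (s : Finset ℂ) (hs : c₀ ∉ s) : ∀ (p₀ : Polynomial ℂ)
    (p : ℂ → Polynomial ℂ) (M : ℝ), (∀ t : ℝ, 0 ≤ t → ‖p₀.eval (t : ℂ) * Complex.exp (c₀ * t) +
      ∑ c ∈ s, (p c).eval (t : ℂ) * Complex.exp (c * t)‖ ≤ M) →
    (0 < c₀.re → p₀ = 0) ∧ (c₀.re = 0 → p₀.natDegree = 0) := by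
  classical
  induction s using Finset.induction_on with
  | empty =>
    intro p₀ p M h
    exact polynomial_of_bounded fun t ht => by simpa using h t ht
  | insert c' s hc' ih =>
    have hs' : c₀ ∉ s := fun h => hs (Finset.mem_insert_of_mem h)
    have hne : c₀ ≠ c' := fun h => hs (h ▸ Finset.mem_insert_self _ _)
    have key : ∀ (N : ℕ) (p₀ : Polynomial ℂ) (p : ℂ → Polynomial ℂ) (M : ℝ),
        (p c').degree < N → (∀ t : ℝ, 0 ≤ t → ‖p₀.eval (t : ℂ) * Complex.exp (c₀ * t) +
          ∑ c ∈ insert c' s, (p c).eval (t : ℂ) * Complex.exp (c * t)‖ ≤ M) →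
        (0 < c₀.re → p₀ = 0) ∧ (c₀.re = 0 → p₀.natDegree = 0) := by
      intro N
      induction N with
      | zero =>
        intro p₀ p M hN h
        have h0 : p c' = 0 := by
          rw [← Polynomial.degree_eq_bot]
          exact Nat.WithBot.lt_zero_iff.1 (by simpa using hN)
        refine ih hs' p₀ p M fun t ht => ?_
        have := h t ht
        rwa [Finset.sum_insert hc', h0, Polynomial.eval_zero, zero_mul, zero_add] at this
      | succ N ihN =>
        intro p₀ p M hN h
        obtain ⟨τ, hτ, hexp⟩ := exists_exp_mul_ne hne
        have hsub := sub_ne_zero.2 hexp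
        have hconc := ihN (diffPoly τ c₀ c' p₀) (fun c => diffPoly τ c c' (p c))
          (M + ‖Complex.exp (c' * τ)‖ * M) (by
            by_cases hp : p c' = 0
            · simp [hp, diffPoly]
            · have h1 := degree_diffPoly_lt τ c' hp
              have h2 : (p c').degree ≤ N := Polynomial.degree_le_of_natDegree_le
                (Nat.lt_succ_iff.1 ((Polynomial.natDegree_lt_iff_degree_lt hp).2 hN))
              exact h1.trans_le h2) fun t ht => by
            have e : (diffPoly τ c₀ c' p₀).eval (t : ℂ) * Complex.exp (c₀ * t) +
                ∑ c ∈ insert c' s, (diffPoly τ c c' (p c)).eval (t : ℂ) * Complex.exp (c * t) =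
                (p₀.eval ((t + τ : ℝ) : ℂ) * Complex.exp (c₀ * (t + τ : ℝ)) +
                  ∑ c ∈ insert c' s,
                    (p c).eval ((t + τ : ℝ) : ℂ) * Complex.exp (c * (t + τ : ℝ))) -
                Complex.exp (c' * τ) * (p₀.eval (t : ℂ) * Complex.exp (c₀ * t) +
                  ∑ c ∈ insert c' s, (p c).eval (t : ℂ) * Complex.exp (c * t)) := by
              simp only [eval_diffPoly_mul_exp, Finset.sum_sub_distrib, ← Finset.mul_sum]
              ring
            rw [e]
            refine (norm_sub_le _ _).trans (add_le_add (h _ (add_nonneg ht hτ)) ?_)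
            rw [norm_mul]
            exact mul_le_mul_of_nonneg_left (h t ht) (norm_nonneg _)
        have hcoeff := coeff_diffPoly τ c₀ c' p₀
        by_cases hp₀ : p₀ = 0
        · simp [hp₀]
        · have hlc : (diffPoly τ c₀ c' p₀).coeff p₀.natDegree ≠ 0 := by
            rw [hcoeff]
            exact mul_ne_zero hsub (Polynomial.leadingCoeff_ne_zero.2 hp₀)
          refine ⟨fun hc => ?_, fun hc => ?_⟩
          · rw [hconc.1 hc] at hlc
            exact absurd (Polynomial.coeff_zero _) hlc
          · have := Polynomial.le_natDegree_of_ne_zero hlc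
            rw [hconc.2 hc] at this
            exact Nat.le_zero.1 this
    intro p₀ p M h
    refine key ((p c').natDegree + 1) p₀ p M ?_ h
    exact Polynomial.degree_le_natDegree.trans_lt (by exact_mod_cast Nat.lt_succ_self _)

/-- The pairing of a complex coweight with a real vector of `𝔱_ℝ^*`. -/
def cdot (m : Fin d → ℂ) (v : Fin d → ℝ) : ℂ := ∑ k, m k * (v k : ℂ)

theorem expFun_eq (m : Fin d → ℂ) (y : Fin d → ℝ) : expFun m y = Complex.exp (cdot m y) := rfl

theorem cdot_add_smul (m : Fin d → ℂ) (y v : Fin d → ℝ) (t : ℝ) :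
    cdot m (y + t • v) = cdot m y + cdot m v * t := by
  simp only [cdot, Pi.add_apply, Pi.smul_apply, smul_eq_mul, Finset.sum_mul,
    ← Finset.sum_add_distrib]
  refine Finset.sum_congr rfl fun k _ => ?_
  push_cast
  ring

theorem re_cdot (m : Fin d → ℂ) (v : Fin d → ℝ) : (cdot m v).re = (fun k => (m k).re) ⬝ᵥ v := by
  simp [cdot, dotProduct]

/-- The value of a polynomial at a real point. -/
def evalReal (p : MvPolynomial (Fin d) ℂ) (y : Fin d → ℝ) : ℂ := eval (fun k => (y k : ℂ)) p

theorem evalReal_cshift (p : MvPolynomial (Fin d) ℂ) (w y : Fin d → ℝ) :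
    evalReal (cshift (fun k => (w k : ℂ)) p) y = evalReal p (y + w) := by
  rw [evalReal, evalReal, cshift, ← aeval_eq_eval, ← aeval_eq_eval, ← AlgHom.comp_apply,
    comp_aeval]
  simp

theorem eq_of_evalReal_eq {p q : MvPolynomial (Fin d) ℂ} (h : ∀ y, evalReal p y = evalReal q y) :
    p = q := by
  refine funext_set (s := fun _ => Set.range ((↑) : ℝ → ℂ))
    (fun _ => Set.infinite_range_of_injective Complex.ofReal_injective) fun x hx => ?_
  choose y hy using fun k => hx k trivial
  have : x = fun k => (y k : ℂ) := funext fun k => (hy k).symm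
  rw [this]
  exact h y

/-- The exponential polynomial `∑_{m ∈ s} Q_m e^m` as a function. -/
def expSum (s : Finset (Fin d → ℂ)) (Q : (Fin d → ℂ) → MvPolynomial (Fin d) ℂ)
    (y : Fin d → ℝ) : ℂ := ∑ m ∈ s, evalReal (Q m) y * expFun m y

/-- The restriction of a polynomial to a line. -/
def rayPoly (p : MvPolynomial (Fin d) ℂ) (y v : Fin d → ℝ) : Polynomial ℂ :=
  aeval (fun k => Polynomial.C (y k : ℂ) + (v k : ℂ) • Polynomial.X) p

theorem eval_rayPoly (p : MvPolynomial (Fin d) ℂ) (y v : Fin d → ℝ) (t : ℝ) :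
    (rayPoly p y v).eval (t : ℂ) = evalReal p (y + t • v) := by
  rw [rayPoly, evalReal, ← Polynomial.coe_aeval_eq_eval, ← AlgHom.coe_toRingHom,
    RingHom.coe_coe, ← AlgHom.comp_apply, comp_aeval, aeval_eq_eval]
  simp only [map_add, map_smul, Polynomial.aeval_C, Polynomial.aeval_X, Pi.add_apply,
    Pi.smul_apply, smul_eq_mul, Complex.ofReal_add, Complex.ofReal_mul, mul_comm (t : ℂ)]
  rfl

/-- The coefficient of `e^{ct}` in the restriction of an exponential polynomial to a line. -/
def classPoly (s : Finset (Fin d → ℂ)) (Q : (Fin d → ℂ) → MvPolynomial (Fin d) ℂ)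
    (y v : Fin d → ℝ) (c : ℂ) : Polynomial ℂ :=
  ∑ m ∈ s with cdot m v = c, Polynomial.C (expFun m y) * rayPoly (Q m) y v

theorem eval_classPoly (s : Finset (Fin d → ℂ)) (Q : (Fin d → ℂ) → MvPolynomial (Fin d) ℂ)
    (y v : Fin d → ℝ) (c : ℂ) (t : ℝ) : (classPoly s Q y v c).eval (t : ℂ) =
      ∑ m ∈ s with cdot m v = c, evalReal (Q m) (y + t • v) * expFun m y := by
  rw [classPoly, Polynomial.eval_finsetSum]
  refine Finset.sum_congr rfl fun m _ => ?_
  rw [Polynomial.eval_mul, Polynomial.eval_C, eval_rayPoly, mul_comm]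

theorem expSum_add_smul (s : Finset (Fin d → ℂ)) (Q : (Fin d → ℂ) → MvPolynomial (Fin d) ℂ)
    (y v : Fin d → ℝ) (t : ℝ) : expSum s Q (y + t • v) =
      ∑ c ∈ s.image fun m => cdot m v,
        (classPoly s Q y v c).eval (t : ℂ) * Complex.exp (c * t) := by
  classical
  rw [expSum, ← Finset.sum_fiberwise_of_maps_to
    (fun m hm => Finset.mem_image_of_mem (fun m => cdot m v) hm)]
  refine Finset.sum_congr rfl fun c _ => ?_
  rw [eval_classPoly, Finset.sum_mul]
  refine Finset.sum_congr (by congr) fun m hm => ?_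
  rw [Finset.mem_filter] at hm
  rw [expFun_eq, expFun_eq, cdot_add_smul, hm.2, Complex.exp_add]
  ring

/-- Multiplication by e^{-ht} shifts all frequencies by h and reduces to the bounded case. -/
theorem classPoly_of_bounded {s : Finset (Fin d → ℂ)}
    {Q : (Fin d → ℂ) → MvPolynomial (Fin d) ℂ} {y v : Fin d → ℝ} {h M : ℝ}
    (hb : ∀ t : ℝ, 0 ≤ t → ‖expSum s Q (y + t • v)‖ ≤ M * Real.exp (t * h)) (c : ℂ) :
    (h < c.re → classPoly s Q y v c = 0) ∧
      (c.re = h → (classPoly s Q y v c).natDegree = 0) := by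
  classical
  by_cases hc : c ∈ s.image fun m => cdot m v
  · have key := expPoly_of_bounded (c - h)
      (((s.image fun m => cdot m v).erase c).image fun c => c - (h : ℂ)) (by simp)
      (classPoly s Q y v c) (fun c => classPoly s Q y v (c + h)) M fun t ht => by
        have e : (classPoly s Q y v c).eval (t : ℂ) * Complex.exp ((c - h) * t) +
            ∑ c ∈ ((s.image fun m => cdot m v).erase c).image fun c => c - (h : ℂ),
              (classPoly s Q y v (c + h)).eval (t : ℂ) * Complex.exp (c * t) =
            expSum s Q (y + t • v) * Complex.exp (-(h * t)) := by
          rw [Finset.sum_image fun a _ b _ hab => sub_left_injective hab, expSum_add_smul,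
            ← Finset.add_sum_erase _ _ hc, add_mul, Finset.sum_mul]
          congr 1
          · rw [mul_assoc, ← Complex.exp_add]; ring_nf
          · refine Finset.sum_congr rfl fun c' _ => ?_
            rw [sub_add_cancel, mul_assoc, ← Complex.exp_add]; ring_nf
        rw [e, norm_mul, Complex.norm_exp]
        have e2 : (-((h : ℂ) * t)).re = -(t * h) := by simp [mul_comm]
        rw [e2, Real.exp_neg, ← div_eq_mul_inv, div_le_iff₀ (Real.exp_pos _)]
        exact hb t ht
    simpa [sub_eq_zero] using key
  · have : classPoly s Q y v c = 0 := by
      rw [classPoly, Finset.filter_false_of_mem, Finset.sum_empty]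
      intro m hm hmc
      exact hc (Finset.mem_image.2 ⟨m, hm, hmc⟩)
    simp [this]

/-- The zero function satisfies every growth bound, in particular one with rate below Re c. -/
theorem expSum_filter_eq_zero {s : Finset (Fin d → ℂ)}
    {Q : (Fin d → ℂ) → MvPolynomial (Fin d) ℂ} (h : ∀ y, expSum s Q y = 0) (v : Fin d → ℝ) (c : ℂ)
    (y : Fin d → ℝ) : expSum {m ∈ s | cdot m v = c} Q y = 0 := by
  have h1 := (classPoly_of_bounded (s := s) (Q := Q) (y := y) (v := v) (h := c.re - 1) (M := 0)
    (fun t _ => by simp [h]) c).1 (by linarith)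
  have h2 := eval_classPoly s Q y v c 0
  rw [h1, zero_smul, add_zero, Polynomial.eval_zero] at h2
  exact h2.symm

/-- Two distinct exponents differ in some coordinate; restricting to the class of m in that
direction gives a strictly smaller vanishing sum. -/
theorem eq_zero_of_expSum_eq_zero (s : Finset (Fin d → ℂ))
    {Q : (Fin d → ℂ) → MvPolynomial (Fin d) ℂ} (h : ∀ y, expSum s Q y = 0) :
    ∀ m ∈ s, Q m = 0 := by
  classical
  induction s using Finset.strongInduction with
  | H s ih =>
    intro m hm
    by_cases hone : ∃ m' ∈ s, m' ≠ m
    · obtain ⟨m', hm', hne⟩ := hone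
      obtain ⟨k, hk⟩ := Function.ne_iff.1 hne
      have hcd : ∀ x : Fin d → ℂ, cdot x (Pi.single k (1 : ℝ)) = x k := by
        intro x
        rw [cdot, Finset.sum_eq_single k]
        · simp
        · intro j _ hj; simp [hj]
        · simp
      refine ih {x ∈ s | cdot x (Pi.single k (1 : ℝ)) = m k} ?_
        (expSum_filter_eq_zero h _ _) m ?_
      · refine Finset.filter_ssubset.2 ⟨m', hm', ?_⟩
        rw [hcd]; exact hk
      · simp [hm, hcd]
    · push Not at hone
      have hs : s = {m} := Finset.eq_singleton_iff_unique_mem.2 ⟨hm, hone⟩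
      refine eq_of_evalReal_eq fun y => ?_
      have := h y
      rw [hs, expSum, Finset.sum_singleton, mul_eq_zero] at this
      rcases this with h0 | h0
      · rw [h0, evalReal, map_zero]
      · exact absurd h0 (Complex.exp_ne_zero _)

/-- Along every ray in direction v the growth rate is at most h(v). If Re m(v) were larger, the
exponents with the same value on v as m would have vanishing sum, and independence gives Q_m = 0. -/
theorem re_exponent_le {s : Finset (Fin d → ℂ)} {Q : (Fin d → ℂ) → MvPolynomial (Fin d) ℂ}
    {h : (Fin d → ℝ) → ℝ} {M : ℝ} (hb : ∀ y, ‖expSum s Q y‖ ≤ M * Real.exp (h y))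
    (hM : 0 ≤ M) (hsub : ∀ y v (t : ℝ), 0 ≤ t → h (y + t • v) ≤ h y + t * h v)
    {m : Fin d → ℂ} (hm : m ∈ s) (hQ : Q m ≠ 0) (v : Fin d → ℝ) : (cdot m v).re ≤ h v := by
  classical
  by_contra! hlt
  refine hQ (eq_zero_of_expSum_eq_zero {x ∈ s | cdot x v = cdot m v} (fun y => ?_) m (by simp [hm]))
  have h1 := (classPoly_of_bounded (s := s) (Q := Q) (y := y) (v := v) (h := h v)
    (M := M * Real.exp (h y)) (fun t ht => ?_) (cdot m v)).1 hlt
  · have h2 := eval_classPoly s Q y v (cdot m v) 0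
    rw [h1, Polynomial.eval_zero] at h2
    rw [expSum, h2]
    simp
  · refine (hb _).trans ?_
    rw [mul_assoc, ← Real.exp_add]
    exact mul_le_mul_of_nonneg_left (Real.exp_le_exp.2 (hsub y v t ht)) hM

/-- At the critical rate the class polynomial is constant in t. Hence the sum of (Q_x(y + tv) -
Q_x(y)) e^x over the class vanishes for all y, and independence of exponentials applies to each
coefficient. -/
theorem cshift_eq_of_re_exponent_eq {s : Finset (Fin d → ℂ)}
    {Q : (Fin d → ℂ) → MvPolynomial (Fin d) ℂ}
    {h : (Fin d → ℝ) → ℝ} {M : ℝ} (hb : ∀ y, ‖expSum s Q y‖ ≤ M * Real.exp (h y))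
    (hM : 0 ≤ M) (hsub : ∀ y v (t : ℝ), 0 ≤ t → h (y + t • v) ≤ h y + t * h v)
    {m : Fin d → ℂ} (hm : m ∈ s) {v : Fin d → ℝ} (heq : (cdot m v).re = h v) (t : ℝ) :
    cshift (fun k => ((t • v) k : ℂ)) (Q m) = Q m := by
  classical
  have key := eq_zero_of_expSum_eq_zero {x ∈ s | cdot x v = cdot m v}
    (Q := fun x => cshift (fun k => ((t • v) k : ℂ)) (Q x) - Q x) (fun y => ?_) m (by simp [hm])
  · exact sub_eq_zero.1 key
  · have h1 := (classPoly_of_bounded (s := s) (Q := Q) (y := y) (v := v) (h := h v)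
      (M := M * Real.exp (h y)) (fun t ht => by
        refine (hb _).trans ?_
        rw [mul_assoc, ← Real.exp_add]
        exact mul_le_mul_of_nonneg_left (Real.exp_le_exp.2 (hsub y v t ht)) hM) (cdot m v)).2 heq
    obtain ⟨a, ha⟩ := Polynomial.natDegree_eq_zero.1 h1
    have h2 := eval_classPoly s Q y v (cdot m v) 0
    have h3 := eval_classPoly s Q y v (cdot m v) t
    rw [← ha, Polynomial.eval_C] at h2 h3
    rw [zero_smul, add_zero] at h2
    have h4 := h3.symm.trans h2
    rw [expSum]
    have e : ∀ x, evalReal (cshift (fun k => ((t • v) k : ℂ)) (Q x) - Q x) y =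
        evalReal (Q x) (y + t • v) - evalReal (Q x) y := by
      intro x
      rw [← evalReal_cshift, evalReal, map_sub]; rfl
    simp only [e, sub_mul, Finset.sum_sub_distrib, h4, sub_self]

end AbelianCoulomb

end

/-! ### The polytope, its support function and its faces -/

noncomputable section

namespace AbelianCoulomb

open MvPolynomial Filter Topology

variable {d n : ℕ} {ξ : Fin n → Fin d → ℤ} {lam : Submodule ℝ (Fin d → ℝ) → Fin d → ℤ}

variable (ξ lam) in
/-- The support function of the polytope. -/
def supportFun (y : Fin d → ℝ) : ℝ := ∑ l ∈ lines ξ, 1 / 2 * |toReal (lam l) ⬝ᵥ y|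

theorem supportFun_add_smul_le (y v : Fin d → ℝ) (t : ℝ) (ht : 0 ≤ t) :
    supportFun ξ lam (y + t • v) ≤ supportFun ξ lam y + t * supportFun ξ lam v := by
  rw [supportFun, supportFun, supportFun, Finset.mul_sum, ← Finset.sum_add_distrib]
  refine Finset.sum_le_sum fun l _ => ?_
  rw [dotProduct_add, dotProduct_smul, smul_eq_mul]
  have := abs_add_le (toReal (lam l) ⬝ᵥ y) (t * (toReal (lam l) ⬝ᵥ v))
  rw [abs_mul, abs_of_nonneg ht] at this
  linarith

theorem norm_expFun_scaled (c : ℝ) (v : Fin d → ℤ) (y : Fin d → ℝ) :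
    ‖expFun (scaled (c : ℂ) v) y‖ = Real.exp (c * (toReal v ⬝ᵥ y)) := by
  rw [expFun, Complex.norm_exp]
  congr 1
  simp [scaled, toReal, dotProduct, Finset.mul_sum, mul_assoc]

theorem norm_expFun_sub_le (v : Fin d → ℤ) (c : ℂ) (y : Fin d → ℝ) :
    ‖expFun (scaled (1 / 2) v) y - c * expFun (scaled (-(1 / 2)) v) y‖ ≤
      (1 + ‖c‖) * Real.exp (1 / 2 * |toReal v ⬝ᵥ y|) := by
  have h1 := norm_expFun_scaled (1 / 2) v y
  have h2 := norm_expFun_scaled (-(1 / 2)) v y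
  push_cast at h1 h2
  refine (norm_sub_le _ _).trans ?_
  rw [norm_mul, h1, h2, add_mul, one_mul]
  have h3 := le_abs_self (toReal v ⬝ᵥ y)
  have h4 := neg_le_abs (toReal v ⬝ᵥ y)
  refine add_le_add (Real.exp_le_exp.2 (by linarith))
    (mul_le_mul_of_nonneg_left (Real.exp_le_exp.2 (by linarith)) (norm_nonneg _))

theorem norm_denFun_le (ζ : Fin d → ℂ) : ∃ M, 0 ≤ M ∧ ∀ y : Fin d → ℝ,
    ‖denFun ξ lam ζ y‖ ≤ M * Real.exp (supportFun ξ lam y) := by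
  refine ⟨∏ l ∈ lines ξ, (1 + ‖twist ζ (lam l)‖),
    Finset.prod_nonneg fun l _ => by positivity, fun y => ?_⟩
  rw [denFun, norm_prod, supportFun, Real.exp_sum, ← Finset.prod_mul_distrib]
  exact Finset.prod_le_prod (fun _ _ => norm_nonneg _) fun l _ => norm_expFun_sub_le _ _ _

theorem convex_isCompact_polytope :
    Convex ℝ (polytope ξ lam) ∧ IsCompact (polytope ξ lam) := by
  let g : (Submodule ℝ (Fin d → ℝ) → ℝ) →ₗ[ℝ] (Fin d → ℝ) :=
    ∑ l ∈ lines ξ, (LinearMap.proj (R := ℝ) (φ := fun _ => ℝ) l).smulRight (toReal (lam l))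
  have hg : ∀ t, g t = ∑ l ∈ lines ξ, t l • toReal (lam l) := by
    intro t; simp [g, LinearMap.sum_apply]
  have he : polytope ξ lam = g '' (Set.univ.pi fun _ => Set.Icc (-(1 / 2)) (1 / 2)) := by
    ext x
    simp only [polytope, Set.mem_ofPred_eq, Set.mem_image, Set.mem_univ_pi, hg]
    exact ⟨fun ⟨t, h1, h2⟩ => ⟨t, h1, h2.symm⟩, fun ⟨t, h1, h2⟩ => ⟨t, h1, h2.symm⟩⟩
  have hc : Continuous g := by
    have : (g : (Submodule ℝ (Fin d → ℝ) → ℝ) → Fin d → ℝ) =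
      fun t => ∑ l ∈ lines ξ, t l • toReal (lam l) := funext hg
    rw [this]
    fun_prop
  rw [he]
  exact ⟨(convex_pi fun _ _ => convex_Icc _ _).linear_image g,
    (isCompact_univ_pi fun _ => isCompact_Icc).image hc⟩

theorem clm_eq_dotProduct (f : StrongDual ℝ (Fin d → ℝ)) :
    ∃ v : Fin d → ℝ, ∀ x, f x = x ⬝ᵥ v := by
  refine ⟨fun k => f (Pi.single k 1), fun x => ?_⟩
  conv_lhs => rw [← Finset.univ_sum_single x]
  rw [map_sum, dotProduct]
  refine Finset.sum_congr rfl fun k _ => ?_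
  have : (Pi.single k (x k) : Fin d → ℝ) = x k • Pi.single k 1 := by
    rw [← Pi.single_smul, smul_eq_mul, mul_one]
  rw [this, map_smul, smul_eq_mul]

theorem sum_smul_dotProduct (t : Submodule ℝ (Fin d → ℝ) → ℝ) (v : Fin d → ℝ) :
    (∑ l ∈ lines ξ, t l • toReal (lam l)) ⬝ᵥ v =
      ∑ l ∈ lines ξ, t l * (toReal (lam l) ⬝ᵥ v) := by
  rw [sum_dotProduct]
  simp only [smul_dotProduct, smul_eq_mul]

/-- The vertex coefficients at which a functional with value `a` on a generator is maximal. -/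
def halfSign (a : ℝ) : ℝ := if 0 ≤ a then 1 / 2 else -(1 / 2)

theorem halfSign_mem (a : ℝ) : halfSign a ∈ Set.Icc (-(1 / 2) : ℝ) (1 / 2) := by
  unfold halfSign; split_ifs <;> norm_num

theorem halfSign_mul (a : ℝ) : halfSign a * a = 1 / 2 * |a| := by
  unfold halfSign
  split_ifs with h
  · rw [abs_of_nonneg h]
  · rw [abs_of_neg (not_le.1 h)]; ring

theorem mul_le_half_abs {t : ℝ} (ht : t ∈ Set.Icc (-(1 / 2) : ℝ) (1 / 2)) (a : ℝ) :
    t * a ≤ 1 / 2 * |a| := by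
  have h1 : |t| ≤ 1 / 2 := abs_le.2 ht
  calc t * a ≤ |t * a| := le_abs_self _
    _ = |t| * |a| := abs_mul _ _
    _ ≤ _ := mul_le_mul_of_nonneg_right h1 (abs_nonneg _)

theorem exists_mem_polytope_dotProduct (v : Fin d → ℝ) :
    ∃ z ∈ polytope ξ lam, z ⬝ᵥ v = supportFun ξ lam v := by
  refine ⟨_, ⟨fun l => halfSign (toReal (lam l) ⬝ᵥ v), fun l => halfSign_mem _, rfl⟩, ?_⟩
  rw [sum_smul_dotProduct (fun l => halfSign (toReal (lam l) ⬝ᵥ v))]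
  simp only [halfSign_mul]
  rfl

/-- A point outside the compact convex polytope is strictly separated from it by a functional, whose
maximum on the polytope is the value of the support function. -/
theorem mem_polytope_of_forall_le {x : Fin d → ℝ} (h : ∀ v, x ⬝ᵥ v ≤ supportFun ξ lam v) :
    x ∈ polytope ξ lam := by
  by_contra hx
  obtain ⟨hconv, hcomp⟩ := convex_isCompact_polytope (ξ := ξ) (lam := lam)
  obtain ⟨f, u, h1, h2⟩ := geometric_hahn_banach_closed_point hconv hcomp.isClosed hx
  obtain ⟨v, hv⟩ := clm_eq_dotProduct f
  obtain ⟨z, hz, hzv⟩ := exists_mem_polytope_dotProduct (ξ := ξ) (lam := lam) v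
  have h3 := h1 z hz
  rw [hv, hzv] at h3
  rw [hv] at h2
  linarith [h v]

/-- Every vector orthogonal to the direction of an exposed face is a difference of functionals
that are maximal on the polytope at a given point of the face. -/
theorem exists_maximal_of_exposed {F : Set (Fin d → ℝ)} (hF : IsExposed ℝ (polytope ξ lam) F)
    {x : Fin d → ℝ} (hx : x ∈ F) : ∃ v₀, x ⬝ᵥ v₀ = supportFun ξ lam v₀ ∧
      ∀ w, (∀ u ∈ (affineSpan ℝ F).direction, u ⬝ᵥ w = 0) →
        ∃ ε > (0 : ℝ), x ⬝ᵥ (v₀ + ε • w) = supportFun ξ lam (v₀ + ε • w) := by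
  classical
  obtain ⟨f, hf⟩ := hF ⟨x, hx⟩
  obtain ⟨v₀, hv⟩ := clm_eq_dotProduct f
  have hxF := hx
  rw [hf] at hxF
  obtain ⟨⟨t, ht, hxt⟩, hmax⟩ := hxF
  obtain ⟨z, hz, hzv⟩ := exists_mem_polytope_dotProduct (ξ := ξ) (lam := lam) v₀
  have h1 : supportFun ξ lam v₀ ≤ x ⬝ᵥ v₀ := by
    have := hmax z hz
    rwa [hv, hv, hzv] at this
  have hval : ∀ v, x ⬝ᵥ v = ∑ l ∈ lines ξ, t l * (toReal (lam l) ⬝ᵥ v) := by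
    intro v
    rw [hxt, sum_smul_dotProduct]
  have hle : ∀ v, x ⬝ᵥ v ≤ supportFun ξ lam v := by
    intro v
    rw [hval]
    exact Finset.sum_le_sum fun l _ => mul_le_half_abs (ht l) _
  have h0 := le_antisymm (hle v₀) h1
  refine ⟨v₀, h0, fun w hw => ?_⟩
  -- Equality of the sums forces equality in each of the termwise inequalities.
  have hterm : ∀ l ∈ lines ξ, t l * (toReal (lam l) ⬝ᵥ v₀) = 1 / 2 * |toReal (lam l) ⬝ᵥ v₀| := by
    rw [hval] at h0
    exact (Finset.sum_eq_sum_iff_of_le fun l _ => mul_le_half_abs (ht l) _).1 h0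
  -- If v₀ vanishes on λ_l, the coefficient of λ_l may be moved freely between -1/2 and 1/2 without
  -- leaving F, so λ_l lies in the direction of F.
  have hdir : ∀ l ∈ lines ξ, toReal (lam l) ⬝ᵥ v₀ = 0 → toReal (lam l) ⬝ᵥ w = 0 := by
    intro l hl hl0
    apply hw
    have hupd : ∀ c : ℝ, ∑ l' ∈ lines ξ, Function.update t l c l' • toReal (lam l') =
        c • toReal (lam l) + ∑ l' ∈ (lines ξ).erase l, t l' • toReal (lam l') := by
      intro c
      rw [← Finset.add_sum_erase _ _ hl, Function.update_self]
      congr 1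
      refine Finset.sum_congr rfl fun l' hl' => ?_
      rw [Function.update_of_ne (Finset.ne_of_mem_erase hl')]
    have hmem : ∀ c ∈ Set.Icc (-(1 / 2) : ℝ) (1 / 2),
        c • toReal (lam l) + ∑ l' ∈ (lines ξ).erase l, t l' • toReal (lam l') ∈ F := by
      intro c hc
      rw [hf]
      refine ⟨⟨Function.update t l c, fun l' => ?_, (hupd c).symm⟩, fun y hy => ?_⟩
      · by_cases h : l' = l
        · rw [h, Function.update_self]; exact hc
        · rw [Function.update_of_ne h]; exact ht l'
      · refine (hmax y hy).trans (le_of_eq ?_)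
        have e : x = t l • toReal (lam l) +
            ∑ l' ∈ (lines ξ).erase l, t l' • toReal (lam l') := by
          rw [hxt, Finset.add_sum_erase _ (fun l' => t l' • toReal (lam l')) hl]
        rw [hv, hv, e, add_dotProduct, add_dotProduct, smul_dotProduct, smul_dotProduct, hl0,
          smul_zero, smul_zero]
    have h2 := AffineSubspace.vsub_mem_direction
      (mem_affineSpan ℝ (hmem (1 / 2) (by norm_num)))
      (mem_affineSpan ℝ (hmem (-(1 / 2)) (by norm_num)))
    rw [vsub_eq_sub, add_sub_add_right_eq_sub, ← sub_smul] at h2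
    norm_num at h2
    exact h2
  -- For small ε the perturbation by ε w does not reverse the sign of any nonzero value of v₀ on a
  -- generator, so the same coefficients t remain optimal.
  have hev : ∀ᶠ ε : ℝ in 𝓝[>] 0, ∀ l ∈ lines ξ,
      ε * |toReal (lam l) ⬝ᵥ w| ≤ |toReal (lam l) ⬝ᵥ v₀| := by
    rw [eventually_all_finset]
    intro l hl
    by_cases h : toReal (lam l) ⬝ᵥ v₀ = 0
    · simp [h, hdir l hl h]
    · have ht : Tendsto (fun ε : ℝ => ε * |toReal (lam l) ⬝ᵥ w|) (𝓝[>] 0) (𝓝 0) := by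
        have : Continuous fun ε : ℝ => ε * |toReal (lam l) ⬝ᵥ w| := by fun_prop
        simpa using (this.tendsto 0).mono_left nhdsWithin_le_nhds
      exact (ht.eventually_lt_const (abs_pos.2 h)).mono fun _ => le_of_lt
  obtain ⟨ε, hε, hε0⟩ := (hev.and self_mem_nhdsWithin).exists
  refine ⟨ε, hε0, ?_⟩
  rw [hval, supportFun]
  refine Finset.sum_congr rfl fun l hl => ?_
  have h2 := hterm l hl
  have h3 := hε l hl
  rw [dotProduct_add, dotProduct_smul, smul_eq_mul]
  have hε0' : 0 < ε := hε0
  have h4 : |ε * (toReal (lam l) ⬝ᵥ w)| ≤ |toReal (lam l) ⬝ᵥ v₀| := by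
    rwa [abs_mul, abs_of_pos hε0']
  have h5 := abs_le.1 h4
  rcases lt_trichotomy (toReal (lam l) ⬝ᵥ v₀) 0 with hneg | hz | hpos
  · rw [abs_of_neg hneg] at h2 h5
    have ht' : t l = -(1 / 2) := by
      have : (t l + 1 / 2) * (toReal (lam l) ⬝ᵥ v₀) = 0 := by linarith
      rcases mul_eq_zero.1 this with h | h <;> linarith
    rw [ht', abs_of_nonpos (by linarith)]
    ring
  · simp [hz, hdir l hl hz]
  · rw [abs_of_pos hpos] at h2 h5
    have ht' : t l = 1 / 2 := by
      have : (t l - 1 / 2) * (toReal (lam l) ⬝ᵥ v₀) = 0 := by linarith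
      rcases mul_eq_zero.1 this with h | h <;> linarith
    rw [ht', abs_of_nonneg (by linarith)]

/-- The transpose of a projection onto U moves y by a vector orthogonal to U, so p is unchanged when
y is replaced by its image y'. The coordinates of y' are linear forms given by elements of U. -/
theorem mem_polysOn_of_cshift_eq {U : Submodule ℝ (Fin d → ℝ)} {p : MvPolynomial (Fin d) ℂ}
    (h : ∀ w : Fin d → ℝ, (∀ u ∈ U, u ⬝ᵥ w = 0) → cshift (fun k => (w k : ℂ)) p = p) :
    p ∈ polysOn U := by
  classical
  obtain ⟨q, hq⟩ := LinearMap.exists_leftInverse_of_injective U.subtype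
    (by rw [Submodule.ker_subtype])
  let c : Fin d → Fin d → ℝ := fun k => (q (Pi.single k 1) : Fin d → ℝ)
  have hc : ∀ k, c k ∈ U := fun k => (q (Pi.single k 1)).2
  have hqu : ∀ u ∈ U, ∑ k, u k • c k = u := by
    intro u hu
    have h1 : q u = ⟨u, hu⟩ := LinearMap.congr_fun hq ⟨u, hu⟩
    have h2 : (q u : Fin d → ℝ) = ∑ k, u k • c k := by
      conv_lhs => rw [← Finset.univ_sum_single u]
      rw [map_sum, Submodule.coe_sum]
      refine Finset.sum_congr rfl fun k _ => ?_
      have : (Pi.single k (u k) : Fin d → ℝ) = u k • Pi.single k 1 := by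
        rw [← Pi.single_smul, smul_eq_mul, mul_one]
      rw [this, map_smul, Submodule.coe_smul]
    rw [← h2, h1]
  have hmem : ∀ p : MvPolynomial (Fin d) ℂ,
      aeval (fun k => linForm fun j => (c k j : ℂ)) p ∈ polysOn U := by
    intro p
    induction p using MvPolynomial.induction_on with
    | C a => rw [aeval_C]; exact Subalgebra.algebraMap_mem _ _
    | add p q hp hq => rw [map_add]; exact Subalgebra.add_mem _ hp hq
    | mul_X p k hp =>
      rw [map_mul, aeval_X]
      exact Subalgebra.mul_mem _ hp (Algebra.subset_adjoin ⟨c k, hc k, rfl⟩)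
  have heq : aeval (fun k => linForm fun j => (c k j : ℂ)) p = p := by
    refine eq_of_evalReal_eq fun y => ?_
    let y' : Fin d → ℝ := fun k => c k ⬝ᵥ y
    have h1 : evalReal (aeval (fun k => linForm fun j => (c k j : ℂ)) p) y = evalReal p y' := by
      rw [evalReal, evalReal, ← aeval_eq_eval, ← aeval_eq_eval, ← AlgHom.comp_apply, comp_aeval]
      congr 2
      ext k
      simp [linForm, y', dotProduct]
    have h2 : y' = y + (y' - y) := by abel
    rw [h1, h2, ← evalReal_cshift, h]
    intro u hu
    rw [dotProduct_sub, sub_eq_zero]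
    conv_rhs => rw [← hqu u hu, sum_dotProduct]
    simp only [dotProduct, y', Pi.smul_apply, smul_eq_mul, Finset.mul_sum, mul_assoc]
  rw [← heq]
  exact hmem p

theorem mem_polytope_and_face {ζ : Fin d → ℂ} {S : (Fin d → ℂ) →₀ MvPolynomial (Fin d) ℂ}
    {u : (Fin d → ℝ) → ℂ} {B : ℝ} (hu : ∀ y, ‖u y‖ ≤ B)
    (hS : ∀ y, denFun ξ lam ζ y * u y = numFun S y) {m : Fin d → ℂ} (hm : m ∈ S.support) :
    (fun k => (m k).re) ∈ polytope ξ lam ∧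
      ∀ F : Set (Fin d → ℝ), IsExposed ℝ (polytope ξ lam) F → (fun k => (m k).re) ∈ F →
        S m ∈ polysOn (affineSpan ℝ F).direction := by
  obtain ⟨M, hM, hden⟩ := norm_denFun_le (ξ := ξ) (lam := lam) ζ
  have hB : 0 ≤ B := (norm_nonneg _).trans (hu 0)
  have hb : ∀ y, ‖expSum S.support S y‖ ≤ (M * B) * Real.exp (supportFun ξ lam y) := by
    intro y
    rw [show expSum S.support S y = numFun S y from rfl, ← hS, norm_mul, mul_right_comm]
    exact mul_le_mul (hden y) (hu y) (norm_nonneg _) (by positivity)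
  have hMB : 0 ≤ M * B := mul_nonneg hM hB
  refine ⟨mem_polytope_of_forall_le fun v => ?_, fun F hF hmF => ?_⟩
  · rw [← re_cdot]
    exact re_exponent_le hb hMB supportFun_add_smul_le hm (Finsupp.mem_support_iff.1 hm) v
  · obtain ⟨v₀, hv₀, hw⟩ := exists_maximal_of_exposed hF hmF
    rw [← re_cdot] at hv₀
    refine mem_polysOn_of_cshift_eq fun w hwU => ?_
    obtain ⟨ε, hε, hwε⟩ := hw w hwU
    rw [← re_cdot] at hwε
    have h1 := cshift_eq_of_re_exponent_eq hb hMB supportFun_add_smul_le hm hv₀ (-ε⁻¹)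
    have h2 := cshift_eq_of_re_exponent_eq hb hMB supportFun_add_smul_le hm hwε ε⁻¹
    -- S_m is invariant along v₀ and along v₀ + ε w, hence along their difference, which is a
    -- multiple of w.
    have e : (fun k => (w k : ℂ)) = (fun k => ((ε⁻¹ • (v₀ + ε • w)) k : ℂ)) +
        fun k => (((-ε⁻¹) • v₀) k : ℂ) := by
      ext k
      have : (ε : ℂ) ≠ 0 := by exact_mod_cast hε.ne'
      simp only [Pi.add_apply, Pi.smul_apply, smul_eq_mul]
      push_cast
      field_simp
      ring
    rw [e, ← cshift_cshift, h1, h2]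

end AbelianCoulomb

end

/-! ### Analyticity of all vectors from moment bounds on a cyclic vector -/

noncomputable section

namespace AbelianCoulomb

open Filter Topology

theorem factorial_four_mul_le (n : ℕ) : ((4 * n).factorial : ℝ) ≤ (16 ^ n * n.factorial ^ 2) ^ 2 := by
  have h : ∀ n : ℕ, (2 * n).factorial ≤ 4 ^ n * n.factorial ^ 2 := by
    intro n
    have h1 := Nat.add_choose_mul_factorial_mul_factorial n n
    have h2 : (n + n).choose n ≤ 4 ^ n := by
      refine (Nat.choose_le_two_pow _ _).trans (le_of_eq ?_)
      rw [← two_mul, pow_mul]; norm_num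
    rw [two_mul, ← h1, mul_assoc, ← sq]
    exact Nat.mul_le_mul_right _ h2
  have h3 : (4 * n).factorial ≤ (16 ^ n * n.factorial ^ 2) ^ 2 := by
    calc (4 * n).factorial = (2 * (2 * n)).factorial := by congr 1; ring
      _ ≤ 4 ^ (2 * n) * (2 * n).factorial ^ 2 := h _
      _ ≤ 4 ^ (2 * n) * (4 ^ n * n.factorial ^ 2) ^ 2 := by gcongr; exact h n
      _ = _ := by
        rw [show (4 : ℕ) ^ (2 * n) = 16 ^ n by rw [pow_mul]; norm_num,
          mul_pow _ _ 2, ← pow_mul 4, mul_comm n 2, show (4 : ℕ) ^ (2 * n) = 16 ^ n by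
            rw [pow_mul]; norm_num]
        ring
  exact_mod_cast h3

/-- Cauchy–Schwarz bounds ‖A^n p‖² by ‖p'‖ ‖A^{2n} e‖, and skew-symmetry turns ‖A^{2n} e‖² into the
moment of order 4n. The fourth root of (4n)! is at most 4^n n!, which accounts for the factor 4 in
the radius. -/
theorem isAnalyticSkew_of_cyclic_bound {V E : Type*} [NormedAddCommGroup V]
    [InnerProductSpace ℂ V] [NormedAddCommGroup E] [NormedSpace ℝ E] {A : E → Module.End ℂ V}
    {ρ G : ℝ} (hρ : 0 < ρ) (hsmul : ∀ (s : ℝ) (y : E), A (s • y) = (s : ℂ) • A y)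
    (hskew : ∀ y p q, inner ℂ (A y p) q = -inner ℂ p (A y q))
    (hcont : ∀ p (n : ℕ), Continuous fun y => (A y ^ n) p) (e : V)
    (he : ∀ p, ∃ p', ∀ y (n : ℕ), ‖(A y ^ n) p‖ ^ 2 ≤ ‖inner ℂ p' ((A y ^ (2 * n)) e)‖)
    (hG : ∀ y (n : ℕ), ‖inner ℂ e ((A y ^ n) e)‖ ≤ G * n.factorial * (ρ * ‖y‖) ^ n) :
    IsAnalyticSkew A (4 * ρ) := by
  refine ⟨by positivity, hsmul, hskew, hcont, fun p => ?_⟩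
  obtain ⟨p', hp'⟩ := he p
  have hG0 : 0 ≤ G := by simpa using (norm_nonneg _).trans (hG 0 0)
  have hskew' : ∀ y (j : ℕ) (p q : V),
      inner ℂ ((A y ^ j) p) q = (-1) ^ j * inner ℂ p ((A y ^ j) q) := by
    intro y j
    induction j with
    | zero => intro p q; simp
    | succ j ih =>
      intro p q
      rw [pow_succ', Module.End.mul_apply, hskew, ih, ← Module.End.mul_apply, ← pow_succ,
        ← pow_succ']
      ring
  refine ⟨√(‖p'‖ * √G), fun y n => ?_⟩
  have hy : 0 ≤ ρ * ‖y‖ := by positivity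
  have h1 : ‖(A y ^ (2 * n)) e‖ ≤ √G * (16 ^ n * n.factorial ^ 2 * (ρ * ‖y‖) ^ (2 * n)) := by
    refine le_of_sq_le_sq ?_ (by positivity)
    have e1 : ‖(A y ^ (2 * n)) e‖ ^ 2 = ‖inner ℂ e ((A y ^ (4 * n)) e)‖ := by
      have h := hskew' y (2 * n) e ((A y ^ (2 * n)) e)
      rw [← Module.End.mul_apply, ← pow_add, ← two_mul, ← mul_assoc,
        show 2 * 2 * n = 4 * n by ring] at h
      have h' := congrArg norm h
      rw [norm_mul, norm_pow, norm_neg, norm_one, one_pow, one_mul] at h'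
      rw [← h', inner_self_eq_norm_sq_to_K]
      simp
    rw [e1, mul_pow, Real.sq_sqrt hG0, mul_pow]
    refine (hG y (4 * n)).trans ?_
    rw [mul_assoc, ← pow_mul, show 2 * n * 2 = 4 * n by ring]
    gcongr
    exact factorial_four_mul_le n
  refine le_of_sq_le_sq ?_ (by positivity)
  calc ‖(A y ^ n) p‖ ^ 2 ≤ ‖p'‖ * ‖(A y ^ (2 * n)) e‖ :=
        (hp' y n).trans (norm_inner_le_norm _ _)
    _ ≤ ‖p'‖ * (√G * (16 ^ n * n.factorial ^ 2 * (ρ * ‖y‖) ^ (2 * n))) := by gcongr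
    _ = _ := by
      have h3 : √(‖p'‖ * √G) ^ 2 = ‖p'‖ * √G := Real.sq_sqrt (by positivity)
      have h4 : (16 : ℝ) ^ n = (4 ^ n) ^ 2 := by rw [← pow_mul, mul_comm, pow_mul]; norm_num
      rw [mul_pow _ _ 2, mul_pow _ _ 2, h3, h4, mul_assoc 4, mul_pow 4, mul_comm 2 n, pow_mul _ n 2]
      ring

/-- V carries no topology in the statement; the norm is installed inside the proof. Continuity of y
↦ (A y)^n p is therefore expressed by finite expansions with continuous coefficients. -/
theorem exists_matrixCoeff {V E : Type*} [AddCommGroup V] [Module ℂ V]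
    [NormedAddCommGroup E] [NormedSpace ℝ E] (core : InnerProductSpace.Core ℂ V)
    {A : E → Module.End ℂ V} {ρ G : ℝ} (hρ : 0 < ρ)
    (hsmul : ∀ (s : ℝ) (y : E), A (s • y) = (s : ℂ) • A y)
    (hskew : ∀ y p q, core.inner (A y p) q = -core.inner p (A y q)) {ι : Type*}
    (hcont : ∀ p (n : ℕ), ∃ (s : Finset ι) (a : ι → E → ℂ) (q : ι → V),
      (∀ i, Continuous (a i)) ∧ ∀ y, (A y ^ n) p = ∑ i ∈ s, a i y • q i) (e : V)
    (he : ∀ p, ∃ p', ∀ y (n : ℕ), ‖core.inner ((A y ^ n) p) ((A y ^ n) p)‖ ≤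
      ‖core.inner p' ((A y ^ (2 * n)) e)‖)
    (hG : ∀ y (n : ℕ), ‖core.inner e ((A y ^ n) e)‖ ≤ G * n.factorial * (ρ * ‖y‖) ^ n) :
    ∃ u : E → ℂ, Continuous u ∧ (∀ y, ‖u y‖ ≤ (core.inner e e).re) ∧
      (u 0 = core.inner e e) ∧
      (∃ δ > 0, ∀ y, ‖y‖ < δ →
        HasSum (fun n : ℕ => core.inner e ((A y ^ n) e) / (n.factorial : ℂ)) (u y)) ∧
      ∀ (y : E) (t₀ : ℝ), AnalyticAt ℝ (fun t : ℝ => u (t • y)) t₀ := by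
  let _ : NormedAddCommGroup V := core.toNormedAddCommGroup
  let _ : InnerProductSpace ℂ V := InnerProductSpace.ofCore core.toCore
  have hnorm : ∀ p : V, core.inner p p = (‖p‖ ^ 2 : ℝ) := by
    intro p
    have := inner_self_eq_norm_sq_to_K (𝕜 := ℂ) p
    push_cast
    exact this
  have hA : IsAnalyticSkew A (4 * ρ) := by
    refine isAnalyticSkew_of_cyclic_bound (G := G) hρ hsmul hskew (fun p n => ?_) e (fun p => ?_) hG
    · obtain ⟨s, a, q, ha, h⟩ := hcont p n
      simp only [h]
      exact continuous_finsetSum s fun i _ => (ha i).smul continuous_const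
    · obtain ⟨p', hp'⟩ := he p
      refine ⟨p', fun y n => ?_⟩
      have := hp' y n
      rw [hnorm, Complex.norm_real, Real.norm_of_nonneg (by positivity)] at this
      exact this
  have hee : (core.inner e e).re = ‖e‖ ^ 2 := by rw [hnorm, Complex.ofReal_re]
  refine ⟨matrixCoeff A (4 * ρ) hA e, hA.continuous_matrixCoeff e, fun y => ?_, ?_,
    -- This is the condition 4ρ‖y‖ < 1/2.
    ⟨1 / (8 * ρ), by positivity, fun y hy => ?_⟩, hA.analyticAt_matrixCoeff e⟩
  · rw [hee]; exact hA.norm_matrixCoeff_le e y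
  · rw [hA.matrixCoeff_zero, hnorm]
  · refine hA.hasSum_matrixCoeff e ?_
    rw [lt_div_iff₀ (by positivity)] at hy
    linarith

end AbelianCoulomb

end

/-! ### The inner product defined by the trace and the function u -/

noncomputable section

namespace AbelianCoulomb

open MvPolynomial Filter Topology

variable {d n : ℕ} {ξ : Fin n → Fin d → ℤ} {b : Fin n → ℂ}

/-- The antilinear ring endomorphism of `ℂ[𝔱]` that sends every coordinate to its negative. -/
def starPoly : MvPolynomial (Fin d) ℂ →+* MvPolynomial (Fin d) ℂ :=
  eval₂Hom (C.comp (starRingEnd ℂ)) fun k => -X k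

theorem starPoly_C (c : ℂ) : starPoly (C c : MvPolynomial (Fin d) ℂ) = C ((starRingEnd ℂ) c) := by
  simp [starPoly]

theorem starPoly_X (k : Fin d) : starPoly (X k : MvPolynomial (Fin d) ℂ) = -X k := by
  simp [starPoly]

theorem starPoly_smul (c : ℂ) (f : MvPolynomial (Fin d) ℂ) :
    starPoly (c • f) = (starRingEnd ℂ) c • starPoly f := by
  rw [smul_eq_C_mul, map_mul, starPoly_C, smul_eq_C_mul]

theorem starPoly_starPoly (f : MvPolynomial (Fin d) ℂ) : starPoly (starPoly f) = f := by
  induction f using MvPolynomial.induction_on with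
  | C c => simp [starPoly_C]
  | add f h hf hh => rw [map_add, map_add, hf, hh]
  | mul_X f k hf => rw [map_mul, map_mul, hf, starPoly_X, map_neg, starPoly_X, neg_neg]

theorem starPoly_linForm (y : Fin d → ℝ) :
    starPoly (linForm fun k => (y k : ℂ)) = -linForm fun k => (y k : ℂ) := by
  simp [linForm, starPoly_C, starPoly_X]

theorem IsAdmissible.map_mono_zero {ρ : CoulombBranch ξ b ≃+* CoulombBranch ξ b}
    (hρ : IsAdmissible ρ) (f : MvPolynomial (Fin d) ℂ) :
    ρ (mono ξ b 0 f) = mono ξ b 0 (starPoly f) := by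
  induction f using MvPolynomial.induction_on with
  | C c =>
    rw [starPoly_C, ← mul_one (C c), ← smul_eq_C_mul, ← smul_mono, hρ.antilinear, mono_zero_one,
      map_one, ← mul_one (C _), ← smul_eq_C_mul, ← smul_mono, mono_zero_one]
  | add f h hf hh => rw [mono_add, map_add, hf, hh, map_add, mono_add]
  | mul_X f k hf =>
    rw [← mono_zero_mul, map_mul, hf, hρ.neg, map_mul, starPoly_X, ← mono_zero_mul]
    congr 1
    rw [← neg_one_smul ℂ, smul_mono, neg_one_smul]

/-- A functional on `ℂ[𝔱]` that is positive with respect to `starPoly`. -/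
structure IsPositiveFunctional (φ : MvPolynomial (Fin d) ℂ →ₗ[ℂ] ℂ) : Prop where
  real : ∀ f, (φ (starPoly f * f)).im = 0
  pos : ∀ f, f ≠ 0 → 0 < (φ (starPoly f * f)).re

theorem IsPositiveTrace.restrictTrace {ρ : CoulombBranch ξ b ≃+* CoulombBranch ξ b}
    {T : CoulombBranch ξ b →ₗ[ℂ] ℂ} (hT : IsPositiveTrace ρ T) (hρ : IsAdmissible ρ) :
    IsPositiveFunctional (restrictTrace T) := by
  have h : ∀ f, AbelianCoulomb.restrictTrace T (starPoly f * f) =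
      T (mono ξ b 0 f * ρ (mono ξ b 0 f)) := by
    intro f
    rw [hρ.map_mono_zero, mono_zero_mul, restrictTrace_apply, mul_comm]
  refine ⟨fun f => ?_, fun f hf => ?_⟩
  · rw [h]; exact hT.real _
  · rw [h]
    refine hT.pos _ fun h0 => hf (mono_injective (ξ := ξ) (b := b) 0 ?_)
    rw [h0, mono_zero]

namespace IsPositiveFunctional

variable {φ : MvPolynomial (Fin d) ℂ →ₗ[ℂ] ℂ}

/-- Polarization: φ(f^* f) is real for f = 1, h, 1 + h and 1 + ih. -/
theorem map_starPoly (hφ : IsPositiveFunctional φ) (h : MvPolynomial (Fin d) ℂ) : φ (starPoly h) = (starRingEnd ℂ) (φ h) := by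
  have h0 := hφ.real 1
  have h1 := hφ.real h
  have h2 := hφ.real (1 + h)
  have h3 := hφ.real (1 + Complex.I • h)
  have e3 : starPoly (1 + Complex.I • h) * (1 + Complex.I • h) =
      starPoly 1 * 1 + Complex.I • h - Complex.I • starPoly h + starPoly h * h := by
    rw [map_add, map_one, starPoly_smul, Complex.conj_I]
    simp only [smul_eq_C_mul, C_neg]
    have : (C Complex.I : MvPolynomial (Fin d) ℂ) * C Complex.I = -1 := by
      rw [← C_mul, Complex.I_mul_I, C_neg, C_1]
    linear_combination (-(starPoly h * h)) * this
  have e2 : starPoly (1 + h) * (1 + h) = starPoly 1 * 1 + h + starPoly h + starPoly h * h := by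
    rw [map_add, map_one]; ring
  rw [e2, map_add, map_add, map_add, Complex.add_im, Complex.add_im, Complex.add_im] at h2
  rw [e3, map_add, map_sub, map_add, map_smul, map_smul, Complex.add_im, Complex.sub_im,
    Complex.add_im, smul_eq_mul, smul_eq_mul, Complex.I_mul_im, Complex.I_mul_im] at h3
  apply Complex.ext
  · rw [Complex.conj_re]; linarith
  · rw [Complex.conj_im]; linarith

/-- The inner product `(f, h) ↦ φ (f^* h)`. -/
@[reducible]
def core (hφ : IsPositiveFunctional φ) : InnerProductSpace.Core ℂ (MvPolynomial (Fin d) ℂ) where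
  inner f h := φ (starPoly f * h)
  conj_inner_symm f h := by
    rw [← hφ.map_starPoly, map_mul, starPoly_starPoly, mul_comm]
  re_inner_nonneg f := by
    by_cases hf : f = 0
    · simp [hf]
    · exact (hφ.pos f hf).le
  add_left f g h := by rw [map_add, add_mul, map_add]
  smul_left f g c := by rw [starPoly_smul, smul_mul_assoc, map_smul, smul_eq_mul]
  definite f hf := by
    by_contra h
    have := hφ.pos f h
    rw [hf] at this
    exact lt_irrefl _ this

/-- The function is ⟨1, exp(y) 1⟩. Real linear forms act skew-symmetrically because the star
operation sends them to their negatives, and 1 is cyclic. -/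
theorem exists_expGenFun (hφ : IsPositiveFunctional φ) (hb : IsGeomBounded (coeffSeries φ)) :
    ∃ u : (Fin d → ℝ) → ℂ, Continuous u ∧ (∀ y, ‖u y‖ ≤ (φ 1).re) ∧ u 0 = φ 1 ∧
      (∃ δ > 0, ∀ y, ‖y‖ < δ → AbsConv (coeffSeries φ) (fun k => (y k : ℂ)) ∧
        evalSeries (coeffSeries φ) (fun k => (y k : ℂ)) = u y) ∧
      ∀ (y : Fin d → ℝ) (t₀ : ℝ), AnalyticAt ℝ (fun t : ℝ => u (t • y)) t₀ := by
  obtain ⟨ρ, hρ, G, hG⟩ := hb.exists_bound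
  set A : (Fin d → ℝ) → Module.End ℂ (MvPolynomial (Fin d) ℂ) :=
    fun y => LinearMap.mulLeft ℂ (linForm fun k => (y k : ℂ)) with hA
  have hpow : ∀ y (n : ℕ) p, (A y ^ n) p = (linForm fun k => (y k : ℂ)) ^ n * p := by
    intro y n p
    rw [hA, LinearMap.pow_mulLeft, LinearMap.mulLeft_apply]
  have hinner : ∀ p q, hφ.core.inner p q = φ (starPoly p * q) := fun _ _ => rfl
  have hone : hφ.core.inner 1 1 = φ 1 := by rw [hinner, map_one, mul_one]
  have honepow : ∀ y (n : ℕ), hφ.core.inner 1 ((A y ^ n) 1) =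
      φ ((linForm fun k => (y k : ℂ)) ^ n) := by
    intro y n; rw [hinner, map_one, one_mul, hpow, mul_one]
  obtain ⟨u, hc, hbd, h0, ⟨δ, hδ, hu⟩, han⟩ := exists_matrixCoeff hφ.core (A := A) (G := G)
      (ι := Fin d →₀ ℕ) hρ
      (fun s y => by
        have : (linForm fun k => ((s • y) k : ℂ)) = (s : ℂ) • linForm fun k => (y k : ℂ) := by
          simp [linForm, Finset.smul_sum, smul_eq_C_mul, mul_assoc]
        refine LinearMap.ext fun p => ?_
        rw [hA, LinearMap.mulLeft_apply, this, LinearMap.smul_apply, LinearMap.mulLeft_apply,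
          smul_mul_assoc])
      (fun y p q => by
        rw [hinner, hinner, hA, LinearMap.mulLeft_apply, LinearMap.mulLeft_apply, map_mul starPoly,
          starPoly_linForm, ← map_neg]
        congr 1; ring)
      (fun p n => ⟨Finset.finsuppAntidiag Finset.univ n,
        fun k y => (Nat.multinomial Finset.univ k : ℂ) * ∏ i, (y i : ℂ) ^ k i,
        fun k => (∏ i, X i ^ k i) * p, fun k => by fun_prop, fun y => by
          rw [hpow, linForm, sum_pow_eq_sum_finsuppAntidiag, Finset.sum_mul]
          refine Finset.sum_congr rfl fun k _ => ?_
          simp only [smul_eq_C_mul, C_mul, map_prod, C_pow, mul_pow, Finset.prod_mul_distrib,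
            map_natCast, mul_assoc]⟩)
      1
      -- By commutativity the squared norm of y^n p is, up to sign, φ(p^* p y^{2n}).
      (fun p => ⟨starPoly p * p, fun y n => by
        rw [hinner, hinner, hpow, hpow, map_mul starPoly, map_mul starPoly, starPoly_starPoly, map_pow,
          starPoly_linForm, mul_one, neg_pow,
          show (-1) ^ n * (linForm fun k => (y k : ℂ)) ^ n * starPoly p *
              ((linForm fun k => (y k : ℂ)) ^ n * p) =
            ((-1) ^ n : ℂ) • (p * starPoly p * (linForm fun k => (y k : ℂ)) ^ (2 * n)) by
              rw [smul_eq_C_mul, map_pow, map_neg, map_one]; ring,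
          map_smul, norm_smul, norm_pow, norm_neg, norm_one, one_pow, one_mul]⟩)
      (fun y n => by
        rw [honepow]
        have h := sum_coeffSeries_eq φ (fun k => (y k : ℂ)) n
        rw [eq_div_iff (by exact_mod_cast n.factorial_ne_zero)] at h
        rw [← h, norm_mul, Complex.norm_natCast, mul_right_comm]
        gcongr
        exact (norm_sum_le _ _).trans (hG y n))
  refine ⟨u, hc, fun y => hone ▸ hbd y, h0.trans hone,
    -- Below ρ⁻¹ the multivariable series also converges absolutely, so it may be regrouped by
    -- degree.
    ⟨min δ ρ⁻¹, lt_min hδ (by positivity), fun y hy => ?_⟩, han⟩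
  have hlt : ρ * ‖y‖ < 1 := by
    have := (lt_min_iff.1 hy).2
    rwa [inv_eq_one_div, lt_div_iff₀ hρ, mul_comm] at this
  have habs : AbsConv (coeffSeries φ) (fun k => (y k : ℂ)) := by
    refine summable_of_degree (fun _ => norm_nonneg _) ?_
    exact Summable.of_nonneg_of_le (fun _ => Finset.sum_nonneg fun _ _ => norm_nonneg _) (hG y)
      ((summable_geometric_of_lt_one (by positivity) hlt).mul_left G)
  refine ⟨habs, (hasSum_evalSeries_coeffSeries habs).unique ?_⟩
  simpa only [honepow] using hu y (lt_min_iff.1 hy).1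

end IsPositiveFunctional

theorem analyticAt_comp_ofReal {g : ℂ → ℂ} (hg : Differentiable ℂ g) (t : ℝ) :
    AnalyticAt ℝ (fun t : ℝ => g t) t :=
  (hg.analyticAt (t : ℂ)).restrictScalars.comp (Complex.ofRealCLM.analyticAt t)

theorem analyticAt_expFun_smul (m : Fin d → ℂ) (y : Fin d → ℝ) (t₀ : ℝ) :
    AnalyticAt ℝ (fun t : ℝ => expFun m (t • y)) t₀ := by
  have e : (fun t : ℝ => expFun m (t • y)) =
      fun t : ℝ => (fun z : ℂ => Complex.exp (cdot m 0 + cdot m y * z)) t := by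
    funext t
    rw [expFun_eq, ← zero_add (t • y), cdot_add_smul]
  rw [e]
  exact analyticAt_comp_ofReal (g := fun z => Complex.exp (cdot m 0 + cdot m y * z))
    (by fun_prop) t₀

theorem analyticAt_denFun_smul (lam : Submodule ℝ (Fin d → ℝ) → Fin d → ℤ) (ζ : Fin d → ℂ)
    (y : Fin d → ℝ) (t₀ : ℝ) : AnalyticAt ℝ (fun t : ℝ => denFun ξ lam ζ (t • y)) t₀ :=
  Finset.analyticAt_fun_prod _ fun _ _ => (analyticAt_expFun_smul _ _ _).sub
    (analyticAt_const.mul (analyticAt_expFun_smul _ _ _))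

theorem analyticAt_numFun_smul (S : (Fin d → ℂ) →₀ MvPolynomial (Fin d) ℂ)
    (y : Fin d → ℝ) (t₀ : ℝ) : AnalyticAt ℝ (fun t : ℝ => numFun S (t • y)) t₀ := by
  refine Finset.analyticAt_fun_sum _ fun m _ => AnalyticAt.mul ?_ (analyticAt_expFun_smul _ _ _)
  have e : (fun t : ℝ => eval (fun k => ((t • y) k : ℂ)) (S m)) =
      fun t : ℝ => (fun z : ℂ => (rayPoly (S m) 0 y).eval z) t := by
    funext t
    simp only [eval_rayPoly, zero_add, evalReal]
  rw [e]
  exact analyticAt_comp_ofReal (Polynomial.differentiable _) t₀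

/-- Near 0 the identity of power series can be evaluated. Along each line through 0 both sides are
real analytic, so the identity theorem carries it to t = 1. -/
theorem denFun_mul_eq_numFun {T : CoulombBranch ξ b →ₗ[ℂ] ℂ}
    {lam : Submodule ℝ (Fin d → ℝ) → Fin d → ℤ} {ζ : Fin d → ℂ}
    {S : (Fin d → ℂ) →₀ MvPolynomial (Fin d) ℂ} (hS : IsNumerator T lam ζ S)
    {u : (Fin d → ℝ) → ℂ} {δ : ℝ} (hδ : 0 < δ)
    (hu : ∀ y, ‖y‖ < δ → AbsConv (genFun T) (fun k => (y k : ℂ)) ∧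
      evalSeries (genFun T) (fun k => (y k : ℂ)) = u y)
    (han : ∀ (y : Fin d → ℝ) (t₀ : ℝ), AnalyticAt ℝ (fun t : ℝ => u (t • y)) t₀)
    (y : Fin d → ℝ) : denFun ξ lam ζ y * u y = numFun S y := by
  have hnear : ∀ y, ‖y‖ < δ → denFun ξ lam ζ y * u y = numFun S y := by
    intro y hy
    obtain ⟨h1, h2⟩ := hu y hy
    rw [← h2, ← evalSeries_denSeries, ← evalSeries_mul (absConv_denSeries _ _ _) h1, hS,
      evalSeries_numSeries]
  have hF : AnalyticOnNhd ℝ (fun t : ℝ => denFun ξ lam ζ (t • y) * u (t • y)) Set.univ :=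
    fun t _ => (analyticAt_denFun_smul lam ζ y t).mul (han y t)
  have hG : AnalyticOnNhd ℝ (fun t : ℝ => numFun S (t • y)) Set.univ :=
    fun t _ => analyticAt_numFun_smul S y t
  have key := hF.eq_of_eventuallyEq hG (z₀ := 0) (by
    have hc : Continuous fun t : ℝ => ‖t • y‖ := by fun_prop
    filter_upwards [hc.continuousAt.eventually_lt (continuousAt_const (y := δ))
      (by simpa using hδ)] with t ht
    exact hnear _ ht)
  simpa using congrFun key 1

end AbelianCoulomb

end

/-! ### The main theorem -/

theorem corollary4p2 {d n : ℕ} (ξ : Fin n → Fin d → ℤ) (b : Fin n → ℂ)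
    (ρ : AbelianCoulomb.CoulombBranch ξ b ≃+* AbelianCoulomb.CoulombBranch ξ b)
    (hρ : AbelianCoulomb.IsAdmissible ρ)
    (ζ : Fin d → ℂ)
    (hζ : ∀ v : Fin d → ℤ, ρ (ρ (AbelianCoulomb.mono ξ b v 1)) =
      AbelianCoulomb.twist ζ v • AbelianCoulomb.mono ξ b v 1)
    (T : AbelianCoulomb.CoulombBranch ξ b →ₗ[ℂ] ℂ)
    (hT : AbelianCoulomb.IsPositiveTrace ρ T)
    (lam : Submodule ℝ (Fin d → ℝ) → Fin d → ℤ)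
    (hlam : ∀ l ∈ AbelianCoulomb.lines ξ, AbelianCoulomb.IsShortestCoweight l (lam l)) :
    (∃ S, AbelianCoulomb.IsNumerator T lam ζ S) ∧
    ∃ u : (Fin d → ℝ) → ℂ, Continuous u ∧ u 0 = T 1 ∧ (∀ y, ‖u y‖ ≤ (u 0).re) ∧
      ∀ S, AbelianCoulomb.IsNumerator T lam ζ S →
        (∀ y, AbelianCoulomb.denFun ξ lam ζ y * u y = AbelianCoulomb.numFun S y) ∧
        ∀ m ∈ S.support,
          (fun k => (m k).re) ∈ AbelianCoulomb.polytope ξ lam ∧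
          ∀ F : Set (Fin d → ℝ), IsExposed ℝ (AbelianCoulomb.polytope ξ lam) F →
            (fun k => (m k).re) ∈ F →
            S m ∈ AbelianCoulomb.polysOn (affineSpan ℝ F).direction := by
  have hφ := hT.restrictTrace hρ
  have h1 : T 1 ≠ 0 := by
    intro h
    have := hφ.pos 1 one_ne_zero
    rw [map_one, one_mul, AbelianCoulomb.restrictTrace_apply, AbelianCoulomb.mono_zero_one, h] at this
    exact lt_irrefl _ this
  -- One numerator is needed before u exists, to make the generating function converge near 0. The
  -- resulting u depends on T alone and serves all numerators.
  obtain ⟨S₀, hS₀⟩ := AbelianCoulomb.exists_isNumerator hζ hT.trace h1 fun l hl => (hlam l hl).2.1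
  obtain ⟨u, hc, hbd, h0, ⟨δ, hδ, hu⟩, han⟩ :=
    hφ.exists_expGenFun (AbelianCoulomb.isGeomBounded_genFun (fun l hl => (hlam l hl).1) hS₀)
  have hden : ∀ S, AbelianCoulomb.IsNumerator T lam ζ S →
      ∀ y, AbelianCoulomb.denFun ξ lam ζ y * u y = AbelianCoulomb.numFun S y :=
    fun S hS => AbelianCoulomb.denFun_mul_eq_numFun hS hδ hu han
  exact ⟨⟨S₀, hS₀⟩, u, hc, h0, fun y => h0 ▸ hbd y, fun S hS =>
    ⟨hden S hS, fun m hm => AbelianCoulomb.mem_polytope_and_face hbd (hden S hS) hm⟩⟩
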